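/- **Model.** A randomized logspace algorithm is a probabilistic random-access machine which, given multiple access to a binary input of length $n$ and read-once access to a uniformly random bit string of length at most $\operatorname{poly}(n)$, outputs a bit using $O(\log n)$ bits of working space and $\operatorname{poly}(n)$ time. A multiple access randomized logspace algorithm has in addition multiple access (through addresses) to a second, independent uniformly random bit string of length at most $\operatorname{poly}(n)$; the bits of the second string are its multiple access random bits. **Problem.** $\mathsf{G}(n,1/2)$ is the Erdős–Rényi distribution on graphs with vertex set $[n]$. $\mathsf{kG}(\ell k,1/2,k)$ is the following distribution on graphs with vertex set $[\ell k]$: a uniformly random $k$-subset $K$ of $[\ell k]$, conditioned on containing exactly one vertex of each block $\{(i-1)\ell+1,\dots,i\ell\}$, $1\le i\le k$, is made a clique, and every other pair of vertices is joined independently with probability $1/2$. For sequences $\ell$ and $k$, an algorithm $\mathcal A$ with random string $r$ solves $\mathsf{kPC_D}(\ell k,k)$ if $$\Pr_{A\sim \mathsf{G}(\ell k,1/2),\,r}\bigl[\mathcal A(\{\ell k,k,A\},r)=0\bigr]+\Pr_{A\sim \mathsf{kG}(\ell k,1/2,k),\,r}\bigl[\mathcal A(\{\ell k,k,A\},r)=1\bigr]=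 1+\Omega(1),$$ where $A$ is the adjacency matrix of the random graph. **Conjecture (kPC-Conj-Space).** For every randomized logspace algorithm and all non-decreasing sequences of positive integers $\ell=\omega(1)$ and $k$ with $k=O(\ell^{1-\delta})$ for some constant $\delta>0$, the sum of probabilities above is $1+o(1)$. **Lemma.** Let $\ell=\omega(1)$, $k$ and $k_s$ be non-decreasing sequences of positive integers such that $k=O(\ell^{1-\delta})$ for some constant $\delta>0$ and $k_s\le k/\sqrt{\ell}$. Assume that, given $\ell k$ and $k$, one can deterministically compute $k_s$ using $O(\log \ell)$ additional bits of space. If kPC-Conj-Space is true, then no multiple access randomized logspace algorithm that uses at most $\binom{\ell k}{2}$ multiple access random bits (on the instances of $\mathsf{kPC_D}(\ell k_s,k_s)$) solves $\mathsf{kPC_D}(\ell k_s,k_s)$. -/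

import Mathlib

open Filter Topology MeasureTheory ProbabilityTheory

/-! ## The machine model

A probabilistic random-access machine with a finite control.  Its working memory consists of
finitely many work registers, each holding a binary word (a natural number), and the working space
in use is the total number of bits stored in the registers.  The input, the multiple access random
string and the read-once random string are not part of the working space.  The first two are
accessed through addresses that are stored in (and hence charged to) work registers, the last one
bit after bit, without any possibility of returning to an earlier bit.

Such machines and random-access Turing machines simulate each other with a constant factor in the
space and a polynomial factor in the time: every instruction can be carried out in space linear in
the number of bits of its operands, and two registers, multiplied and divided by the size of an
alphabet, are the two halves of a work tape. -/

/-- The instructions; `d` is the destination register, `q` the next control state. -/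
inductive RAMInstr (Reg State : Type) : Type
  /-- `d := c` for a fixed number `c` -/
  | const (d : Reg) (c : ℕ) (q : State)
  /-- `d := a + b` -/
  | add (d a b : Reg) (q : State)
  /-- `d := max (a - b) 0` -/
  | sub (d a b : Reg) (q : State)
  /-- `d := a * b` -/
  | mul (d a b : Reg) (q : State)
  /-- `d := ⌊a / b⌋` (and `0` if `b = 0`) -/
  | div (d a b : Reg) (q : State)
  /-- go to `q` if `a ≤ b`, and to `q'` otherwise -/
  | branch (a b : Reg) (q q' : State)
  /-- `d :=` the input bit at the address stored in `a`, or the end marker `2` beyond the end -/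
  | readInput (d a : Reg) (q : State)
  /-- `d :=` the bit of the multiple access random string at the address stored in `a` -/
  | readMulti (d a : Reg) (q : State)
  /-- `d :=` the next bit of the read-once random string -/
  | flip (d : Reg) (q : State)
  /-- stop and output the content of `a` -/
  | halt (a : Reg)

/-- A probabilistic random-access machine. -/
structure RAM where
  State : Type
  Reg : Type
  [finState : Finite State]
  [fintypeReg : Fintype Reg]
  [decReg : DecidableEq Reg]
  start : State
  code : State → RAMInstr Reg State

namespace RAM

attribute [instance] RAM.finState RAM.fintypeReg RAM.decReg

/-- A configuration: the control state, the contents of the work registers, and the position on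
the read-once random string. -/
@[ext]
structure Cfg (M : RAM) where
  state : M.State
  regs : M.Reg → ℕ
  coin : ℕ

/-- The initial configuration: all registers hold `0`. -/
def init (M : RAM) : M.Cfg := ⟨M.start, fun _ => 0, 0⟩

/-- The value read at address `a` of the binary input `x`; `2` marks the end of the input. -/
def inputAt (x : List Bool) (a : ℕ) : ℕ :=
  match x[a]? with
  | some b => b.toNat
  | none => 2

/-- One step of `M` on the input `x` with read-once random string `ro` and multiple access random
string `ma`.  A halting configuration stays as it is. -/
def step (M : RAM) (x : List Bool) (ro ma : ℕ → Bool) (c : M.Cfg) : M.Cfg :=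
  match M.code c.state with
  | .const d v q => ⟨q, Function.update c.regs d v, c.coin⟩
  | .add d a b q => ⟨q, Function.update c.regs d (c.regs a + c.regs b), c.coin⟩
  | .sub d a b q => ⟨q, Function.update c.regs d (c.regs a - c.regs b), c.coin⟩
  | .mul d a b q => ⟨q, Function.update c.regs d (c.regs a * c.regs b), c.coin⟩
  | .div d a b q => ⟨q, Function.update c.regs d (c.regs a / c.regs b), c.coin⟩
  | .branch a b q q' => ⟨if c.regs a ≤ c.regs b then q else q', c.regs, c.coin⟩
  | .readInput d a q => ⟨q, Function.update c.regs d (inputAt x (c.regs a)), c.coin⟩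
  | .readMulti d a q => ⟨q, Function.update c.regs d (ma (c.regs a)).toNat, c.coin⟩
  | .flip d q => ⟨q, Function.update c.regs d (ro c.coin).toNat, c.coin + 1⟩
  | .halt _ => c

/-- The configuration after `t` steps. -/
def run (M : RAM) (x : List Bool) (ro ma : ℕ → Bool) (t : ℕ) : M.Cfg :=
  (M.step x ro ma)^[t] M.init

/-- After `t` steps `M` has halted with output `y`. -/
def HaltsWith (M : RAM) (x : List Bool) (ro ma : ℕ → Bool) (t y : ℕ) : Prop :=
  ∃ a, M.code (M.run x ro ma t).state = .halt a ∧ (M.run x ro ma t).regs a = y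

/-- `M` halts with the output bit `b`; every nonzero output is read as the bit `1`. -/
def Answers (M : RAM) (x : List Bool) (ro ma : ℕ → Bool) (b : Bool) : Prop :=
  ∃ t y, M.HaltsWith x ro ma t y ∧ b = decide (y ≠ 0)

/-- The number of bits of working space in use in a configuration. -/
def Cfg.space {M : RAM} (c : M.Cfg) : ℕ := ∑ r, (c.regs r).size

/-- Multiple access randomized logspace algorithms: on every binary input of length `n`, whatever
the random strings are, `M` halts within `poly(n)` steps and uses `O(log n)` bits of working space.
In particular it looks at only `poly(n)` bits of either random string. -/
def IsMultiAccessRandomizedLogspace (M : RAM) : Prop :=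
  ∃ C : ℕ, ∀ (x : List Bool) (ro ma : ℕ → Bool),
    (∃ t ≤ C * (x.length ^ C + 1), ∃ y, M.HaltsWith x ro ma t y) ∧
    ∀ t, (M.run x ro ma t).space ≤ C * (Nat.log 2 x.length + 1)

/-- `M` never accesses the multiple access random string. -/
def NoMulti (M : RAM) : Prop := ∀ q d a q', M.code q ≠ .readMulti d a q'

/-- `M` never accesses the read-once random string. -/
def NoFlip (M : RAM) : Prop := ∀ q d q', M.code q ≠ .flip d q'

/-- Randomized logspace algorithms: all randomness is read-once. -/
def IsRandomizedLogspace (M : RAM) : Prop :=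
  M.IsMultiAccessRandomizedLogspace ∧ M.NoMulti

/-- On input `x`, `M` uses at most the first `R` bits of its multiple access random string. -/
def UsesMultiAtMost (M : RAM) (x : List Bool) (R : ℕ) : Prop :=
  ∀ (ro ma : ℕ → Bool) (t : ℕ) (d a : M.Reg) (q : M.State),
    M.code (M.run x ro ma t).state = .readMulti d a q → (M.run x ro ma t).regs a < R

end RAM

/-! ## The `k`-partite planted clique problem -/

/-- The Erdős–Rényi distribution `G(n, 1/2)`. -/
noncomputable def erdosRenyi (n : ℕ) : Measure (SimpleGraph (Fin n)) :=
  SimpleGraph.binomialRandom (Fin n) ⟨1 / 2, by norm_num, by norm_num⟩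

/-- The graph `G` with all edges between distinct vertices of `K` added. -/
def plantClique {n : ℕ} (K : Finset (Fin n)) (G : SimpleGraph (Fin n)) : SimpleGraph (Fin n) :=
  G ⊔ SimpleGraph.fromRel fun u v => u ∈ K ∧ v ∈ K

/-- The joint law of a uniformly random set `K` of `k` of the `n` vertices and an independent
sample of `G(n, 1/2)`, so that `plantClique` maps it to the planted clique distribution
`G(n, 1/2, k)`. -/
noncomputable def plantedPair (n k : ℕ) : Measure (Finset (Fin n) × SimpleGraph (Fin n)) :=
  (uniformOn {K : Finset (Fin n) | K.card = k}).prod (erdosRenyi n)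

/-- Each of the `k` consecutive blocks of `ℓ` vertices contains exactly one vertex of `K`. -/
def OnePerBlock (ℓ k : ℕ) (K : Finset (Fin (ℓ * k))) : Prop :=
  ∀ j < k, (K.filter fun v : Fin (ℓ * k) => j * ℓ ≤ (v : ℕ) ∧ (v : ℕ) < (j + 1) * ℓ).card = 1

/-- The `k`-partite planted clique distribution `kG(ℓ * k, 1/2, k)`: the planted clique
distribution `G(ℓ * k, 1/2, k)` conditioned on exactly one clique vertex in each block. -/
noncomputable def kPartitePlanted (ℓ k : ℕ) : Measure (SimpleGraph (Fin (ℓ * k))) :=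
  (cond (plantedPair (ℓ * k) k) {p | OnePerBlock ℓ k p.1}).map fun p => plantClique p.1 p.2

/-- A binary encoding of the pair of numbers `N`, `k`. -/
def encodePair (N k : ℕ) : List Bool :=
  List.replicate N true ++ false :: (List.replicate k true ++ [false])

open Classical in
/-- The binary encoding of the triple consisting of the number `n` of vertices, the clique size
`k`, and the `n²`-bit adjacency matrix of `G`.  It has length `n + k + 2 + n²`. -/
noncomputable def encodeInstance {n : ℕ} (k : ℕ) (G : SimpleGraph (Fin n)) : List Bool :=
  encodePair n k ++ List.ofFn fun p : Fin (n * n) => decide (G.Adj p.divNat p.modNat)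

/-- An infinite sequence of independent uniformly random bits. -/
noncomputable def fairBits : Measure (ℕ → Bool) :=
  Measure.infinitePi fun _ => uniformOn (Set.univ : Set Bool)

/-- The probability that `M` answers `b` on the instance with vertex number `n`, clique size `k`,
and random graph of law `μ`.  The graph, the read-once random string and the multiple access random
string are independent; machines without multiple access randomness ignore the latter. -/
noncomputable def answerProb (M : RAM) {n : ℕ} (k : ℕ) (μ : Measure (SimpleGraph (Fin n)))
    (b : Bool) : ℝ :=
  (μ.prod (fairBits.prod fairBits)).real
    {ω | M.Answers (encodeInstance k ω.1) ω.2.1 ω.2.2 b}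

/-- The probability of answering `0` on `G(ℓ * k, 1/2)` plus the probability of answering `1` on
`kG(ℓ * k, 1/2, k)`. -/
noncomputable def kPCSuccess (M : RAM) (ℓ k : ℕ) : ℝ :=
  answerProb M k (erdosRenyi (ℓ * k)) false + answerProb M k (kPartitePlanted ℓ k) true

/-- `M` solves the `k`-partite planted clique detection problem `kPC_D(ℓ * k, k)` for the given
sequences of parameters: its success is `1 + Ω(1)`. -/
def SolvesKPC (M : RAM) (ℓ k : ℕ → ℕ) : Prop :=
  ∃ c : ℝ, 0 < c ∧ ∀ᶠ i in atTop, 1 + c ≤ kPCSuccess M (ℓ i) (k i)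

/-- Non-decreasing sequences of positive integers. -/
def IsParamSeq (s : ℕ → ℕ) : Prop := Monotone s ∧ ∀ i, 0 < s i

/-- `k = O(ℓ ^ (1 - δ))` for some constant `δ > 0`. -/
def PolyBelow (k ℓ : ℕ → ℕ) : Prop :=
  ∃ δ : ℝ, 0 < δ ∧ (fun i => (k i : ℝ)) =O[atTop] fun i => (ℓ i : ℝ) ^ (1 - δ)

/-- The logspace `k`-partite planted clique conjecture. -/
def KPCConjSpace : Prop :=
  ∀ M : RAM, M.IsRandomizedLogspace → ∀ ℓ k : ℕ → ℕ, IsParamSeq ℓ → IsParamSeq k →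
    Tendsto ℓ atTop atTop → PolyBelow k ℓ →
    Tendsto (fun i => kPCSuccess M (ℓ i) (k i)) atTop (𝓝 1)

/-- Given `ℓ * k` and `k`, a deterministic machine computes `ks` with `O(log ℓ)` bits of working
space. -/
def ComputableInLogSpace (ℓ k ks : ℕ → ℕ) : Prop :=
  ∃ (M : RAM) (C : ℕ), M.NoMulti ∧ M.NoFlip ∧ ∀ (i : ℕ) (ro ma : ℕ → Bool),
    (∃ t, M.HaltsWith (encodePair (ℓ i * k i) (k i)) ro ma t (ks i)) ∧
    ∀ t, (M.run (encodePair (ℓ i * k i) (k i)) ro ma t).space ≤ C * (Nat.log 2 (ℓ i) + 1)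

open scoped BigOperators

/-! Suppose `S` solves the problem with parameters `ℓ`, `ks`. Two randomized logspace algorithms for
the parameters `ℓ`, `3 * k` are built from `S`, and the conjecture is applied to both. Write `W = ℓ
* k`. Given a graph on `3 * k` blocks, both algorithms simulate `S`, pass on the read-once string
unchanged, and answer each multiple access query from the `W * W` edges between the middle `k`
blocks and the last `k` blocks. They differ in the instance shown to `S`. The first algorithm
(`readSub`) shows the subgraph on the first `ks` blocks. The second (`readSim`) shows a planted
instance that it generates itself, always planted whatever the input is.

On an unplanted input the multiple access bits are fair. On a planted input they are fair bits with
a mask or-ed in, the mask depending only on the clique in the last `2 * k` blocks and hence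
independent of the instance shown to `S`. Let `p(null, fair)`, `p(planted, fair)` and `p(planted,
masked)` be the probabilities that `S` answers `1`. The first algorithm has success `1 - p(null,
fair) + p(planted, masked)`, the second approximately `1 - p(planted, fair) + p(planted, masked)`.
In the difference the masked term, about which nothing is known, cancels, and what remains is the
success of `S` minus `1` (`abs_kPCSuccess_sub_le`). By the conjecture both successes tend to `1`, so
the success of `S` tends to `1` as well.

The second algorithm needs random bits that can be read repeatedly and are fair even on planted
inputs. These are the edges inside a block: the clique has one vertex per block, so planting changes
none of them (`cleanBit_plantClique`). Only edges between the two halves of a block are used, which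
makes the indexing simple. About `(ℓ * ks) ^ 2` bits are needed and about `3 * k * ℓ ^ 2 / 4` are
available; `ks ≤ k / √ℓ` and `k = o(ℓ)` make this sufficient (`capacity`). A clique position is an
`ℓ`-bit number modulo `ℓ`; its bias gives the total error `2 * ks * ℓ / 2 ^ ℓ`, which vanishes
(`abs_expect_bitsPos_sub_le`, `tendsto_error`).

The remaining work is to show that both algorithms are machines of the model. A small imperative
language with values cut off at a polynomial bound is compiled to machines (`Prog.exists_RAM`). A
program in it simulates any machine whose input symbols are recomputed on demand
(`SimRegs.eval_simProg`), and is used first for the machine that computes `ks` and then for `S`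
(`Reduction.exists_reduction`). -/

/-! ## Program fragments -/

namespace RAMInstr

variable {Reg σ τ : Type}

/-- Rename the control states of an instruction. -/
def map (f : σ → τ) : RAMInstr Reg σ → RAMInstr Reg τ
  | const d c q => const d c (f q)
  | add d a b q => add d a b (f q)
  | sub d a b q => sub d a b (f q)
  | mul d a b q => mul d a b (f q)
  | div d a b q => div d a b (f q)
  | branch a b q q' => branch a b (f q) (f q')
  | readInput d a q => readInput d a (f q)
  | readMulti d a q => readMulti d a (f q)
  | flip d q => flip d (f q)
  | halt a => halt a

/-- Execute an instruction at the control state `q` with register contents `ρ` and `n` read-once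
bits already read. -/
def exec [DecidableEq Reg] (x : List Bool) (ro ma : ℕ → Bool) (q : σ) (i : RAMInstr Reg σ)
    (ρ : Reg → ℕ) (n : ℕ) : σ × (Reg → ℕ) × ℕ :=
  match i with
  | .const d v q => ⟨q, Function.update ρ d v, n⟩
  | .add d a b q => ⟨q, Function.update ρ d (ρ a + ρ b), n⟩
  | .sub d a b q => ⟨q, Function.update ρ d (ρ a - ρ b), n⟩
  | .mul d a b q => ⟨q, Function.update ρ d (ρ a * ρ b), n⟩
  | .div d a b q => ⟨q, Function.update ρ d (ρ a / ρ b), n⟩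
  | .branch a b q q' => ⟨if ρ a ≤ ρ b then q else q', ρ, n⟩
  | .readInput d a q => ⟨q, Function.update ρ d (RAM.inputAt x (ρ a)), n⟩
  | .readMulti d a q => ⟨q, Function.update ρ d (ma (ρ a)).toNat, n⟩
  | .flip d q => ⟨q, Function.update ρ d (ro n).toNat, n + 1⟩
  | .halt _ => ⟨q, ρ, n⟩

theorem exec_map [DecidableEq Reg] (x : List Bool) (ro ma : ℕ → Bool) (q : σ)
    (i : RAMInstr Reg σ) (ρ : Reg → ℕ) (n : ℕ) (f : σ → τ) :
    (i.map f).exec x ro ma (f q) ρ n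
      = (f (i.exec x ro ma q ρ n).1, (i.exec x ro ma q ρ n).2) := by
  cases i <;> simp [map, exec, apply_ite f]

/-- The instruction does not access the multiple access random string. -/
def NoMulti : RAMInstr Reg σ → Prop
  | readMulti _ _ _ => False
  | _ => True

theorem NoMulti.map {i : RAMInstr Reg σ} (h : i.NoMulti) (f : σ → τ) : (i.map f).NoMulti := by
  cases i <;> simp_all [NoMulti, RAMInstr.map]

end RAMInstr

/-- A piece of code with one entry; the exit is the state `none`. -/
structure Frag (Reg : Type) where
  St : Type
  [finite : Finite St]
  start : St
  code : St → RAMInstr Reg (Option St)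
  noMulti : ∀ s, (code s).NoMulti

attribute [instance] Frag.finite

namespace Frag

variable {Reg : Type} [DecidableEq Reg]

/-- Runs of a fragment of a given length during which all registers stay below `W`. -/
inductive Run (F : Frag Reg) (x : List Bool) (ro ma : ℕ → Bool) (W : ℕ) :
    ℕ → Option F.St × (Reg → ℕ) × ℕ → Option F.St × (Reg → ℕ) × ℕ → Prop
  | refl (c) : (∀ r, c.2.1 r ≤ W) → Run F x ro ma W 0 c c
  | head {s ρ n T c} : (∀ r, ρ r ≤ W) →
      Run F x ro ma W T ((F.code s).exec x ro ma (some s) ρ n) c →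
      Run F x ro ma W (T + 1) (some s, ρ, n) c

variable {x : List Bool} {ro ma : ℕ → Bool} {W : ℕ}

theorem Run.trans {F : Frag Reg} {T T' a b c} (h : F.Run x ro ma W T a b)
    (h' : F.Run x ro ma W T' b c) : F.Run x ro ma W (T + T') a c := by
  induction h with
  | refl => simpa using h'
  | head hρ _ ih =>
    have := Run.head hρ (ih h')
    rwa [Nat.add_right_comm] at this

theorem Run.le_right {F : Frag Reg} {T a b} (h : F.Run x ro ma W T a b) : ∀ r, b.2.1 r ≤ W := by
  induction h with
  | refl _ h => exact h
  | head _ _ ih => exact ih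

theorem Run.le_left {F : Frag Reg} {T a b} (h : F.Run x ro ma W T a b) : ∀ r, a.2.1 r ≤ W := by
  cases h with
  | refl _ h => exact h
  | head h _ => exact h

/-- All control structures are built by embedding the control states of a fragment into a larger
fragment. The map `φ` may send the exit `none` to any state, for instance to the entry of the next
fragment, so this one transport statement covers sequencing, branching and loops. -/
theorem Run.map {F G : Frag Reg} (φ : Option F.St → Option G.St)
    (hφ : ∀ s, ∃ s', φ (some s) = some s' ∧ G.code s' = (F.code s).map φ) {T a b}
    (h : F.Run x ro ma W T a b) : G.Run x ro ma W T (φ a.1, a.2) (φ b.1, b.2) := by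
  induction h with
  | refl c h => exact .refl _ h
  | @head s ρ n T c hρ _ ih =>
    obtain ⟨s', hs, hc⟩ := hφ s
    simp only [hs]
    refine .head hρ ?_
    rw [hc, ← hs, RAMInstr.exec_map]
    exact ih

/-- The fragment transforms `(ρ, n)` into `(ρ', n')` within `T` steps, with registers below `W`. -/
def Spec (F : Frag Reg) (x : List Bool) (ro ma : ℕ → Bool) (W T : ℕ) (ρ : Reg → ℕ) (n : ℕ)
    (ρ' : Reg → ℕ) (n' : ℕ) : Prop :=
  ∃ t ≤ T, F.Run x ro ma W t (some F.start, ρ, n) (none, ρ', n')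

theorem Spec.le_right {F : Frag Reg} {T ρ n ρ' n'} (h : F.Spec x ro ma W T ρ n ρ' n') :
    ∀ r, ρ' r ≤ W := by
  obtain ⟨t, -, h⟩ := h
  exact h.le_right

theorem Spec.mono {F : Frag Reg} {T T' ρ n ρ' n'} (h : F.Spec x ro ma W T ρ n ρ' n')
    (hT : T ≤ T') : F.Spec x ro ma W T' ρ n ρ' n' := by
  obtain ⟨t, ht, h⟩ := h
  exact ⟨t, ht.trans hT, h⟩

/-- A single instruction. -/
def instr (i : RAMInstr Reg Unit) (hi : i.NoMulti) : Frag Reg where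
  St := Unit
  start := ()
  code _ := i.map fun _ => none
  noMulti _ := hi.map _

theorem instr_spec {i : RAMInstr Reg Unit} {hi : i.NoMulti} {ρ n ρ' n'}
    (h : (i.map fun _ => (none : Option Unit)).exec x ro ma (some ()) ρ n = (none, ρ', n'))
    (hρ : ∀ r, ρ r ≤ W) (hρ' : ∀ r, ρ' r ≤ W) : (instr i hi).Spec x ro ma W 1 ρ n ρ' n' := by
  refine ⟨1, le_rfl, .head hρ ?_⟩
  have : ((instr i hi).code (instr i hi).start).exec x ro ma (some (instr i hi).start) ρ n
    = (none, ρ', n') := h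
  rw [this]
  exact .refl _ hρ'

/-- Sequential composition. -/
def seq (F G : Frag Reg) : Frag Reg where
  St := F.St ⊕ G.St
  start := .inl F.start
  code
    | .inl s => (F.code s).map fun o => o.elim (some (.inr G.start)) fun t => some (.inl t)
    | .inr s => (G.code s).map (Option.map .inr)
  noMulti s := by
    cases s with
    | inl s => exact (F.noMulti s).map _
    | inr s => exact (G.noMulti s).map _

theorem Spec.then {F G : Frag Reg} {T T' ρ n ρ' n' ρ'' n''} (hF : F.Spec x ro ma W T ρ n ρ' n')
    (hG : G.Spec x ro ma W T' ρ' n' ρ'' n'') :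
    (F.seq G).Spec x ro ma W (T + T') ρ n ρ'' n'' := by
  obtain ⟨t, ht, hF⟩ := hF
  obtain ⟨t', ht', hG⟩ := hG
  refine ⟨t + t', by omega, ?_⟩
  have h1 := hF.map (G := F.seq G)
    (fun o => o.elim (some (.inr G.start)) fun t => some (.inl t)) fun s => ⟨_, rfl, rfl⟩
  have h2 := hG.map (G := F.seq G) (Option.map .inr) fun s => ⟨_, rfl, rfl⟩
  exact h1.trans h2

/-- Case distinction on `ρ a ≤ ρ b`. -/
def ite (a b : Reg) (F G : Frag Reg) : Frag Reg where
  St := Option (F.St ⊕ G.St)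
  start := none
  code
    | none => .branch a b (some (some (.inl F.start))) (some (some (.inr G.start)))
    | some (.inl s) => (F.code s).map (Option.map fun s => some (.inl s))
    | some (.inr s) => (G.code s).map (Option.map fun s => some (.inr s))
  noMulti s := by
    match s with
    | none => trivial
    | some (.inl s) => exact (F.noMulti s).map _
    | some (.inr s) => exact (G.noMulti s).map _

theorem ite_spec_pos {a b : Reg} {F G : Frag Reg} {T ρ n ρ' n'} (hab : ρ a ≤ ρ b)
    (hF : F.Spec x ro ma W T ρ n ρ' n') : (ite a b F G).Spec x ro ma W (T + 1) ρ n ρ' n' := by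
  obtain ⟨t, ht, hF⟩ := hF
  refine ⟨t + 1, by omega, .head hF.le_left ?_⟩
  have h1 := hF.map (G := ite a b F G) (Option.map fun s => some (.inl s)) fun s => ⟨_, rfl, rfl⟩
  simpa [ite, RAMInstr.exec, hab] using h1

theorem ite_spec_neg {a b : Reg} {F G : Frag Reg} {T ρ n ρ' n'} (hab : ¬ ρ a ≤ ρ b)
    (hG : G.Spec x ro ma W T ρ n ρ' n') : (ite a b F G).Spec x ro ma W (T + 1) ρ n ρ' n' := by
  obtain ⟨t, ht, hG⟩ := hG
  refine ⟨t + 1, by omega, .head hG.le_left ?_⟩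
  have h1 := hG.map (G := ite a b F G) (Option.map fun s => some (.inr s)) fun s => ⟨_, rfl, rfl⟩
  simpa [ite, RAMInstr.exec, hab] using h1

/-- Repeat `F` as often as the register `c` says; `c` is counted down and `t` is an auxiliary
register. -/
def countdown (c t : Reg) (F : Frag Reg) : Frag Reg where
  St := Fin 3 ⊕ F.St
  start := .inl 0
  code
    | .inl 0 => .const t 1 (some (.inl 1))
    | .inl 1 => .branch t c (some (.inl 2)) none
    | .inl 2 => .sub c c t (some (.inr F.start))
    | .inr s => (F.code s).map fun o => some (o.elim (.inl 0) .inr)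
  noMulti s := by
    match s with
    | .inl 0 => trivial
    | .inl 1 => trivial
    | .inl 2 => trivial
    | .inr s => exact (F.noMulti s).map _

theorem countdown_enter {c t : Reg} (hct : c ≠ t) {F : Frag Reg} {ρ n u b} (hW : 1 ≤ W)
    (hρ : ∀ r, ρ r ≤ W) (h : 1 ≤ ρ c)
    (h' : (countdown c t F).Run x ro ma W u (some (.inr F.start),
      Function.update (Function.update ρ t 1) c (ρ c - 1), n) b) :
    (countdown c t F).Run x ro ma W (u + 3) (some (countdown c t F).start, ρ, n) b := by
  have hle : ∀ r, Function.update ρ t 1 r ≤ W := by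
    intro r
    by_cases hr : r = t
    · subst hr; simpa using hW
    · simpa [hr] using hρ r
  refine .head hρ ?_
  change (countdown c t F).Run x ro ma W _ (some (.inl 1), Function.update ρ t 1, n) b
  refine .head hle ?_
  simp only [RAMInstr.exec, countdown, Function.update_self, Function.update_of_ne hct, if_pos h]
  change (countdown c t F).Run x ro ma W _ (some (.inl 2), Function.update ρ t 1, n) b
  refine .head hle ?_
  simpa only [RAMInstr.exec, countdown, Function.update_self, Function.update_of_ne hct] using h'

theorem countdown_exit {c t : Reg} (hct : c ≠ t) {F : Frag Reg} {ρ n} (hW : 1 ≤ W)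
    (hρ : ∀ r, ρ r ≤ W) (h : ρ c = 0) :
    (countdown c t F).Run x ro ma W 2 (some (countdown c t F).start, ρ, n)
      (none, Function.update ρ t 1, n) := by
  have hle : ∀ r, Function.update ρ t 1 r ≤ W := by
    intro r
    by_cases hr : r = t
    · subst hr; simpa using hW
    · simpa [hr] using hρ r
  refine .head hρ ?_
  change (countdown c t F).Run x ro ma W _ (some (.inl 1), Function.update ρ t 1, n) _
  refine .head hle ?_
  simp only [RAMInstr.exec, countdown, Function.update_self, Function.update_of_ne hct, h]
  exact .refl _ hle

/-- A loop invariant rule: `P m` is the invariant with `m` rounds left. The body starts after the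
counter has been decremented and `t` set to `1`; it may overwrite `t`, which is reset before every
test. -/
theorem countdown_spec {c t : Reg} (hct : c ≠ t) {F : Frag Reg} {T : ℕ} (hW : 1 ≤ W)
    (P : ℕ → (Reg → ℕ) → ℕ → Prop) (hc : ∀ m ρ n, P m ρ n → ρ c = m ∧ ∀ r, ρ r ≤ W)
    (hstep : ∀ m ρ n, P (m + 1) ρ n → ∃ ρ' n',
      F.Spec x ro ma W T (Function.update (Function.update ρ t 1) c m) n ρ' n' ∧ P m ρ' n')
    (m : ℕ) : ∀ ρ n, P m ρ n → ∃ ρ' n', P 0 ρ' n' ∧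
      (countdown c t F).Spec x ro ma W (m * (T + 3) + 2) ρ n (Function.update ρ' t 1) n' := by
  induction m with
  | zero =>
    intro ρ n h
    obtain ⟨h1, h2⟩ := hc _ _ _ h
    exact ⟨ρ, n, h, 2, by omega, countdown_exit hct hW h2 h1⟩
  | succ m ih =>
    intro ρ n h
    obtain ⟨ρ', n', ⟨u, hu, hF⟩, hP⟩ := hstep m ρ n h
    obtain ⟨ρ'', n'', hP', ⟨u', hu', h'⟩⟩ := ih ρ' n' hP
    obtain ⟨h1, h2⟩ := hc _ _ _ h
    refine ⟨ρ'', n'', hP', u + u' + 3, ?_, countdown_enter hct hW h2 (by omega) ?_⟩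
    · rw [Nat.add_mul]; omega
    have h3 := hF.map (G := countdown c t F) (fun o => some (o.elim (.inl 0) .inr))
      fun s => ⟨_, rfl, rfl⟩
    rw [h1]
    exact h3.trans h'

end Frag

/-! ## A small programming language -/

/-- Expressions over registers from `R`. -/
inductive Expr (R : Type) : Type
  | reg (r : R)
  | const (c : ℕ)
  | bound
  | add (a b : Expr R)
  | sub (a b : Expr R)
  | mul (a b : Expr R)
  | div (a b : Expr R)
  | ite (a b c d : Expr R)
  | input (a : Expr R)

namespace Expr

variable {R : Type}

/-- The value of an expression on the input `x` when the bound is `B` and the registers hold `v`. -/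
def eval (x : List Bool) (B : ℕ) (v : R → ℕ) : Expr R → ℕ
  | reg r => v r
  | const c => c
  | bound => B
  | add a b => a.eval x B v + b.eval x B v
  | sub a b => a.eval x B v - b.eval x B v
  | mul a b => a.eval x B v * b.eval x B v
  | div a b => a.eval x B v / b.eval x B v
  | ite a b c d => if a.eval x B v ≤ b.eval x B v then c.eval x B v else d.eval x B v
  | input a => RAM.inputAt x (a.eval x B v)

end Expr

/-- Programs over registers from `R`. -/
inductive Prog (R : Type) : Type
  | assign (r : R) (e : Expr R)
  | flip (r : R)
  | seq (p q : Prog R)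
  | ite (a b : Expr R) (p q : Prog R)
  | loop (e : Expr R) (p : Prog R)

namespace Prog

variable {R : Type} [DecidableEq R]

/-- The effect of a program on the registers and on the position of the read-once random string.
Assigned values are cut off at `B`. -/
def eval (x : List Bool) (ro : ℕ → Bool) (B : ℕ) : Prog R → (R → ℕ) × ℕ → (R → ℕ) × ℕ
  | assign r e, s => (Function.update s.1 r (min (e.eval x B s.1) B), s.2)
  | flip r, s => (Function.update s.1 r (ro s.2).toNat, s.2 + 1)
  | seq p q, s => q.eval x ro B (p.eval x ro B s)
  | ite a b p q, s =>
    if a.eval x B s.1 ≤ b.eval x B s.1 then p.eval x ro B s else q.eval x ro B s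
  | loop e p, s => (p.eval x ro B)^[e.eval x B s.1] s

theorem eval_le {x : List Bool} {ro : ℕ → Bool} {B : ℕ} (hB : 1 ≤ B) (p : Prog R) :
    ∀ s : (R → ℕ) × ℕ, (∀ r, s.1 r ≤ B) → ∀ r, (p.eval x ro B s).1 r ≤ B := by
  induction p with
  | assign r e =>
    intro s hs r'
    by_cases h : r' = r
    · subst h; simp [eval]
    · simp [eval, h, hs]
  | flip r =>
    intro s hs r'
    by_cases h : r' = r
    · subst h; simpa [eval] using (Bool.toNat_le _).trans hB
    · simp [eval, h, hs]
  | seq p q hp hq => exact fun s hs => hq _ (hp s hs)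
  | ite a b p q hp hq =>
    intro s hs
    simp only [eval]
    split_ifs
    · exact hp s hs
    · exact hq s hs
  | loop e p hp =>
    intro s hs
    simp only [eval]
    induction e.eval x B s.1 generalizing s with
    | zero => simpa using hs
    | succ m ih => exact ih _ (hp s hs)

end Prog

/-! ## Compilation of programs -/

/-- All time and size bounds below are kept in the form of a single power of `B`; this absorbs a sum
of two costs into the exponent. -/
theorem Nat.pow_add_pow_le_pow {B : ℕ} (hB : 2 ≤ B) (a b : ℕ) :
    B ^ a + B ^ b ≤ B ^ (a + b + 1) := by
  have h1 : B ^ a ≤ B ^ (a + b) := Nat.pow_le_pow_right (by omega) (by omega)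
  have h2 : B ^ b ≤ B ^ (a + b) := Nat.pow_le_pow_right (by omega) (by omega)
  have h3 : B ^ (a + b) * 2 ≤ B ^ (a + b) * B := Nat.mul_le_mul_left _ hB
  rw [pow_succ]
  omega

theorem RAM.inputAt_le (x : List Bool) (a : ℕ) : RAM.inputAt x a ≤ 2 := by
  unfold RAM.inputAt
  split
  · exact (Bool.toNat_le _).trans (by omega)
  · exact le_rfl

/-- Only assigned values are cut off at `B`; intermediate values may exceed it, but only
polynomially, with an exponent that depends on the expression alone. This is why compiled code works
with a second bound `W`, a power of `B`. -/
theorem Expr.exists_eval_le {R : Type} (e : Expr R) : ∃ c, ∀ x B (v : R → ℕ), 2 ≤ B →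
    (∀ r, v r ≤ B) → e.eval x B v ≤ B ^ c := by
  induction e with
  | reg r => exact ⟨1, fun x B v _ hv => by simpa [eval] using hv r⟩
  | const c =>
    refine ⟨c, fun x B v hB _ => ?_⟩
    exact (Nat.lt_two_pow_self.le).trans (Nat.pow_le_pow_left hB c)
  | bound => exact ⟨1, fun x B v _ _ => by simp [eval]⟩
  | add a b ha hb =>
    obtain ⟨ca, ha⟩ := ha
    obtain ⟨cb, hb⟩ := hb
    exact ⟨ca + cb + 1, fun x B v hB hv => (add_le_add (ha x B v hB hv) (hb x B v hB hv)).trans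
      (Nat.pow_add_pow_le_pow hB _ _)⟩
  | sub a b ha _ =>
    obtain ⟨ca, ha⟩ := ha
    exact ⟨ca, fun x B v hB hv => (Nat.sub_le _ _).trans (ha x B v hB hv)⟩
  | mul a b ha hb =>
    obtain ⟨ca, ha⟩ := ha
    obtain ⟨cb, hb⟩ := hb
    refine ⟨ca + cb, fun x B v hB hv => ?_⟩
    rw [pow_add]
    exact Nat.mul_le_mul (ha x B v hB hv) (hb x B v hB hv)
  | div a b ha _ =>
    obtain ⟨ca, ha⟩ := ha
    exact ⟨ca, fun x B v hB hv => (Nat.div_le_self _ _).trans (ha x B v hB hv)⟩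
  | ite a b c d _ _ hc hd =>
    obtain ⟨cc, hc⟩ := hc
    obtain ⟨cd, hd⟩ := hd
    refine ⟨cc + cd, fun x B v hB hv => ?_⟩
    simp only [eval]
    split_ifs
    · exact (hc x B v hB hv).trans (Nat.pow_le_pow_right (by omega) (by omega))
    · exact (hd x B v hB hv).trans (Nat.pow_le_pow_right (by omega) (by omega))
  | input a _ =>
    exact ⟨1, fun x B v hB _ => (RAM.inputAt_le _ _).trans (by simpa using hB)⟩

/-- The register contents `ρ` are admissible for compiled code: the visible registers are below
`B`, the hidden register `0` holds `B`, and all registers are below `W`. -/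
structure Admissible {R : Type} {D : ℕ} (B W : ℕ) (ρ : R ⊕ Fin D → ℕ) : Prop where
  visible : ∀ r, ρ (.inl r) ≤ B
  bound : ∀ i : Fin D, (i : ℕ) = 0 → ρ (.inr i) = B
  le : ∀ r, ρ r ≤ W

/-- The visible registers and the hidden registers below `d` agree. -/
structure AgreeBelow {R : Type} {D : ℕ} (d : ℕ) (ρ ρ' : R ⊕ Fin D → ℕ) : Prop where
  visible : ρ' ∘ Sum.inl = ρ ∘ Sum.inl
  hidden : ∀ i : Fin D, (i : ℕ) < d → ρ' (.inr i) = ρ (.inr i)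

section

variable {R : Type} {D : ℕ} {B W d e : ℕ} {ρ ρ' ρ'' : R ⊕ Fin D → ℕ}

theorem AgreeBelow.refl : AgreeBelow d ρ ρ := ⟨rfl, fun _ _ => rfl⟩

theorem AgreeBelow.trans (h : AgreeBelow d ρ ρ') (h' : AgreeBelow e ρ' ρ'') (hde : d ≤ e) :
    AgreeBelow d ρ ρ'' :=
  ⟨h'.visible.trans h.visible, fun i hi => (h'.hidden i (by omega)).trans (h.hidden i hi)⟩

theorem AgreeBelow.update [DecidableEq R] {i : Fin D} (h : AgreeBelow d ρ ρ') (hi : d ≤ i) (a : ℕ) :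
    AgreeBelow d ρ (Function.update ρ' (.inr i) a) := by
  refine ⟨?_, fun j hj => ?_⟩
  · rw [← h.visible]
    funext r
    simp
  · rw [← h.hidden j hj, Function.update_of_ne]
    rintro h
    cases h
    omega

theorem Admissible.of_agree (h : Admissible B W ρ) (h' : AgreeBelow d ρ ρ') (hd : 0 < d)
    (hW : ∀ r, ρ' r ≤ W) : Admissible B W ρ' where
  visible r := by
    have := congrFun h'.visible r
    simp only [Function.comp] at this
    rw [this]
    exact h.visible r
  bound i hi := by rw [h'.hidden i (by omega), h.bound i hi]
  le := hW

theorem update_le [DecidableEq R] {r : R ⊕ Fin D} {a : ℕ} (h : ∀ r, ρ r ≤ W) (ha : a ≤ W) :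
    ∀ r', Function.update ρ r a r' ≤ W := by
  intro r'
  by_cases h' : r' = r
  · subst h'; simpa using ha
  · simpa [h'] using h r'

end

namespace Expr

variable {R : Type} [DecidableEq R]

/-- A fragment evaluates an expression into the hidden register `d`. -/
def Computes {D : ℕ} (e : Expr R) (c d : ℕ) (F : Frag (R ⊕ Fin D)) : Prop :=
  ∀ x ro ma B W (ρ : R ⊕ Fin D → ℕ) k, 2 ≤ B → B ^ c ≤ W → Admissible B W ρ →
    ∃ ρ', F.Spec x ro ma W (B ^ c) ρ k ρ' k ∧ AgreeBelow d ρ ρ' ∧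
      ∀ i : Fin D, (i : ℕ) = d → ρ' (.inr i) = e.eval x B (ρ ∘ Sum.inl)

/-- The expression can be compiled. -/
def Compilable (e : Expr R) : Prop :=
  ∃ c n, ∀ D d, 0 < d → d + n < D → ∃ F : Frag (R ⊕ Fin D), e.Computes c d F

/-- The target register is zeroed first because the machine has no copy instruction: adding a
register to the zeroed target copies it. -/
theorem compilable_of_instr {e : Expr R}
    (i : ∀ {D}, Fin D → Fin D → RAMInstr (R ⊕ Fin D) Unit) (hi : ∀ D a b, (@i D a b).NoMulti)
    (he : ∀ D (a b : Fin D) x ro ma B W (ρ : R ⊕ Fin D → ℕ) k, (b : ℕ) = 0 → Admissible B W ρ →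
      ρ (.inr a) = 0 →
      ((i a b).map fun _ => (none : Option Unit)).exec x ro ma (some ()) ρ k
        = (none, Function.update ρ (.inr a) (e.eval x B (ρ ∘ Sum.inl)), k)) :
    e.Compilable := by
  obtain ⟨c, hc⟩ := e.exists_eval_le
  refine ⟨c + 1, 0, fun D d hd hD => ?_⟩
  let a : Fin D := ⟨d, by omega⟩
  let b : Fin D := ⟨0, by omega⟩
  refine ⟨(Frag.instr (.const (.inr a) 0 ()) trivial).seq (Frag.instr (i a b) (hi D a b)), ?_⟩
  intro x ro ma B W ρ k hB hW hρ
  have h1 : AgreeBelow d ρ (Function.update ρ (.inr a) 0) :=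
    AgreeBelow.refl.update (show d ≤ d from le_rfl) _
  have hW1 := update_le (r := .inr a) hρ.le (Nat.zero_le W)
  have hρ1 := hρ.of_agree h1 hd hW1
  have h2 := he D a b x ro ma B W _ k rfl hρ1 (by simp)
  have hle : e.eval x B (ρ ∘ Sum.inl) ≤ W :=
    (hc x B _ hB hρ.visible).trans ((Nat.pow_le_pow_right (by omega) (by omega)).trans hW)
  have hv : (Function.update ρ (.inr a) 0) ∘ Sum.inl = ρ ∘ Sum.inl := h1.visible
  rw [hv] at h2
  refine ⟨_, ((Frag.instr_spec rfl hρ.le hW1).then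
    (Frag.instr_spec h2 hW1 (update_le hW1 hle))).mono ?_, h1.update le_rfl _, ?_⟩
  · calc 1 + 1 ≤ B ^ 1 := by simpa using hB
      _ ≤ _ := Nat.pow_le_pow_right (by omega) (by omega)
  · intro i hi
    have : i = a := Fin.ext hi
    subst this
    simp

/-- The hidden registers act as an evaluation stack. The first operand is left in register `d`; the
second is computed with base `d + 1` and so does not disturb it. -/
theorem compilable_binary {e a b : Expr R} (ha : a.Compilable) (hb : b.Compilable)
    (i : ∀ {D}, Fin D → Fin D → RAMInstr (R ⊕ Fin D) Unit) (hi : ∀ D a b, (@i D a b).NoMulti)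
    (he : ∀ D (s t : Fin D) x ro ma B (ρ : R ⊕ Fin D → ℕ) k,
      ρ (.inr s) = a.eval x B (ρ ∘ Sum.inl) → ρ (.inr t) = b.eval x B (ρ ∘ Sum.inl) →
      ((i s t).map fun _ => (none : Option Unit)).exec x ro ma (some ()) ρ k
        = (none, Function.update ρ (.inr s) (e.eval x B (ρ ∘ Sum.inl)), k)) :
    e.Compilable := by
  obtain ⟨c, hc⟩ := e.exists_eval_le
  obtain ⟨ca, na, ha⟩ := ha
  obtain ⟨cb, nb, hb⟩ := hb
  refine ⟨ca + cb + 2 + c, na + nb + 1, fun D d hd hD => ?_⟩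
  obtain ⟨F, hF⟩ := ha D d hd (by omega)
  obtain ⟨G, hG⟩ := hb D (d + 1) (by omega) (by omega)
  let s : Fin D := ⟨d, by omega⟩
  let t : Fin D := ⟨d + 1, by omega⟩
  refine ⟨(F.seq G).seq (Frag.instr (i s t) (hi D s t)), ?_⟩
  intro x ro ma B W ρ k hB hW hρ
  have hpow : ∀ j, j ≤ ca + cb + 2 + c → B ^ j ≤ B ^ (ca + cb + 2 + c) :=
    fun j hj => Nat.pow_le_pow_right (by omega) hj
  obtain ⟨ρ1, hS1, hA1, hv1⟩ := hF x ro ma B W ρ k hB ((hpow _ (by omega)).trans hW) hρ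
  have hρ1 := hρ.of_agree hA1 hd hS1.le_right
  obtain ⟨ρ2, hS2, hA2, hv2⟩ := hG x ro ma B W ρ1 k hB ((hpow _ (by omega)).trans hW) hρ1
  have hA : AgreeBelow d ρ ρ2 := hA1.trans hA2 (by omega)
  have hle : e.eval x B (ρ2 ∘ Sum.inl) ≤ W := by
    rw [hA.visible]
    exact (hc x B _ hB hρ.visible).trans ((hpow _ (by omega)).trans hW)
  have h3 := he D s t x ro ma B ρ2 k
    (by rw [hA2.hidden s (by simp [s]), hv1 s rfl, hA.visible])
    (by rw [hv2 t rfl, hA2.visible])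
  refine ⟨_, ((hS1.then hS2).then
    (Frag.instr_spec h3 hS2.le_right (update_le hS2.le_right hle))).mono ?_, hA.update le_rfl _, ?_⟩
  · have h4 := Nat.pow_add_pow_le_pow hB ca cb
    have h5 := Nat.pow_add_pow_le_pow hB (ca + cb + 1) 0
    have h6 := hpow (ca + cb + 1 + 0 + 1) (by omega)
    simp only [pow_zero] at h5
    omega
  · intro j hj
    have : j = s := Fin.ext hj
    subst this
    simp [hA.visible]

theorem compilable_ite {a b c d : Expr R} (ha : a.Compilable) (hb : b.Compilable)
    (hc : c.Compilable) (hd : d.Compilable) : (Expr.ite a b c d).Compilable := by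
  obtain ⟨ca, na, ha⟩ := ha
  obtain ⟨cb, nb, hb⟩ := hb
  obtain ⟨cc, nc, hc⟩ := hc
  obtain ⟨cd, nd, hd⟩ := hd
  refine ⟨ca + cb + cc + cd + 4, na + nb + nc + nd + 1, fun D d' hd' hD => ?_⟩
  obtain ⟨F, hF⟩ := ha D d' hd' (by omega)
  obtain ⟨G, hG⟩ := hb D (d' + 1) (by omega) (by omega)
  obtain ⟨F', hF'⟩ := hc D d' hd' (by omega)
  obtain ⟨G', hG'⟩ := hd D d' hd' (by omega)
  let s : Fin D := ⟨d', by omega⟩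
  let t : Fin D := ⟨d' + 1, by omega⟩
  refine ⟨(F.seq G).seq (Frag.ite (.inr s) (.inr t) F' G'), ?_⟩
  intro x ro ma B W ρ k hB hW hρ
  have hpow : ∀ j, j ≤ ca + cb + cc + cd + 4 → B ^ j ≤ B ^ (ca + cb + cc + cd + 4) :=
    fun j hj => Nat.pow_le_pow_right (by omega) hj
  obtain ⟨ρ1, hS1, hA1, hv1⟩ := hF x ro ma B W ρ k hB ((hpow _ (by omega)).trans hW) hρ
  have hρ1 := hρ.of_agree hA1 hd' hS1.le_right
  obtain ⟨ρ2, hS2, hA2, hv2⟩ := hG x ro ma B W ρ1 k hB ((hpow _ (by omega)).trans hW) hρ1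
  have hA : AgreeBelow d' ρ ρ2 := hA1.trans hA2 (by omega)
  have hρ2 := hρ.of_agree hA hd' hS2.le_right
  have hs : ρ2 (.inr s) = a.eval x B (ρ ∘ Sum.inl) := by rw [hA2.hidden s (by simp [s]), hv1 s rfl]
  have ht : ρ2 (.inr t) = b.eval x B (ρ ∘ Sum.inl) := by rw [hv2 t rfl, hA1.visible]
  obtain ⟨ρ3, hS3, hA3, hv3⟩ := hF' x ro ma B W ρ2 k hB ((hpow _ (by omega)).trans hW) hρ2
  obtain ⟨ρ4, hS4, hA4, hv4⟩ := hG' x ro ma B W ρ2 k hB ((hpow _ (by omega)).trans hW) hρ2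
  have h4 := Nat.pow_add_pow_le_pow hB ca cb
  have h5 := Nat.pow_add_pow_le_pow hB (ca + cb + 1) 0
  have h6 := Nat.pow_add_pow_le_pow hB (ca + cb + 1 + 0 + 1) cc
  have h7 := Nat.pow_add_pow_le_pow hB (ca + cb + 1 + 0 + 1) cd
  have h8 := hpow (ca + cb + 1 + 0 + 1 + cc + 1) (by omega)
  have h9 := hpow (ca + cb + 1 + 0 + 1 + cd + 1) (by omega)
  simp only [pow_zero] at h5
  by_cases hab : a.eval x B (ρ ∘ Sum.inl) ≤ b.eval x B (ρ ∘ Sum.inl)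
  · refine ⟨ρ3, ((hS1.then hS2).then (Frag.ite_spec_pos (by rwa [hs, ht]) hS3)).mono ?_,
      hA.trans hA3 le_rfl, fun i hi => ?_⟩
    · omega
    · rw [hv3 i hi, hA.visible, eval, if_pos hab]
  · refine ⟨ρ4, ((hS1.then hS2).then (Frag.ite_spec_neg (by rwa [hs, ht]) hS4)).mono ?_,
      hA.trans hA4 le_rfl, fun i hi => ?_⟩
    · omega
    · rw [hv4 i hi, hA.visible, eval, if_neg hab]

theorem compilable (e : Expr R) : e.Compilable := by
  induction e with
  | reg r =>
    refine compilable_of_instr (fun a _ => .add (.inr a) (.inl r) (.inr a) ())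
      (fun _ _ _ => trivial) ?_
    intro D a b x ro ma B W ρ k _ hρ h0
    simp [RAMInstr.map, RAMInstr.exec, eval, h0]
  | const c =>
    refine compilable_of_instr (fun a _ => .const (.inr a) c ()) (fun _ _ _ => trivial) ?_
    intro D a b x ro ma B W ρ k _ hρ h0
    simp [RAMInstr.map, RAMInstr.exec, eval]
  | bound =>
    refine compilable_of_instr (fun a b => .add (.inr a) (.inr b) (.inr a) ())
      (fun _ _ _ => trivial) ?_
    intro D a b x ro ma B W ρ k hb hρ h0
    simp [RAMInstr.map, RAMInstr.exec, eval, h0, hρ.bound b hb]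
  | add a b ha hb =>
    refine compilable_binary ha hb (fun s t => .add (.inr s) (.inr s) (.inr t) ())
      (fun _ _ _ => trivial) ?_
    intro D s t x ro ma B ρ k hs ht
    simp [RAMInstr.map, RAMInstr.exec, eval, hs, ht]
  | sub a b ha hb =>
    refine compilable_binary ha hb (fun s t => .sub (.inr s) (.inr s) (.inr t) ())
      (fun _ _ _ => trivial) ?_
    intro D s t x ro ma B ρ k hs ht
    simp [RAMInstr.map, RAMInstr.exec, eval, hs, ht]
  | mul a b ha hb =>
    refine compilable_binary ha hb (fun s t => .mul (.inr s) (.inr s) (.inr t) ())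
      (fun _ _ _ => trivial) ?_
    intro D s t x ro ma B ρ k hs ht
    simp [RAMInstr.map, RAMInstr.exec, eval, hs, ht]
  | div a b ha hb =>
    refine compilable_binary ha hb (fun s t => .div (.inr s) (.inr s) (.inr t) ())
      (fun _ _ _ => trivial) ?_
    intro D s t x ro ma B ρ k hs ht
    simp [RAMInstr.map, RAMInstr.exec, eval, hs, ht]
  | ite a b c d ha hb hc hd => exact compilable_ite ha hb hc hd
  | input a ha =>
    refine compilable_binary ha ha (fun s _ => .readInput (.inr s) (.inr s) ())
      (fun _ _ _ => trivial) ?_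
    intro D s t x ro ma B ρ k hs ht
    simp [RAMInstr.map, RAMInstr.exec, eval, hs]

end Expr

namespace Prog

variable {R : Type} [DecidableEq R]

/-- A fragment executes a program and preserves the hidden registers below `d`. -/
def Executes {D : ℕ} (p : Prog R) (c d : ℕ) (F : Frag (R ⊕ Fin D)) : Prop :=
  ∀ x ro ma B W (ρ : R ⊕ Fin D → ℕ) k, 2 ≤ B → B ^ c ≤ W → Admissible B W ρ →
    ∃ ρ', F.Spec x ro ma W (B ^ c) ρ k ρ' (p.eval x ro B (ρ ∘ Sum.inl, k)).2 ∧
      ρ' ∘ Sum.inl = (p.eval x ro B (ρ ∘ Sum.inl, k)).1 ∧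
      ∀ i : Fin D, (i : ℕ) < d → ρ' (.inr i) = ρ (.inr i)

/-- The program can be compiled. -/
def Compilable (p : Prog R) : Prop :=
  ∃ c n, ∀ D d, 0 < d → d + n < D → ∃ F : Frag (R ⊕ Fin D), p.Executes c d F

theorem admissible_of_eval {D B W d k : ℕ} {ρ ρ' : R ⊕ Fin D → ℕ} {x ro} {p : Prog R}
    (hB : 2 ≤ B) (hρ : Admissible B W ρ) (hW : ∀ r, ρ' r ≤ W) (hd : 0 < d)
    (h : ρ' ∘ Sum.inl = (p.eval x ro B (ρ ∘ Sum.inl, k)).1)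
    (h' : ∀ i : Fin D, (i : ℕ) < d → ρ' (.inr i) = ρ (.inr i)) : Admissible B W ρ' where
  visible r := by
    have := congrFun h r
    simp only [Function.comp] at this
    rw [this]
    exact p.eval_le (by omega) _ hρ.visible r
  bound i hi := by rw [h' i (by omega), hρ.bound i hi]
  le := hW

theorem compilable_flip (r : R) : (flip r).Compilable := by
  refine ⟨1, 0, fun D d hd hD => ⟨Frag.instr (.flip (.inl r) ()) trivial, ?_⟩⟩
  intro x ro ma B W ρ k hB hW hρ
  have h1 : (ro k).toNat ≤ W := (Bool.toNat_le _).trans (by simp at hW; omega)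
  refine ⟨_, (Frag.instr_spec rfl hρ.le (update_le hρ.le h1)).mono ?_, ?_, ?_⟩
  · simp; omega
  · funext r'
    by_cases h : r' = r
    · subst h; simp [eval]
    · simp [eval, h]
  · intro i hi; simp

theorem compilable_seq {p q : Prog R} (hp : p.Compilable) (hq : q.Compilable) :
    (seq p q).Compilable := by
  obtain ⟨cp, np, hp⟩ := hp
  obtain ⟨cq, nq, hq⟩ := hq
  refine ⟨cp + cq + 1, np + nq, fun D d hd hD => ?_⟩
  obtain ⟨F, hF⟩ := hp D d hd (by omega)
  obtain ⟨G, hG⟩ := hq D d hd (by omega)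
  refine ⟨F.seq G, ?_⟩
  intro x ro ma B W ρ k hB hW hρ
  have hpow : ∀ j, j ≤ cp + cq + 1 → B ^ j ≤ B ^ (cp + cq + 1) :=
    fun j hj => Nat.pow_le_pow_right (by omega) hj
  obtain ⟨ρ1, hS1, hv1, hh1⟩ := hF x ro ma B W ρ k hB ((hpow _ (by omega)).trans hW) hρ
  have hρ1 := admissible_of_eval hB hρ hS1.le_right hd hv1 hh1
  obtain ⟨ρ2, hS2, hv2, hh2⟩ := hG x ro ma B W ρ1 _ hB ((hpow _ (by omega)).trans hW) hρ1
  rw [hv1] at hS2 hv2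
  exact ⟨ρ2, (hS1.then hS2).mono (Nat.pow_add_pow_le_pow hB _ _), hv2,
    fun i hi => (hh2 i hi).trans (hh1 i hi)⟩

/-- The cut-off is a branch comparing the value with hidden register `0`, which holds `B`. Copying
to the visible register goes through an auxiliary register that holds `0`. -/
theorem compilable_assign (r : R) (e : Expr R) : (assign r e).Compilable := by
  obtain ⟨c, n, he⟩ := e.compilable
  refine ⟨c + 3, n + 1, fun D d hd hD => ?_⟩
  obtain ⟨F, hF⟩ := he D d hd (by omega)
  let z : Fin D := ⟨0, by omega⟩
  let s : Fin D := ⟨d, by omega⟩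
  let t : Fin D := ⟨d + 1, by omega⟩
  refine ⟨(F.seq (Frag.instr (.const (.inr t) 0 ()) trivial)).seq (Frag.ite (.inr s) (.inr z)
    (Frag.instr (.add (.inl r) (.inr s) (.inr t) ()) trivial)
    (Frag.instr (.add (.inl r) (.inr z) (.inr t) ()) trivial)), ?_⟩
  intro x ro ma B W ρ k hB hW hρ
  have hpow : ∀ j, j ≤ c + 3 → B ^ j ≤ B ^ (c + 3) :=
    fun j hj => Nat.pow_le_pow_right (by omega) hj
  obtain ⟨ρ1, hS1, hA1, hv1⟩ := hF x ro ma B W ρ k hB ((hpow _ (by omega)).trans hW) hρ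
  have hA2 : AgreeBelow d ρ (Function.update ρ1 (.inr t) 0) :=
    hA1.update (show d ≤ d + 1 by omega) 0
  have hW2 := update_le (r := .inr t) hS1.le_right (Nat.zero_le W)
  have hρ2 := hρ.of_agree hA2 hd hW2
  have hst : s ≠ t := by simp [s, t]
  have hzt : z ≠ t := by simp [z, t]
  have hs : Function.update ρ1 (.inr t) 0 (.inr s) = e.eval x B (ρ ∘ Sum.inl) := by
    simp [hst, hv1 s rfl]
  have hz : Function.update ρ1 (.inr t) 0 (.inr z) = B := hρ2.bound z rfl
  have ht : Function.update ρ1 (.inr t) 0 (.inr t) = 0 := by simp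
  have hSt : (Frag.instr (.const (.inr t) 0 ()) trivial).Spec x ro ma W 1 ρ1 k
    (Function.update ρ1 (.inr t) 0) k := Frag.instr_spec rfl hS1.le_right hW2
  have hB1 : B ≤ W := le_trans (by simpa using hpow 1 (by omega)) hW
  have hm : min (e.eval x B (ρ ∘ Sum.inl)) B ≤ W := (min_le_right _ _).trans hB1
  have htime : B ^ c + 1 + (1 + 1) ≤ B ^ (c + 3) := by
    have h5 := Nat.pow_add_pow_le_pow hB c 0
    have h6 := Nat.pow_add_pow_le_pow hB (c + 0 + 1) 1
    have h7 := hpow (c + 0 + 1 + 1 + 1) (by omega)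
    simp only [pow_zero, pow_one] at h5 h6
    omega
  refine ⟨Function.update (Function.update ρ1 (.inr t) 0) (.inl r)
    (min (e.eval x B (ρ ∘ Sum.inl)) B), ?_, ?_, ?_⟩
  · refine ((hS1.then hSt).then (T' := 1 + 1) ?_).mono htime
    by_cases hle : e.eval x B (ρ ∘ Sum.inl) ≤ B
    · refine Frag.ite_spec_pos (by rw [hs, hz]; exact hle)
        (Frag.instr_spec ?_ hW2 (update_le hW2 hm))
      simp only [RAMInstr.map, RAMInstr.exec, hs, ht, eval, min_eq_left hle, Nat.add_zero]
    · refine Frag.ite_spec_neg (by rw [hs, hz]; exact hle)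
        (Frag.instr_spec ?_ hW2 (update_le hW2 hm))
      simp only [RAMInstr.map, RAMInstr.exec, hz, ht, eval, min_eq_right (le_of_not_ge hle),
        Nat.add_zero]
  · simp only [eval]
    funext r'
    by_cases h : r' = r
    · subst h; simp
    · simpa [h] using congrFun hA1.visible r'
  · intro i hi
    rw [← hA2.hidden i hi]
    simp

theorem compilable_ite {a b : Expr R} {p q : Prog R} (hp : p.Compilable) (hq : q.Compilable) :
    (ite a b p q).Compilable := by
  obtain ⟨ca, na, ha⟩ := a.compilable
  obtain ⟨cb, nb, hb⟩ := b.compilable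
  obtain ⟨cc, nc, hc⟩ := hp
  obtain ⟨cd, nd, hd⟩ := hq
  refine ⟨ca + cb + cc + cd + 4, na + nb + nc + nd + 1, fun D d' hd' hD => ?_⟩
  obtain ⟨F, hF⟩ := ha D d' hd' (by omega)
  obtain ⟨G, hG⟩ := hb D (d' + 1) (by omega) (by omega)
  obtain ⟨F', hF'⟩ := hc D d' hd' (by omega)
  obtain ⟨G', hG'⟩ := hd D d' hd' (by omega)
  let s : Fin D := ⟨d', by omega⟩
  let t : Fin D := ⟨d' + 1, by omega⟩
  refine ⟨(F.seq G).seq (Frag.ite (.inr s) (.inr t) F' G'), ?_⟩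
  intro x ro ma B W ρ k hB hW hρ
  have hpow : ∀ j, j ≤ ca + cb + cc + cd + 4 → B ^ j ≤ B ^ (ca + cb + cc + cd + 4) :=
    fun j hj => Nat.pow_le_pow_right (by omega) hj
  obtain ⟨ρ1, hS1, hA1, hv1⟩ := hF x ro ma B W ρ k hB ((hpow _ (by omega)).trans hW) hρ
  have hρ1 := hρ.of_agree hA1 hd' hS1.le_right
  obtain ⟨ρ2, hS2, hA2, hv2⟩ := hG x ro ma B W ρ1 k hB ((hpow _ (by omega)).trans hW) hρ1
  have hA : AgreeBelow d' ρ ρ2 := hA1.trans hA2 (by omega)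
  have hρ2 := hρ.of_agree hA hd' hS2.le_right
  have hs : ρ2 (.inr s) = a.eval x B (ρ ∘ Sum.inl) := by rw [hA2.hidden s (by simp [s]), hv1 s rfl]
  have ht : ρ2 (.inr t) = b.eval x B (ρ ∘ Sum.inl) := by rw [hv2 t rfl, hA1.visible]
  obtain ⟨ρ3, hS3, hv3, hh3⟩ := hF' x ro ma B W ρ2 k hB ((hpow _ (by omega)).trans hW) hρ2
  obtain ⟨ρ4, hS4, hv4, hh4⟩ := hG' x ro ma B W ρ2 k hB ((hpow _ (by omega)).trans hW) hρ2
  rw [hA.visible] at hS3 hS4 hv3 hv4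
  have h4 := Nat.pow_add_pow_le_pow hB ca cb
  have h5 := Nat.pow_add_pow_le_pow hB (ca + cb + 1) 0
  have h6 := Nat.pow_add_pow_le_pow hB (ca + cb + 1 + 0 + 1) cc
  have h7 := Nat.pow_add_pow_le_pow hB (ca + cb + 1 + 0 + 1) cd
  have h8 := hpow (ca + cb + 1 + 0 + 1 + cc + 1) (by omega)
  have h9 := hpow (ca + cb + 1 + 0 + 1 + cd + 1) (by omega)
  simp only [pow_zero] at h5
  by_cases hab : a.eval x B (ρ ∘ Sum.inl) ≤ b.eval x B (ρ ∘ Sum.inl)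
  · simp only [eval, if_pos hab]
    exact ⟨ρ3, ((hS1.then hS2).then (Frag.ite_spec_pos (by rwa [hs, ht]) hS3)).mono
      (by omega), hv3, fun i hi => (hh3 i hi).trans (hA.hidden i hi)⟩
  · simp only [eval, if_neg hab]
    exact ⟨ρ4, ((hS1.then hS2).then (Frag.ite_spec_neg (by rwa [hs, ht]) hS4)).mono
      (by omega), hv4, fun i hi => (hh4 i hi).trans (hA.hidden i hi)⟩

/-- The number of rounds is evaluated once into hidden register `d`, so it is at most a power of
`B`. The body is compiled with base `d + 1` and therefore preserves the counter. -/
theorem compilable_loop {e : Expr R} {p : Prog R} (hp : p.Compilable) :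
    (loop e p).Compilable := by
  obtain ⟨c, hc⟩ := e.exists_eval_le
  obtain ⟨ce, ne, he⟩ := e.compilable
  obtain ⟨cp, np, hp⟩ := hp
  refine ⟨c + ce + cp + 6, ne + np + 2, fun D d hd hD => ?_⟩
  obtain ⟨F, hF⟩ := he D d hd (by omega)
  obtain ⟨G, hG⟩ := hp D (d + 1) (by omega) (by omega)
  let s : Fin D := ⟨d, by omega⟩
  let t : Fin D := ⟨d + 1, by omega⟩
  refine ⟨F.seq (Frag.countdown (.inr s) (.inr t) G), ?_⟩
  intro x ro ma B W ρ k hB hW hρ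
  have hpow : ∀ j, j ≤ c + ce + cp + 6 → B ^ j ≤ B ^ (c + ce + cp + 6) :=
    fun j hj => Nat.pow_le_pow_right (by omega) hj
  have hW1 : 1 ≤ W := (by simpa using hpow 0 (by omega) : 1 ≤ _).trans hW
  obtain ⟨ρ1, hS1, hA1, hv1⟩ := hF x ro ma B W ρ k hB ((hpow _ (by omega)).trans hW) hρ
  have hρ1 := hρ.of_agree hA1 hd hS1.le_right
  set M := e.eval x B (ρ ∘ Sum.inl) with hM
  have hMc : M ≤ B ^ c := hc x B _ hB hρ.visible
  have hst : s ≠ t := by simp [s, t]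
  obtain ⟨ρ2, n2, hP, hS2⟩ := Frag.countdown_spec (x := x) (ro := ro) (ma := ma) (W := W)
    (c := Sum.inr s) (t := Sum.inr t) (by simpa using hst)
    (F := G) (T := B ^ cp) hW1
    -- With `m` rounds left, `M - m` iterates of the body have been performed.
    (fun m ρ' n => m ≤ M ∧ Admissible B W ρ' ∧ ρ' (.inr s) = m ∧
      (ρ' ∘ Sum.inl, n) = (p.eval x ro B)^[M - m] (ρ ∘ Sum.inl, k) ∧
      ∀ i : Fin D, (i : ℕ) < d → ρ' (.inr i) = ρ (.inr i))
    (fun m ρ' n h => ⟨h.2.2.1, h.2.1.le⟩)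
    (by
      rintro m ρ' n ⟨hm, hρ', hs, hv, hh⟩
      have hA2 : AgreeBelow d ρ' (Function.update (Function.update ρ' (.inr t) 1) (.inr s) m) :=
        (AgreeBelow.refl.update (i := t) (show d ≤ d + 1 by omega) _).update (i := s)
          (show d ≤ d from le_rfl) _
      have hmW : m ≤ W := by have := hρ'.le (.inr s); omega
      have hρ2 := hρ'.of_agree hA2 hd (update_le (update_le hρ'.le hW1) hmW)
      obtain ⟨ρ3, hS3, hv3, hh3⟩ := hG x ro ma B W _ n hB ((hpow _ (by omega)).trans hW) hρ2
      have hρ3 := admissible_of_eval hB hρ2 hS3.le_right (by omega) hv3 hh3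
      refine ⟨ρ3, _, hS3, by omega, hρ3, ?_, ?_, ?_⟩
      · rw [hh3 s (by simp [s])]; simp
      · rw [hv3, hA2.visible, show M - m = (M - (m + 1)) + 1 by omega, Function.iterate_succ_apply',
          ← hv]
      · intro i hi
        rw [hh3 i (by omega), hA2.hidden i hi, hh i hi])
    M ρ1 k ⟨le_rfl, hρ1, hv1 s rfl, by simp [hA1.visible], hA1.hidden⟩
  obtain ⟨-, hρ2, -, hv2, hh2⟩ := hP
  rw [Nat.sub_zero] at hv2
  have hev : (loop e p).eval x ro B (ρ ∘ Sum.inl, k) = (ρ2 ∘ Sum.inl, n2) := by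
    rw [hv2]; rfl
  rw [hev]
  refine ⟨_, (hS1.then hS2).mono ?_, ?_, ?_⟩
  · have h1 : M * (B ^ cp + 3) ≤ B ^ c * (B ^ cp + 3) := Nat.mul_le_mul_right _ hMc
    have h2 : B ^ cp + 3 ≤ B ^ (cp + 3) := by
      have h5 := Nat.pow_add_pow_le_pow hB cp 2
      have h6 : 2 ^ 2 ≤ B ^ 2 := Nat.pow_le_pow_left hB 2
      rw [show cp + 2 + 1 = cp + 3 by omega] at h5
      omega
    have h3 : B ^ c * (B ^ cp + 3) ≤ B ^ (c + cp + 3) := by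
      calc _ ≤ B ^ c * B ^ (cp + 3) := Nat.mul_le_mul_left _ h2
        _ = _ := by rw [← pow_add, add_assoc]
    have h4 := Nat.pow_add_pow_le_pow hB ce (c + cp + 3)
    have h5 := Nat.pow_add_pow_le_pow hB (ce + (c + cp + 3) + 1) 1
    have h6 := hpow (ce + (c + cp + 3) + 1 + 1 + 1) (by omega)
    simp only [pow_one] at h5
    omega
  · funext r; simp
  · intro i hi
    rw [← hh2 i hi, Function.update_of_ne]
    intro h
    cases h
    simp [t] at hi

theorem compilable (p : Prog R) : p.Compilable := by
  induction p with
  | assign r e => exact compilable_assign r e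
  | flip r => exact compilable_flip r
  | seq p q hp hq => exact compilable_seq hp hq
  | ite a b p q hp hq => exact compilable_ite hp hq
  | loop e p hp => exact compilable_loop hp

end Prog

/-! ## Computing the bound, and complete machines -/

namespace Frag

variable {Reg : Type} [DecidableEq Reg] {x : List Bool} {ro ma : ℕ → Bool} {W : ℕ}

/-- Move the register `a` to the end of the input. -/
def scan (a t u : Reg) : Frag Reg where
  St := Fin 5
  start := 0
  code
    | 0 => .readInput t a (some 1)
    | 1 => .const u 2 (some 2)
    | 2 => .branch u t none (some 3)
    | 3 => .const u 1 (some 4)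
    | 4 => .add a a u (some 0)
  noMulti s := by fin_cases s <;> trivial

theorem bounded_update {ρ : Reg → ℕ} {r : Reg} {a : ℕ} (h : ∀ r, ρ r ≤ W) (ha : a ≤ W) :
    ∀ r', Function.update ρ r a r' ≤ W := by
  intro r'
  by_cases h' : r' = r
  · subst h'; simpa using ha
  · simpa [h'] using h r'

theorem Run.step {F : Frag Reg} {s ρ n T c} (q : Option F.St) (ρ' : Reg → ℕ) (n' : ℕ)
    (hρ : ∀ r, ρ r ≤ W) (h : (F.code s).exec x ro ma (some s) ρ n = (q, ρ', n'))
    (hrun : F.Run x ro ma W T (q, ρ', n') c) : F.Run x ro ma W (T + 1) (some s, ρ, n) c :=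
  .head hρ (h ▸ hrun)

/-- A genuine input bit is at most `1`, so the test `2 ≤ symbol` succeeds exactly at the end marker.
Each bit costs five steps and the final test three. -/
theorem scan_run {a t u : Reg} (hat : a ≠ t) (hau : a ≠ u) (htu : t ≠ u) (hW : 2 ≤ W)
    (hxW : x.length ≤ W) (n : ℕ) (m : ℕ) : ∀ ρ : Reg → ℕ, (∀ r, ρ r ≤ W) → ρ a + m = x.length →
    ∃ ρ' : Reg → ℕ,
      (scan a t u).Run x ro ma W (5 * m + 3) (some (scan a t u).start, ρ, n) (none, ρ', n) ∧
      ρ' a = x.length ∧ ∀ r, r ≠ a → r ≠ t → r ≠ u → ρ' r = ρ r := by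
  induction m with
  | zero =>
    intro ρ hρ hm
    have h2 : RAM.inputAt x (ρ a) = 2 := by
      simp [RAM.inputAt, List.getElem?_eq_none (show x.length ≤ ρ a by omega)]
    have hW1 : ∀ r, Function.update ρ t 2 r ≤ W := bounded_update hρ hW
    have hW2 : ∀ r, Function.update (Function.update ρ t 2) u 2 r ≤ W := bounded_update hW1 hW
    refine ⟨Function.update (Function.update ρ t 2) u 2, ?_, ?_, ?_⟩
    · refine .step (F := scan a t u) (some (1 : Fin 5)) _ n hρ
        (by simp [scan, RAMInstr.exec, h2]; rfl) ?_
      refine .step (F := scan a t u) (some (2 : Fin 5)) _ n hW1 rfl ?_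
      refine .step (F := scan a t u) none _ n hW2 ?_ (.refl _ hW2)
      simp [scan, RAMInstr.exec, htu]
    · simp [hat, hau]; omega
    · intro r h1 h2 h3; simp [h2, h3]
  | succ m ih =>
    intro ρ hρ hm
    have h2 : RAM.inputAt x (ρ a) ≤ 1 := by
      simp only [RAM.inputAt, List.getElem?_eq_getElem (show ρ a < x.length by omega)]
      exact Bool.toNat_le _
    set y := RAM.inputAt x (ρ a) with hy
    have hW1 : ∀ r, Function.update ρ t y r ≤ W := bounded_update hρ (by omega)
    have hW2 : ∀ r, Function.update (Function.update ρ t y) u 2 r ≤ W := bounded_update hW1 hW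
    have hW3 : ∀ r, Function.update (Function.update ρ t y) u 1 r ≤ W :=
      bounded_update hW1 (by omega)
    have hW4 : ∀ r,
        Function.update (Function.update (Function.update ρ t y) u 1) a (ρ a + 1) r ≤ W :=
      bounded_update hW3 (by omega)
    obtain ⟨ρ', hrun, ha', hr'⟩ := ih _ hW4 (by simp; omega)
    refine ⟨ρ', ?_, ha', ?_⟩
    · refine .step (F := scan a t u) (some (1 : Fin 5)) _ n hρ rfl ?_
      refine .step (F := scan a t u) (some (2 : Fin 5)) _ n hW1 rfl ?_
      refine .step (F := scan a t u) (some (3 : Fin 5))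
        (Function.update (Function.update ρ t y) u 2) n hW2 ?_ ?_
      rotate_left
      · refine .step (F := scan a t u) (some (4 : Fin 5)) _ n hW2 rfl ?_
        refine .step (F := scan a t u) (some (0 : Fin 5)) _ n ?_ ?_ hrun
        · simpa using hW3
        · simp [scan, RAMInstr.exec, hat, hau]
      · simp only [scan, RAMInstr.exec, Function.update_self, Function.update_of_ne htu]
        rw [if_neg (by omega)]
    · intro r h1 h2 h3
      rw [hr' r h1 h2 h3]
      simp [h1, h2, h3]

/-- Put the `C`-th power of the register `a` into the register `z`. -/
def power (z a : Reg) : ℕ → Frag Reg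
  | 0 => instr (.const z 1 ()) trivial
  | C + 1 => (power z a C).seq (instr (.mul z z a ()) trivial)

theorem power_spec {z a : Reg} (hza : a ≠ z) (n : ℕ) (ρ : Reg → ℕ) (hρ : ∀ r, ρ r ≤ W) (C : ℕ)
    (h1 : 1 ≤ ρ a) (hW : ρ a ^ C ≤ W) :
    (power z a C).Spec x ro ma W (C + 1) ρ n (Function.update ρ z (ρ a ^ C)) n := by
  induction C with
  | zero => exact instr_spec rfl hρ (bounded_update hρ hW)
  | succ C ih =>
    have h2 : ρ a ^ C ≤ W := (Nat.pow_le_pow_right h1 (Nat.le_succ C)).trans hW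
    refine (ih h2).then (instr_spec ?_ (ih h2).le_right (bounded_update hρ hW))
    simp [RAMInstr.map, RAMInstr.exec, hza, pow_succ]

/-- The machine that runs a fragment and outputs the register `o`. -/
def toRAM [Fintype Reg] (F : Frag Reg) (o : Reg) : RAM where
  State := Option F.St
  Reg := Reg
  start := some F.start
  code
    | some s => F.code s
    | none => .halt o

theorem toRAM_step [Fintype Reg] (F : Frag Reg) (o : Reg) (s : F.St) (ρ : Reg → ℕ) (n : ℕ) :
    (F.toRAM o).step x ro ma ⟨some s, ρ, n⟩ =
      ⟨((F.code s).exec x ro ma (some s) ρ n).1, ((F.code s).exec x ro ma (some s) ρ n).2.1,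
        ((F.code s).exec x ro ma (some s) ρ n).2.2⟩ := by
  simp only [RAM.step, toRAM, RAMInstr.exec]
  cases F.code s <;> rfl

/-- The register bound is recorded at every intermediate time, since the space requirement concerns
all configurations and not only the last one. -/
theorem Run.toRAM [Fintype Reg] {F : Frag Reg} (o : Reg) {T a b} (h : F.Run x ro ma W T a b) :
    ((F.toRAM o).step x ro ma)^[T] ⟨a.1, a.2.1, a.2.2⟩ = ⟨b.1, b.2.1, b.2.2⟩ ∧
    ∀ j ≤ T, ∀ r, (((F.toRAM o).step x ro ma)^[j] ⟨a.1, a.2.1, a.2.2⟩).regs r ≤ W := by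
  induction h with
  | refl c h => exact ⟨rfl, fun j hj => by obtain rfl : j = 0 := (by omega); exact h⟩
  | head hρ _ ih =>
    refine ⟨?_, fun j hj => ?_⟩
    · rw [Function.iterate_succ_apply, toRAM_step]
      exact ih.1
    · cases j with
      | zero => exact hρ
      | succ j =>
        rw [Function.iterate_succ_apply, toRAM_step]
        exact ih.2 j (by omega)

theorem toRAM_noMulti [Fintype Reg] (F : Frag Reg) (o : Reg) : (F.toRAM o).NoMulti := by
  intro q d a q' h
  cases q with
  | none => cases h
  | some s =>
    have := F.noMulti s
    rw [show F.code s = .readMulti d a q' from h] at this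
    exact this

end Frag

/-- The definition of a logspace algorithm has one constant as both factor and exponent. Since `n +
2 ≤ 3 * n` for `n > 0` and `m + 1 ≤ 3 ^ (m + 1)`, the constant `3 ^ (m + 1)` can play both roles. -/
theorem Nat.add_two_pow_le (n m : ℕ) :
    (n + 2) ^ (m + 1) ≤ 3 ^ (m + 1) * (n ^ (3 ^ (m + 1)) + 1) := by
  rcases Nat.eq_zero_or_pos n with rfl | hn
  · have : (0 : ℕ) ^ (3 ^ (m + 1)) = 0 := by simp
    rw [this]
    simpa using Nat.pow_le_pow_left (show 2 ≤ 3 by omega) (m + 1)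
  · calc (n + 2) ^ (m + 1) ≤ (3 * n) ^ (m + 1) := Nat.pow_le_pow_left (by omega) _
      _ = 3 ^ (m + 1) * n ^ (m + 1) := mul_pow _ _ _
      _ ≤ _ := by
        refine Nat.mul_le_mul_left _ ((Nat.pow_le_pow_right hn ?_).trans (Nat.le_succ _))
        exact (Nat.lt_pow_self (by omega)).le

theorem Nat.size_le_of_le_add_two_pow {n m w : ℕ} (h : w ≤ (n + 2) ^ m) :
    w.size ≤ (2 * m + 1) * (Nat.log 2 n + 1) := by
  have h1 : n < 2 ^ (Nat.log 2 n + 1) := Nat.lt_pow_succ_log_self (by omega) n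
  have h2 : n + 2 ≤ 2 ^ (Nat.log 2 n + 2) := by
    have h3 : 2 ^ 1 ≤ 2 ^ (Nat.log 2 n + 1) := Nat.pow_le_pow_right (by omega) (by omega)
    rw [show Nat.log 2 n + 2 = Nat.log 2 n + 1 + 1 by omega, pow_succ 2 (Nat.log 2 n + 1)]
    omega
  have h4 : w.size ≤ (Nat.log 2 n + 2) * m + 1 := by
    rw [Nat.size_le, pow_succ, pow_mul]
    have h5 := Nat.pow_le_pow_left h2 m
    have h6 : 0 < (2 ^ (Nat.log 2 n + 2)) ^ m := by positivity
    omega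
  refine h4.trans ?_
  nlinarith [Nat.zero_le (Nat.log 2 n * m), Nat.zero_le (Nat.log 2 n)]

/-- The bound at which programs cut off values. -/
def progBound (C : ℕ) (x : List Bool) : ℕ := (x.length + 2) ^ C

/-- A halting configuration is a fixed point of the step function, so a run never leaves it. -/
theorem RAM.HaltsWith.unique {M : RAM} {x : List Bool} {ro ma : ℕ → Bool} {t t' y y' : ℕ}
    (h : M.HaltsWith x ro ma t y) (h' : M.HaltsWith x ro ma t' y') : y = y' := by
  have key : ∀ (s s' z : ℕ), M.HaltsWith x ro ma s z → s ≤ s' →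
      M.run x ro ma s' = M.run x ro ma s := by
    rintro s s' z ⟨a, ha, -⟩ hs
    obtain ⟨j, rfl⟩ := Nat.exists_eq_add_of_le hs
    induction j with
    | zero => rfl
    | succ j ih =>
      rw [← add_assoc, RAM.run, Function.iterate_succ_apply']
      change M.step x ro ma (M.run x ro ma (s + j)) = _
      rw [ih (by omega), RAM.step, ha]
  rcases le_total t t' with htt | htt
  · have := key t t' y h htt
    obtain ⟨a, ha, rfl⟩ := h
    obtain ⟨a', ha', rfl⟩ := h'
    rw [this] at ha' ⊢
    rw [ha] at ha'
    cases ha'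
    rfl
  · have := key t' t y' h' htt
    obtain ⟨a, ha, rfl⟩ := h
    obtain ⟨a', ha', rfl⟩ := h'
    rw [this] at ha ⊢
    rw [ha] at ha'
    cases ha'
    rfl

theorem RAM.answers_iff {M : RAM} {x : List Bool} {ro ma : ℕ → Bool} {t y : ℕ}
    (h : M.HaltsWith x ro ma t y) (b : Bool) : M.Answers x ro ma b ↔ b = decide (y ≠ 0) := by
  constructor
  · rintro ⟨t', y', h', rfl⟩
    rw [h.unique h']
  · rintro rfl
    exact ⟨t, y, h, rfl⟩

/-- Every program is carried out by a randomized logspace algorithm. -/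
theorem Prog.exists_RAM {R : Type} [DecidableEq R] [Fintype R] (p : Prog R) (o : R) {C : ℕ}
    (hC : 1 ≤ C) : ∃ M : RAM, M.IsRandomizedLogspace ∧ ∀ x ro ma b, M.Answers x ro ma b ↔
      b = decide ((p.eval x ro (progBound C x) (fun _ => 0, 0)).1 o ≠ 0) := by
  obtain ⟨c, n, hp⟩ := p.compilable
  obtain ⟨G, hG⟩ := hp (n + 4) 1 one_pos (by omega)
  let z : R ⊕ Fin (n + 4) := .inr ⟨0, by omega⟩
  let a : R ⊕ Fin (n + 4) := .inr ⟨1, by omega⟩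
  let t : R ⊕ Fin (n + 4) := .inr ⟨2, by omega⟩
  let u : R ⊕ Fin (n + 4) := .inr ⟨3, by omega⟩
  let F : Frag (R ⊕ Fin (n + 4)) := (((Frag.scan a t u).seq
    ((Frag.instr (.const u 2 ()) trivial).seq (Frag.instr (.add a a u ()) trivial))).seq
      (Frag.power z a C)).seq G
  have key : ∀ x ro ma, ∃ T ≤ 5 * x.length + 3 + 2 + (C + 1) + progBound C x ^ c,
      ∃ ρ' n', F.Run x ro ma (progBound C x ^ (c + 1)) T (some F.start, fun _ => 0, 0)
        (none, ρ', n') ∧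
      ρ' ∘ Sum.inl = (p.eval x ro (progBound C x) (fun _ => 0, 0)).1 := by
    intro x ro ma
    set B := progBound C x with hB
    have hB1 : x.length + 2 ≤ B := by
      have := Nat.pow_le_pow_right (show 0 < x.length + 2 by omega) hC
      simpa [hB, progBound] using this
    set W := B ^ (c + 1) with hW
    have hBW : B ≤ W := by
      have := Nat.pow_le_pow_right (show 0 < B by omega) (show 1 ≤ c + 1 by omega)
      simpa [hW] using this
    have hat : a ≠ t := by simp [a, t]
    have hau : a ≠ u := by simp [a, u]
    have htu : t ≠ u := by simp [t, u]
    have haz : a ≠ z := by simp [a, z]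
    obtain ⟨ρ1, hr1, ha1, ho1⟩ := Frag.scan_run (ro := ro) (ma := ma) (W := W) (x := x) hat hau htu
      (by omega) (by omega) 0 x.length (fun _ => 0) (fun _ => Nat.zero_le _) (by simp)
    have hS1 : (Frag.scan a t u).Spec x ro ma W (5 * x.length + 3) (fun _ => 0) 0 ρ1 0 :=
      ⟨_, le_rfl, hr1⟩
    have hWu := Frag.bounded_update (r := u) hS1.le_right (show 2 ≤ W by omega)
    have hWa := Frag.bounded_update (r := a) hWu (show x.length + 2 ≤ W by omega)
    have hS2 : (Frag.instr (.const u 2 ()) trivial).Spec x ro ma W 1 ρ1 0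
      (Function.update ρ1 u 2) 0 := Frag.instr_spec rfl hS1.le_right hWu
    have hS3 : (Frag.instr (.add a a u ()) trivial).Spec x ro ma W 1 (Function.update ρ1 u 2) 0
        (Function.update (Function.update ρ1 u 2) a (x.length + 2)) 0 := by
      refine Frag.instr_spec ?_ hWu hWa
      simp [RAMInstr.map, RAMInstr.exec, hau, ha1]
    have hS4 := Frag.power_spec (x := x) (ro := ro) (ma := ma) haz 0 _ hWa C (by simp)
      (by rw [Function.update_self]; exact hBW)
    set ρ4 := Function.update (Function.update (Function.update ρ1 u 2) a (x.length + 2)) z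
      (Function.update (Function.update ρ1 u 2) a (x.length + 2) a ^ C) with hρ4
    have hvis : ρ4 ∘ Sum.inl = fun _ => 0 := by
      funext r
      simp only [Function.comp, hρ4, z, a, u]
      simp [ho1 (.inl r) (by simp [a]) (by simp [t]) (by simp [u])]
    have hadm : Admissible B W ρ4 := by
      refine ⟨fun r => ?_, fun i hi => ?_, hS4.le_right⟩
      · have := congrFun hvis r
        simp only [Function.comp] at this
        omega
      · have : (Sum.inr i : R ⊕ Fin (n + 4)) = z := by simp [z, Fin.ext_iff, hi]
        rw [this]
        simp [hρ4, hB, progBound]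
    obtain ⟨ρ5, hS5, hv5, -⟩ := hG x ro ma B W ρ4 0 (by omega)
      (Nat.pow_le_pow_right (by omega) (by omega)) hadm
    rw [hvis] at hS5 hv5
    obtain ⟨T, hT, hrun⟩ := ((hS1.then (hS2.then hS3)).then hS4).then hS5
    exact ⟨T, by omega, ρ5, _, hrun, hv5⟩
  refine ⟨F.toRAM (.inl o), ⟨?_, F.toRAM_noMulti _⟩, ?_⟩
  -- One exponent that dominates both the register bound `progBound C x ^ (c + 1)` and the total
  -- running time of scanning, exponentiation and the compiled program.
  · set m := C * (c + 1) + C + 5 with hm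
    have hwm : ∀ x : List Bool, progBound C x ^ (c + 1) ≤ (x.length + 2) ^ (m + 1) := by
      intro x
      rw [progBound, ← pow_mul]
      exact Nat.pow_le_pow_right (by omega) (by omega)
    have htm : ∀ x : List Bool, 5 * x.length + 3 + 2 + (C + 1) + progBound C x ^ c ≤
        (x.length + 2) ^ (m + 1) := by
      intro x
      set N := x.length + 2 with hN
      have e1 : 5 * x.length + 3 + 2 ≤ N ^ 4 := by
        have : 2 ^ 3 ≤ N ^ 3 := Nat.pow_le_pow_left (by omega) 3
        calc _ ≤ 2 ^ 3 * N := by omega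
          _ ≤ N ^ 3 * N := Nat.mul_le_mul_right _ this
          _ = N ^ 4 := by ring
      have e2 : C + 1 ≤ N ^ C := (Nat.lt_two_pow_self (n := C)).trans_le
        (Nat.pow_le_pow_left (by omega) C)
      have e3 : progBound C x ^ c = N ^ (C * c) := by rw [progBound, ← pow_mul]
      have e4 := Nat.pow_add_pow_le_pow (show 2 ≤ N by omega) 4 C
      have e5 := Nat.pow_add_pow_le_pow (show 2 ≤ N by omega) (4 + C + 1) (C * c)
      have e6 : N ^ (4 + C + 1 + C * c + 1) ≤ N ^ (m + 1) :=
        Nat.pow_le_pow_right (by omega) (by rw [hm]; ring_nf; omega)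
      omega
    have hfin : ∀ m' K : ℕ, K ≤ K + 3 ^ (m' + 1) := fun _ _ => Nat.le_add_right _ _
    set K := Fintype.card (R ⊕ Fin (n + 4)) * (2 * (m + 1) + 1) with hK
    refine ⟨K + 3 ^ (m + 1), fun x ro ma => ?_⟩
    obtain ⟨T, hT, ρ', n', hrun, -⟩ := key x ro ma
    obtain ⟨h1, h2⟩ := hrun.toRAM (.inl o)
    have hend : (F.toRAM (.inl o)).run x ro ma T = ⟨none, ρ', n'⟩ := h1
    constructor
    · refine ⟨T, hT.trans ((htm x).trans ((Nat.add_two_pow_le _ _).trans ?_)), ρ' (.inl o),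
        .inl o, ?_, ?_⟩
      · have hpos : 0 < 3 ^ (m + 1) := by positivity
        rcases Nat.eq_zero_or_pos x.length with h0 | h0
        · rw [h0, zero_pow (by omega), zero_pow (by omega)]
          omega
        · exact Nat.mul_le_mul (by omega)
            (Nat.add_le_add_right (Nat.pow_le_pow_right h0 (by omega)) 1)
      · rw [hend]; rfl
      · rw [hend]
    · intro s
      have hle : ∀ r, ((F.toRAM (.inl o)).run x ro ma s).regs r ≤ progBound C x ^ (c + 1) := by
        rcases le_total s T with hs | hs
        · exact h2 s hs
        · obtain ⟨j, rfl⟩ := Nat.exists_eq_add_of_le hs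
          have : (F.toRAM (.inl o)).run x ro ma (T + j) = ⟨none, ρ', n'⟩ := by
            induction j with
            | zero => exact hend
            | succ j ih =>
              rw [← add_assoc, RAM.run, Function.iterate_succ_apply']
              change (F.toRAM (.inl o)).step x ro ma ((F.toRAM (.inl o)).run x ro ma (T + j)) = _
              rw [ih (by omega)]
              rfl
          rw [this]
          exact hrun.le_right
      calc ((F.toRAM (.inl o)).run x ro ma s).space
          ≤ ∑ _r : R ⊕ Fin (n + 4), (2 * (m + 1) + 1) * (Nat.log 2 x.length + 1) :=
            Finset.sum_le_sum fun r _ => Nat.size_le_of_le_add_two_pow ((hle r).trans (hwm x))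
        _ = K * (Nat.log 2 x.length + 1) := by
            rw [Finset.sum_const, Finset.card_univ, smul_eq_mul, hK, mul_assoc]
        _ ≤ _ := Nat.mul_le_mul_right _ (hfin m K)
  · intro x ro ma b
    obtain ⟨T, hT, ρ', n', hrun, hv⟩ := key x ro ma
    obtain ⟨h1, -⟩ := hrun.toRAM (.inl o)
    have hend : (F.toRAM (.inl o)).run x ro ma T = ⟨none, ρ', n'⟩ := h1
    rw [RAM.answers_iff (t := T) (y := ρ' (.inl o)) ⟨(Sum.inl o : R ⊕ Fin (n + 4)), by rw [hend]; rfl,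
      by rw [hend]⟩,
      ← hv]
    rfl

/-! ## Simulation of a machine with computed input -/

/-- The registers used by a program that simulates `S`. -/
structure SimRegs (S : RAM) (R : Type) where
  reg : S.Reg → R
  pc : R
  adr : R
  res : R
  out : R
  reg_injective : Function.Injective reg
  reg_ne_pc : ∀ r, reg r ≠ pc
  reg_ne_adr : ∀ r, reg r ≠ adr
  reg_ne_out : ∀ r, reg r ≠ out
  pc_ne_out : pc ≠ out

namespace RAM

/-- A numbering of the control states. -/
noncomputable def index (S : RAM) (q : S.State) : ℕ := Finite.equivFin S.State q

theorem index_injective (S : RAM) : Function.Injective S.index :=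
  Fin.val_injective.comp (Finite.equivFin S.State).injective

theorem index_lt (S : RAM) (q : S.State) : S.index q < Nat.card S.State :=
  (Finite.equivFin S.State q).2

end RAM

namespace SimRegs

variable {S : RAM} {R : Type} [DecidableEq R] (g : SimRegs S R)

/-- `r` is one of the registers used by the simulation. -/
def Used (r : R) : Prop := (∃ a, r = g.reg a) ∨ r = g.pc ∨ r = g.adr ∨ r = g.res ∨ r = g.out

/-- Carry out the instruction at the control state `q`. -/
noncomputable def instrProg (RI RM : Prog R) (q : S.State) : Prog R :=
  match S.code q with
  | .const d c q' => .seq (.assign (g.reg d) (.const c)) (.assign g.pc (.const (S.index q')))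
  | .add d a b q' => .seq (.assign (g.reg d) (.add (.reg (g.reg a)) (.reg (g.reg b))))
      (.assign g.pc (.const (S.index q')))
  | .sub d a b q' => .seq (.assign (g.reg d) (.sub (.reg (g.reg a)) (.reg (g.reg b))))
      (.assign g.pc (.const (S.index q')))
  | .mul d a b q' => .seq (.assign (g.reg d) (.mul (.reg (g.reg a)) (.reg (g.reg b))))
      (.assign g.pc (.const (S.index q')))
  | .div d a b q' => .seq (.assign (g.reg d) (.div (.reg (g.reg a)) (.reg (g.reg b))))
      (.assign g.pc (.const (S.index q')))
  | .branch a b q' q'' => .ite (.reg (g.reg a)) (.reg (g.reg b))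
      (.assign g.pc (.const (S.index q'))) (.assign g.pc (.const (S.index q'')))
  | .readInput d a q' => .seq (.assign g.adr (.reg (g.reg a))) (.seq RI
      (.seq (.assign (g.reg d) (.reg g.res)) (.assign g.pc (.const (S.index q')))))
  | .readMulti d a q' => .seq (.assign g.adr (.reg (g.reg a))) (.seq RM
      (.seq (.assign (g.reg d) (.reg g.res)) (.assign g.pc (.const (S.index q')))))
  | .flip d q' => .seq (.flip (g.reg d)) (.assign g.pc (.const (S.index q')))
  | .halt a => .assign g.out (.reg (g.reg a))

/-- Carry out the instruction at the current control state if it is on the list. -/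
noncomputable def switchProg (RI RM : Prog R) : List S.State → Prog R
  | [] => .assign g.pc (.reg g.pc)
  | q :: L => .ite (.reg g.pc) (.const (S.index q))
      (.ite (.const (S.index q)) (.reg g.pc) (g.instrProg RI RM q) (switchProg RI RM L))
      (switchProg RI RM L)

/-- Equality with a state number is tested by two inequalities. The remaining tests lie only in the
failing branches, so the new value of `pc` is not inspected again within the same step. -/
theorem eval_switchProg {x ro B} {RI RM : Prog R} {s : (R → ℕ) × ℕ} {q : S.State}
    (hq : s.1 g.pc = S.index q) {L : List S.State} (hL : q ∈ L) :
    (g.switchProg RI RM L).eval x ro B s = (g.instrProg RI RM q).eval x ro B s := by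
  induction L with
  | nil => simp at hL
  | cons q' L ih =>
    simp only [switchProg, Prog.eval, Expr.eval, hq]
    by_cases h : q = q'
    · subst h; simp
    · have hL' : q ∈ L := by simpa [h] using hL
      have hne : S.index q ≠ S.index q' := fun h' => h (S.index_injective h')
      rw [ih hL']
      split_ifs
      · omega
      · rfl
      · rfl

/-- One step of the simulation. -/
noncomputable def stepProg (RI RM : Prog R) : Prog R :=
  g.switchProg RI RM (Set.finite_univ (α := S.State)).toFinset.toList

/-- The complete simulation. -/
noncomputable def simProg (RI RM : Prog R) : Prog R :=
  .seq (.assign g.pc (.const (S.index S.start))) (.loop .bound (g.stepProg RI RM))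

/-- The registers represent a configuration of `S`. -/
structure Represents (s : (R → ℕ) × ℕ) (c : S.Cfg) : Prop where
  pc : s.1 g.pc = S.index c.state
  regs : ∀ r, s.1 (g.reg r) = c.regs r
  coin : s.2 = c.coin

/-- The program `p` puts the value `f a` into `res`, where `a` is the address in `adr`, for
addresses in `A`, and does not disturb the simulation; `Q` describes the parameters in use. -/
def Reads (x : List Bool) (ro : ℕ → Bool) (B : ℕ) (Q : (R → ℕ) → Prop) (p : Prog R) (A : Set ℕ)
    (f : ℕ → ℕ) : Prop :=
  ∀ s : (R → ℕ) × ℕ, (∀ r, s.1 r ≤ B) → Q s.1 → s.1 g.adr ∈ A →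
    Q (p.eval x ro B s).1 ∧ (p.eval x ro B s).1 g.res = f (s.1 g.adr) ∧
    (p.eval x ro B s).1 g.pc = s.1 g.pc ∧ (p.eval x ro B s).2 = s.2 ∧
    ∀ r, (p.eval x ro B s).1 (g.reg r) = s.1 (g.reg r)

section

variable {x x' : List Bool} {ro ma : ℕ → Bool} {B : ℕ} {Q : (R → ℕ) → Prop} {RI RM : Prog R}
  {A : Set ℕ}

theorem Represents.update_aux {v : R → ℕ} {k : ℕ} {d : S.Reg} {w : ℕ} {q' : S.State} {c : S.Cfg}
    (hr : ∀ r, v (g.reg r) = c.regs r) (hk : k = c.coin) (hB : Nat.card S.State ≤ B) :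
    g.Represents (Function.update (Function.update v (g.reg d) w) g.pc (min (S.index q') B), k)
      ⟨q', Function.update c.regs d w, c.coin⟩ where
  pc := by simp [((S.index_lt q').trans_le hB).le]
  regs r := by
    by_cases h : r = d
    · subst h; simp [g.reg_ne_pc]
    · simp [g.reg_ne_pc, h, g.reg_injective.ne h, hr]
  coin := hk

/-- The hypothesis `hc` on the registers of the next configuration makes the cut-off at `B`
harmless: the simulated value is the true one. -/
theorem represents_step (hQ : ∀ v r a, g.Used r → Q v → Q (Function.update v r a))
    (hRI : g.Reads x ro B Q RI Set.univ (RAM.inputAt x'))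
    (hRM : g.Reads x ro B Q RM A fun a => (ma a).toNat)
    (hB : Nat.card S.State ≤ B) {s : (R → ℕ) × ℕ} {c : S.Cfg} (hs : ∀ r, s.1 r ≤ B)
    (h : g.Represents s c) (hQs : Q s.1) (hc : ∀ r, (S.step x' ro ma c).regs r ≤ B)
    (hA : ∀ d a q, S.code c.state = .readMulti d a q → c.regs a ∈ A) :
    g.Represents ((g.stepProg RI RM).eval x ro B s) (S.step x' ro ma c) ∧
    Q ((g.stepProg RI RM).eval x ro B s).1 ∧
    ∀ a, S.code c.state = .halt a → ((g.stepProg RI RM).eval x ro B s).1 g.out = c.regs a := by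
  have hev : (g.stepProg RI RM).eval x ro B s = (g.instrProg RI RM c.state).eval x ro B s :=
    g.eval_switchProg h.pc (by simp)
  have hreg : ∀ r, g.Used (g.reg r) := fun r => .inl ⟨r, rfl⟩
  have hpc : g.Used g.pc := .inr (.inl rfl)
  have hadr : g.Used g.adr := .inr (.inr (.inl rfl))
  have hout : g.Used g.out := .inr (.inr (.inr (.inr rfl)))
  have hle : ∀ r, c.regs r ≤ B := fun r => h.regs r ▸ hs _
  rw [hev]
  unfold instrProg RAM.step
  unfold RAM.step at hc
  have hread : ∀ (p : Prog R) (A' : Set ℕ) (f : ℕ → ℕ), g.Reads x ro B Q p A' f →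
      ∀ (d a : S.Reg) (q' : S.State), c.regs a ∈ A' → f (c.regs a) ≤ B →
      g.Represents ((Prog.seq (.assign g.adr (.reg (g.reg a))) (.seq p
        (.seq (.assign (g.reg d) (.reg g.res)) (.assign g.pc (.const (S.index q')))))).eval x ro B s)
        ⟨q', Function.update c.regs d (f (c.regs a)), c.coin⟩ ∧
      Q ((Prog.seq (.assign g.adr (.reg (g.reg a))) (.seq p
        (.seq (.assign (g.reg d) (.reg g.res)) (.assign g.pc (.const (S.index q')))))).eval
          x ro B s).1 := by
    intro p A' f hp d a q' ha hf
    simp only [Prog.eval, Expr.eval, h.regs, min_eq_left (hle a)]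
    have hadrv : Function.update s.1 g.adr (c.regs a) g.adr = c.regs a := by simp
    obtain ⟨h1, h2, h3, h4, h5⟩ := hp (Function.update s.1 g.adr (c.regs a), s.2)
      (Frag.bounded_update hs (hle a)) (hQ _ _ _ hadr hQs) (by simpa using ha)
    simp only [hadrv] at h2
    rw [h2, min_eq_left hf]
    refine ⟨Represents.update_aux g (fun r => ?_) (by rw [h4, h.coin]) hB,
      hQ _ _ _ hpc (hQ _ _ _ (hreg d) h1)⟩
    rw [h5]
    simp [g.reg_ne_adr, h.regs]
  cases hcode : S.code c.state with
  | const d v q' =>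
    simp only [hcode] at hc
    have hd := hc d
    simp only [Function.update_self] at hd
    simp only [Prog.eval, Expr.eval, min_eq_left hd]
    exact ⟨Represents.update_aux g h.regs h.coin hB, hQ _ _ _ hpc (hQ _ _ _ (hreg d) hQs),
      fun a ha => by cases ha⟩
  | add d a b q' =>
    simp only [hcode] at hc
    have hd := hc d
    simp only [Function.update_self] at hd
    simp only [Prog.eval, Expr.eval, h.regs, min_eq_left hd]
    exact ⟨Represents.update_aux g h.regs h.coin hB, hQ _ _ _ hpc (hQ _ _ _ (hreg d) hQs),
      fun a ha => by cases ha⟩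
  | sub d a b q' =>
    simp only [hcode] at hc
    have hd := hc d
    simp only [Function.update_self] at hd
    simp only [Prog.eval, Expr.eval, h.regs, min_eq_left hd]
    exact ⟨Represents.update_aux g h.regs h.coin hB, hQ _ _ _ hpc (hQ _ _ _ (hreg d) hQs),
      fun a ha => by cases ha⟩
  | mul d a b q' =>
    simp only [hcode] at hc
    have hd := hc d
    simp only [Function.update_self] at hd
    simp only [Prog.eval, Expr.eval, h.regs, min_eq_left hd]
    exact ⟨Represents.update_aux g h.regs h.coin hB, hQ _ _ _ hpc (hQ _ _ _ (hreg d) hQs),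
      fun a ha => by cases ha⟩
  | div d a b q' =>
    simp only [hcode] at hc
    have hd := hc d
    simp only [Function.update_self] at hd
    simp only [Prog.eval, Expr.eval, h.regs, min_eq_left hd]
    exact ⟨Represents.update_aux g h.regs h.coin hB, hQ _ _ _ hpc (hQ _ _ _ (hreg d) hQs),
      fun a ha => by cases ha⟩
  | branch a b q' q'' =>
    simp only [Prog.eval, Expr.eval, h.regs]
    have aux : ∀ q₀ : S.State, g.Represents
        (Function.update s.1 g.pc (min (S.index q₀) B), s.2) ⟨q₀, c.regs, c.coin⟩ := fun q₀ =>
      ⟨by simp [((S.index_lt q₀).trans_le hB).le], fun r => by simp [g.reg_ne_pc, h.regs], h.coin⟩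
    split_ifs
    · exact ⟨aux _, hQ _ _ _ hpc hQs, fun a ha => by cases ha⟩
    · exact ⟨aux _, hQ _ _ _ hpc hQs, fun a ha => by cases ha⟩
  | readInput d a q' =>
    simp only [hcode] at hc
    have hd := hc d
    simp only [Function.update_self] at hd
    obtain ⟨h1, h2⟩ := hread RI _ _ hRI d a q' (Set.mem_univ _) hd
    exact ⟨h1, h2, fun a ha => by cases ha⟩
  | readMulti d a q' =>
    simp only [hcode] at hc
    have hd := hc d
    simp only [Function.update_self] at hd
    obtain ⟨h1, h2⟩ := hread RM _ _ hRM d a q' (hA _ _ _ hcode) hd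
    exact ⟨h1, h2, fun a ha => by cases ha⟩
  | flip d q' =>
    simp only [Prog.eval, Expr.eval, h.coin]
    exact ⟨Represents.update_aux (c := ⟨c.state, c.regs, c.coin + 1⟩) g h.regs rfl hB,
      hQ _ _ _ hpc (hQ _ _ _ (hreg d) hQs), fun a ha => by cases ha⟩
  | halt a =>
    simp only [Prog.eval, Expr.eval, h.regs, min_eq_left (hle a)]
    refine ⟨⟨?_, ?_, h.coin⟩, hQ _ _ _ hout hQs, fun a' ha => ?_⟩
    · simp [g.pc_ne_out, h.pc]
    · simp [g.reg_ne_out, h.regs]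
    · cases ha; simp

/-- The simulation computes the output of `S` on the input `x'`. -/
theorem eval_simProg (hQ : ∀ v r a, g.Used r → Q v → Q (Function.update v r a))
    (hRI : g.Reads x ro B Q RI Set.univ (RAM.inputAt x'))
    (hRM : g.Reads x ro B Q RM A fun a => (ma a).toNat)
    (hB : Nat.card S.State ≤ B) (hB1 : 1 ≤ B) {s : (R → ℕ) × ℕ} (hs : ∀ r, s.1 r ≤ B)
    (hQs : Q s.1) (h0 : ∀ r, s.1 (g.reg r) = 0) (hcoin : s.2 = 0)
    (hle : ∀ t r, (S.run x' ro ma t).regs r ≤ B)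
    (hA : ∀ t d a q, S.code (S.run x' ro ma t).state = .readMulti d a q →
      (S.run x' ro ma t).regs a ∈ A) {t y : ℕ} (ht : t < B) (hy : S.HaltsWith x' ro ma t y) :
    ((g.simProg RI RM).eval x ro B s).1 g.out = y ∧ Q ((g.simProg RI RM).eval x ro B s).1 ∧
    ∃ u, ((g.simProg RI RM).eval x ro B s).2 = (S.run x' ro ma u).coin := by
  set s0 : (R → ℕ) × ℕ := (Function.update s.1 g.pc (S.index S.start), s.2) with hs0
  have hstart : S.index S.start ≤ B := ((S.index_lt _).trans_le hB).le
  have hev : (g.simProg RI RM).eval x ro B s = ((g.stepProg RI RM).eval x ro B)^[B] s0 := by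
    simp only [simProg, Prog.eval, Expr.eval, min_eq_left hstart, hs0]
  have key : ∀ j, (∀ r, (((g.stepProg RI RM).eval x ro B)^[j] s0).1 r ≤ B) ∧
      g.Represents (((g.stepProg RI RM).eval x ro B)^[j] s0) (S.run x' ro ma j) ∧
      Q (((g.stepProg RI RM).eval x ro B)^[j] s0).1 := by
    intro j
    induction j with
    | zero =>
      refine ⟨Frag.bounded_update hs hstart, ⟨by simp [s0, RAM.run, RAM.init], fun r => ?_, hcoin⟩,
        hQ _ _ _ (.inr (.inl rfl)) hQs⟩
      simp [s0, RAM.run, RAM.init, g.reg_ne_pc, h0]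
    | succ j ih =>
      obtain ⟨h1, h2, h3⟩ := ih
      have hrun : S.run x' ro ma (j + 1) = S.step x' ro ma (S.run x' ro ma j) :=
        Function.iterate_succ_apply' _ _ _
      have := g.represents_step hQ hRI hRM hB h1 h2 h3 (hrun ▸ hle (j + 1)) (hA j)
      rw [Function.iterate_succ_apply', hrun]
      exact ⟨Prog.eval_le hB1 _ _ h1, this.1, this.2.1⟩
  refine ⟨?_, hev ▸ (key B).2.2, B, hev ▸ (key B).2.1.coin⟩
  -- The loop runs `B` rounds and `t < B`, so the last round, number `t + j + 1`, starts in the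
  -- halting configuration and stores the output.
  obtain ⟨j, rfl⟩ := Nat.exists_eq_add_of_lt ht
  have hhalt : S.run x' ro ma (t + j) = S.run x' ro ma t := by
    obtain ⟨a, ha, -⟩ := hy
    clear ht hev key hle hB hB1 hRI hRM hs hstart hA
    induction j with
    | zero => rfl
    | succ j ih =>
      rw [← add_assoc, RAM.run, Function.iterate_succ_apply']
      change S.step x' ro ma (S.run x' ro ma (t + j)) = _
      rw [ih, RAM.step, ha]
  obtain ⟨a, ha, hay⟩ := hy
  obtain ⟨h1, h2, h3⟩ := key (t + j)
  have hrun : S.run x' ro ma (t + j + 1) = S.step x' ro ma (S.run x' ro ma (t + j)) :=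
    Function.iterate_succ_apply' _ _ _
  have := (g.represents_step hQ hRI hRM hB h1 h2 h3 (hrun ▸ hle _) (hA _)).2.2 a
    (by rw [hhalt, ha])
  rw [hev, Function.iterate_succ_apply', this, hhalt, hay]

end

end SimRegs

/-! ## Reading encoded instances -/

theorem RAM.inputAt_append (x y : List Bool) (a : ℕ) : RAM.inputAt (x ++ y) a =
    if a < x.length then RAM.inputAt x a else RAM.inputAt y (a - x.length) := by
  unfold RAM.inputAt
  rw [List.getElem?_append]
  split_ifs <;> rfl

theorem RAM.inputAt_replicate (n a : ℕ) :
    RAM.inputAt (List.replicate n true) a = if a < n then 1 else 2 := by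
  unfold RAM.inputAt
  rw [List.getElem?_replicate]
  split_ifs <;> rfl

theorem encodePair_length (N k : ℕ) : (encodePair N k).length = N + k + 2 := by
  simp [encodePair]; omega

/-- The right side is phrased with nested `≤` tests, and `a + 1 ≤ N` instead of `a < N`, because
this is the only branching of the expression language; the programs can then evaluate it literally.
-/
theorem inputAt_encodePair_append (N k : ℕ) (y : List Bool) (a : ℕ) :
    RAM.inputAt (encodePair N k ++ y) a =
      if a + 1 ≤ N then 1 else if a ≤ N then 0 else
      if a ≤ N + k then 1 else if a ≤ N + k + 1 then 0 else
      RAM.inputAt y (a - (N + k + 2)) := by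
  have h0 : ∀ (L : List Bool) (a : ℕ), RAM.inputAt (false :: L) a =
      if a = 0 then 0 else RAM.inputAt L (a - 1) := by
    intro L a
    cases a <;> simp [RAM.inputAt]
  simp only [encodePair, List.append_assoc, List.cons_append, List.nil_append,
    RAM.inputAt_append, RAM.inputAt_replicate, List.length_replicate, h0]
  have h1 : a - N - 1 - k - 1 = a - (N + k + 2) := by omega
  rw [h1]
  split_ifs <;> first | rfl | omega

open Classical in
/-- The adjacency of two vertices given by their numbers. -/
noncomputable def adjBit {n : ℕ} (A : SimpleGraph (Fin n)) (u v : ℕ) : Bool :=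
  decide (∃ (hu : u < n) (hv : v < n), A.Adj ⟨u, hu⟩ ⟨v, hv⟩)

theorem adjBit_fin {n : ℕ} (A : SimpleGraph (Fin n)) (u v : Fin n) :
    adjBit A u v = true ↔ A.Adj u v := by
  simp [adjBit]

theorem adjBit_comm {n : ℕ} (A : SimpleGraph (Fin n)) (u v : ℕ) : adjBit A u v = adjBit A v u := by
  rw [Bool.eq_iff_iff]
  simp only [adjBit, decide_eq_true_eq]
  exact ⟨fun ⟨hu, hv, h⟩ => ⟨hv, hu, h.symm⟩, fun ⟨hu, hv, h⟩ => ⟨hv, hu, h.symm⟩⟩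

theorem adjBit_self {n : ℕ} (A : SimpleGraph (Fin n)) (u : ℕ) : adjBit A u u = false := by
  simp [adjBit]

theorem inputAt_encodeInstance {n : ℕ} (k : ℕ) (G : SimpleGraph (Fin n)) (a : ℕ) :
    RAM.inputAt (encodeInstance k G) a =
      if a + 1 ≤ n then 1 else if a ≤ n then 0 else
      if a ≤ n + k then 1 else if a ≤ n + k + 1 then 0 else
      if a - (n + k + 2) + 1 ≤ n * n then
        (adjBit G ((a - (n + k + 2)) / n) ((a - (n + k + 2)) % n)).toNat else 2 := by
  rw [encodeInstance, inputAt_encodePair_append]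
  congr 4
  set p := a - (n + k + 2)
  unfold RAM.inputAt
  rw [List.getElem?_ofFn]
  by_cases h : p < n * n
  · rw [dif_pos h, if_pos (by omega)]
    have := adjBit_fin G (Fin.divNat ⟨p, h⟩) (Fin.modNat ⟨p, h⟩)
    simp only [Fin.coe_divNat, Fin.coe_modNat] at this
    by_cases hb : G.Adj (Fin.divNat ⟨p, h⟩) (Fin.modNat ⟨p, h⟩)
    · rw [this.2 hb]; simp [hb]
    · have h2 : adjBit G (p / n) (p % n) = false := by
        rw [← Bool.not_eq_true, this]; exact hb
      rw [h2]; simp [hb]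
  · rw [dif_neg h, if_neg (by omega)]

theorem inputAt_encodeInstance_adj {n : ℕ} (k : ℕ) (G : SimpleGraph (Fin n)) {u v : ℕ} (hu : u < n)
    (hv : v < n) : RAM.inputAt (encodeInstance k G) (n + k + 2 + (u * n + v)) =
      (adjBit G u v).toNat := by
  have h : u * n + v < n * n := by nlinarith
  rw [inputAt_encodeInstance, if_neg (by omega), if_neg (by omega), if_neg (by omega),
    if_neg (by omega), Nat.add_sub_cancel_left, if_pos (by omega)]
  have h1 : (u * n + v) / n = u := by
    rw [mul_comm, Nat.mul_add_div (by omega), Nat.div_eq_of_lt hv, add_zero]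
  have h2 : (u * n + v) % n = v := by
    rw [mul_comm, Nat.mul_add_mod, Nat.mod_eq_of_lt hv]
  rw [h1, h2]

theorem encodeInstance_length {n : ℕ} (k : ℕ) (G : SimpleGraph (Fin n)) :
    (encodeInstance k G).length = n + k + 2 + n * n := by
  simp [encodeInstance, encodePair_length]

/-! ## The graphs and random strings extracted from an instance -/

/-- The `t`-th edge of `A` inside a block of size `ℓ`. -/
noncomputable def cleanBit {n : ℕ} (ℓ : ℕ) (A : SimpleGraph (Fin n)) (t : ℕ) : Bool :=
  adjBit A (t / (ℓ / 2 * (ℓ / 2)) * ℓ + t % (ℓ / 2 * (ℓ / 2)) / (ℓ / 2))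
    (t / (ℓ / 2 * (ℓ / 2)) * ℓ + ℓ / 2 + t % (ℓ / 2 * (ℓ / 2)) % (ℓ / 2))

/-- The number with binary digits `b 0, …, b (s - 1)` modulo `ℓ`. -/
def binaryMod (ℓ : ℕ) (b : ℕ → Bool) : ℕ → ℕ
  | 0 => 0
  | s + 1 => (2 * binaryMod ℓ b s + (b s).toNat) % ℓ

/-- The position of the clique vertex in the block `j` of the simulated instance. -/
noncomputable def simPos {n : ℕ} (ℓ ks : ℕ) (A : SimpleGraph (Fin n)) (j : ℕ) : ℕ :=
  binaryMod ℓ (fun s => cleanBit ℓ A (ℓ * ks * (ℓ * ks) + (j * ℓ + s))) ℓ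

/-- The induced subgraph on the first `m` vertices. -/
noncomputable def subGraph {n : ℕ} (m : ℕ) (A : SimpleGraph (Fin n)) : SimpleGraph (Fin m) where
  Adj u v := adjBit A u v = true
  symm := ⟨fun u v h => by rwa [adjBit_comm]⟩
  loopless := ⟨fun u h => by simp [adjBit_self] at h⟩

/-- The simulated planted clique instance. -/
noncomputable def simGraph {n : ℕ} (ℓ ks : ℕ) (A : SimpleGraph (Fin n)) :
    SimpleGraph (Fin (ℓ * ks)) where
  Adj u v := u ≠ v ∧ (((u : ℕ) % ℓ = simPos ℓ ks A (u / ℓ) ∧ (v : ℕ) % ℓ = simPos ℓ ks A (v / ℓ)) ∨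
    cleanBit ℓ A (min (u : ℕ) v * (ℓ * ks) + max (u : ℕ) v) = true)
  symm := ⟨fun u v ⟨h, h'⟩ => ⟨h.symm, by rwa [min_comm, max_comm, and_comm]⟩⟩
  loopless := ⟨fun u h => h.1 rfl⟩

/-- The simulated multiple access random string. -/
noncomputable def simMulti {n : ℕ} (W : ℕ) (A : SimpleGraph (Fin n)) (a : ℕ) : Bool :=
  adjBit A (W + a / W) (2 * W + a % W)

/-! ## The programs -/

/-- The registers of the reduction that do not belong to a simulated machine. -/
inductive MainReg : Type
  | vertices | parts | ell | k | ks | pc₁ | adr₁ | res₁ | pc₂ | adr₂ | res₂ | out | u | v | cu | cv | i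
  deriving DecidableEq

namespace MainReg

instance : Fintype MainReg where
  elems := {vertices, parts, ell, k, ks, pc₁, adr₁, res₁, pc₂, adr₂, res₂, out, u, v, cu, cv, i}
  complete r := by cases r <;> simp

end MainReg

/-- The registers of the reduction. -/
abbrev RedReg (K S : RAM) : Type := MainReg ⊕ (K.Reg ⊕ S.Reg)

namespace Reduction

open MainReg

variable {K S : RAM}

/-- The content of a register. -/
abbrev rd (r : MainReg) : Expr (RedReg K S) := .reg (.inl r)

/-- Assignment to a register. -/
abbrev asg (r : MainReg) (e : Expr (RedReg K S)) : Prog (RedReg K S) := .assign (.inl r) e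

/-- The registers for the simulation of the machine that computes the clique size. -/
def regs₁ (K S : RAM) : SimRegs K (RedReg K S) where
  reg r := .inr (.inl r)
  pc := .inl pc₁
  adr := .inl adr₁
  res := .inl res₁
  out := .inl ks
  reg_injective := Sum.inr_injective.comp Sum.inl_injective
  reg_ne_pc := by simp
  reg_ne_adr := by simp
  reg_ne_out := by simp
  pc_ne_out := by simp

/-- The registers for the simulation of the algorithm. -/
def regs₂ (K S : RAM) : SimRegs S (RedReg K S) where
  reg r := .inr (.inr r)
  pc := .inl pc₂
  adr := .inl adr₂
  res := .inl res₂
  out := .inl out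
  reg_injective := Sum.inr_injective.comp Sum.inr_injective
  reg_ne_pc := by simp
  reg_ne_adr := by simp
  reg_ne_out := by simp
  pc_ne_out := by simp

/-- The remainder. -/
def modE (a b : Expr (RedReg K S)) : Expr (RedReg K S) := .sub a (.mul b (.div a b))

/-- Case distinction on equality. -/
def eqE (a b c d : Expr (RedReg K S)) : Expr (RedReg K S) := .ite a b (.ite b a c d) d

/-- The symbol at the address `a` of the encoding of a pair, followed by `e`. -/
def pairE (n k a e : Expr (RedReg K S)) : Expr (RedReg K S) :=
  .ite (.add a (.const 1)) n (.const 1) (.ite a n (.const 0) (.ite a (.add n k) (.const 1)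
    (.ite a (.add (.add n k) (.const 1)) (.const 0) e)))

/-- An entry of the adjacency matrix. -/
def adjE (a b : Expr (RedReg K S)) : Expr (RedReg K S) :=
  .input (.add (.add (.add (rd vertices) (rd parts)) (.const 2)) (.add (.mul a (rd vertices)) b))

/-- Half of the block length. -/
def halfE : Expr (RedReg K S) := .div (rd ell) (.const 2)

/-- The bit `cleanBit`. -/
def cleanE (t : Expr (RedReg K S)) : Expr (RedReg K S) :=
  adjE (.add (.mul (.div t (.mul halfE halfE)) (rd ell)) (.div (modE t (.mul halfE halfE)) halfE))
    (.add (.add (.mul (.div t (.mul halfE halfE)) (rd ell)) halfE)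
      (modE (modE t (.mul halfE halfE)) halfE))

/-- The number of vertices of the simulated instance. -/
def sizeE : Expr (RedReg K S) := .mul (rd ell) (rd ks)

/-- The position in the adjacency matrix of the simulated instance. -/
def matE : Expr (RedReg K S) := .sub (rd adr₂) (.add (.add sizeE (rd ks)) (.const 2))

/-- The symbol of the simulated instance, `e` being the entry of the adjacency matrix. -/
def instE (e : Expr (RedReg K S)) : Expr (RedReg K S) :=
  pairE sizeE (rd ks) (rd adr₂) (.ite (.add matE (.const 1)) (.mul sizeE sizeE) e (.const 2))

section eval

variable (x : List Bool) (B : ℕ) (v : RedReg K S → ℕ)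

@[simp] theorem eval_modE (a b : Expr (RedReg K S)) :
    (modE a b).eval x B v = a.eval x B v % b.eval x B v := by
  simp only [modE, Expr.eval]
  rw [Nat.mod_def]

@[simp] theorem eval_eqE (a b c d : Expr (RedReg K S)) : (eqE a b c d).eval x B v =
    if a.eval x B v = b.eval x B v then c.eval x B v else d.eval x B v := by
  simp only [eqE, Expr.eval]
  split_ifs <;> first | rfl | omega

@[simp] theorem eval_pairE (n k a e : Expr (RedReg K S)) : (pairE n k a e).eval x B v =
    if a.eval x B v + 1 ≤ n.eval x B v then 1 else if a.eval x B v ≤ n.eval x B v then 0 else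
    if a.eval x B v ≤ n.eval x B v + k.eval x B v then 1 else
    if a.eval x B v ≤ n.eval x B v + k.eval x B v + 1 then 0 else e.eval x B v := rfl

@[simp] theorem eval_adjE (a b : Expr (RedReg K S)) : (adjE a b).eval x B v =
    RAM.inputAt x (v (.inl vertices) + v (.inl parts) + 2 +
      (a.eval x B v * v (.inl vertices) + b.eval x B v)) := rfl

@[simp] theorem eval_halfE : (halfE : Expr (RedReg K S)).eval x B v = v (.inl ell) / 2 := rfl

@[simp] theorem eval_sizeE : (sizeE : Expr (RedReg K S)).eval x B v =
    v (.inl ell) * v (.inl ks) := rfl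

@[simp] theorem eval_matE : (matE : Expr (RedReg K S)).eval x B v =
    v (.inl adr₂) - (v (.inl ell) * v (.inl ks) + v (.inl ks) + 2) := rfl

end eval

/-- The registers hold the parameters of the instance. -/
structure Params (n k' ℓ k₀ : ℕ) (w : RedReg K S → ℕ) : Prop where
  vertices : w (.inl vertices) = n
  parts : w (.inl parts) = k'
  ell : w (.inl ell) = ℓ
  k : w (.inl k) = k₀

theorem Params.update {n k' ℓ k₀ : ℕ} {w : RedReg K S → ℕ} (h : Params n k' ℓ k₀ w)
    {r : RedReg K S} (a : ℕ) (h1 : r ≠ .inl MainReg.vertices) (h2 : r ≠ .inl MainReg.parts)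
    (h3 : r ≠ .inl MainReg.ell) (h4 : r ≠ .inl MainReg.k) :
    Params n k' ℓ k₀ (Function.update w r a) where
  vertices := by rw [Function.update_of_ne h1.symm, h.vertices]
  parts := by rw [Function.update_of_ne h2.symm, h.parts]
  ell := by rw [Function.update_of_ne h3.symm, h.ell]
  k := by rw [Function.update_of_ne h4.symm, h.k]

/-- Count the leading ones from a position of the input on. -/
def countProg (r : MainReg) (e : Expr (RedReg K S)) : Prog (RedReg K S) :=
  .loop .bound (.ite (.const 1) (.input e) (asg r (.add (rd r) (.const 1))) (asg r (rd r)))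

/-- There is no early exit: the loop always runs `B` rounds. Once the count reaches `m` it keeps
rereading the separator `0` and stays constant. -/
theorem eval_countProg {x : List Bool} {ro : ℕ → Bool} {B : ℕ} {r : MainReg}
    {e : Expr (RedReg K S)} {s : (RedReg K S → ℕ) × ℕ} {m off : ℕ} (h0 : s.1 (.inl r) = 0)
    (he : ∀ j, e.eval x B (Function.update s.1 (.inl r) j) = off + j)
    (h1 : ∀ j < m, 1 ≤ RAM.inputAt x (off + j)) (h2 : RAM.inputAt x (off + m) = 0) (hm : m ≤ B) :
    (countProg r e).eval x ro B s = (Function.update s.1 (.inl r) m, s.2) := by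
  simp only [countProg, Prog.eval, Expr.eval]
  have key : ∀ j, (((Prog.ite (.const 1) (.input e) (asg r (.add (rd r) (.const 1)))
      (asg r (rd r))).eval x ro B)^[j] s) = (Function.update s.1 (.inl r) (min j m), s.2) := by
    intro j
    induction j with
    | zero =>
      have : Function.update s.1 (.inl r) 0 = s.1 := by
        conv_lhs => rw [← h0, Function.update_eq_self]
      rw [Nat.zero_min, this]
      rfl
    | succ j ih =>
      rw [Function.iterate_succ_apply', ih]
      simp only [Prog.eval, Expr.eval, he, Function.update_self, Function.update_idem]
      by_cases hj : j < m
      · rw [min_eq_left hj.le, if_pos (h1 j hj), min_eq_left (by omega), min_eq_left (by omega)]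
      · rw [min_eq_right (by omega), h2, if_neg (by omega), min_eq_left (by omega),
          min_eq_right (by omega)]
  have := key B
  rwa [min_eq_right hm] at this

/-- Compute the parameters of the instance. -/
def setupProg : Prog (RedReg K S) :=
  .seq (countProg vertices (rd vertices)) (.seq
    (countProg parts (.add (.add (rd vertices) (.const 1)) (rd parts)))
    (.seq (asg k (.div (rd parts) (.const 3))) (asg ell (.div (rd vertices) (rd parts)))))

theorem eval_setupProg {ℓ k₀ : ℕ} (hk : 0 < k₀) (A : SimpleGraph (Fin (ℓ * (3 * k₀))))
    (ro : ℕ → Bool) {B : ℕ} (hB : (encodeInstance (3 * k₀) A).length ≤ B) :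
    ∃ w : RedReg K S → ℕ, (setupProg : Prog (RedReg K S)).eval (encodeInstance (3 * k₀) A) ro B
      (fun _ => 0, 0) = (w, 0) ∧ Params (ℓ * (3 * k₀)) (3 * k₀) ℓ k₀ w ∧
      (∀ r, w (.inr r) = 0) ∧ ∀ r, w r ≤ B := by
  set x := encodeInstance (3 * k₀) A with hx
  set n := ℓ * (3 * k₀) with hn
  rw [encodeInstance_length] at hB
  have hdiv : n / (3 * k₀) = ℓ := Nat.mul_div_cancel _ (by omega)
  have h1 : (countProg vertices (rd vertices)).eval x ro B ((fun _ => 0 : RedReg K S → ℕ), 0) =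
      (Function.update (fun _ => 0) (.inl vertices) n, 0) := by
    refine eval_countProg (off := 0) rfl (fun j => by simp [Expr.eval]) (fun j hj => ?_) ?_ (by omega)
    · rw [hx, inputAt_encodeInstance, if_pos (by omega)]
    · rw [hx, inputAt_encodeInstance, if_neg (by omega), if_pos (by omega)]
  have h2 : (countProg parts (.add (.add (rd vertices) (.const 1)) (rd parts))).eval x ro B
      ((Function.update (fun _ => 0) (.inl vertices) n : RedReg K S → ℕ), 0) =
      (Function.update (Function.update (fun _ => 0) (.inl vertices) n) (.inl parts) (3 * k₀), 0) := by
    refine eval_countProg (off := n + 1) (by simp) (fun j => by simp [Expr.eval])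
      (fun j hj => ?_) ?_ (by omega)
    · rw [hx, inputAt_encodeInstance]
      rw [if_neg (by omega), if_neg (by omega), if_pos (by omega)]
    · rw [hx, inputAt_encodeInstance]
      rw [if_neg (by omega), if_neg (by omega), if_neg (by omega), if_pos (by omega)]
  have hℓn : ℓ ≤ n := Nat.le_mul_of_pos_right _ (by omega)
  refine ⟨Function.update (Function.update (Function.update (Function.update (fun _ => 0)
    (.inl vertices) n) (.inl parts) (3 * k₀)) (.inl k) k₀) (.inl ell) ℓ, ?_, ?_, ?_, ?_⟩
  · simp only [setupProg, Prog.eval, h1, h2]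
    have e1 : min k₀ B = k₀ := by omega
    have e2 : min ℓ B = ℓ := by omega
    simp [Expr.eval, e1, hdiv, e2]
  · constructor <;> simp
  · simp
  · refine Frag.bounded_update (Frag.bounded_update (Frag.bounded_update (Frag.bounded_update
      (fun _ => Nat.zero_le _) ?_) ?_) ?_) ?_ <;> omega

/-- Access to the input of the machine that computes the clique size. -/
def readPair : Prog (RedReg K S) :=
  asg res₁ (pairE (.mul (rd ell) (rd k)) (rd k) (rd adr₁) (.const 2))

/-- Access to the simulated multiple access random string. -/
def readMulti : Prog (RedReg K S) :=
  asg res₂ (adjE (.add (.mul (rd ell) (rd k)) (.div (rd adr₂) (.mul (rd ell) (rd k))))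
    (.add (.mul (.const 2) (.mul (rd ell) (rd k))) (modE (rd adr₂) (.mul (rd ell) (rd k)))))

/-- The parameters including the clique size. -/
def Params₂ (n k' ℓ k₀ ks₀ : ℕ) (w : RedReg K S → ℕ) : Prop :=
  Params n k' ℓ k₀ w ∧ w (.inl ks) = ks₀

theorem Params₂.update {n k' ℓ k₀ ks₀ : ℕ} {w : RedReg K S → ℕ} (h : Params₂ n k' ℓ k₀ ks₀ w)
    {r : RedReg K S} (a : ℕ) (h1 : r ≠ .inl MainReg.vertices) (h2 : r ≠ .inl MainReg.parts)
    (h3 : r ≠ .inl MainReg.ell) (h4 : r ≠ .inl MainReg.k) (h5 : r ≠ .inl MainReg.ks) :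
    Params₂ n k' ℓ k₀ ks₀ (Function.update w r a) :=
  ⟨h.1.update a h1 h2 h3 h4, by rw [Function.update_of_ne h5.symm, h.2]⟩

theorem Params₂.update_used {n k' ℓ k₀ ks₀ : ℕ} (w : RedReg K S → ℕ) (r : RedReg K S) (a : ℕ)
    (hr : (regs₂ K S).Used r) (h : Params₂ n k' ℓ k₀ ks₀ w) :
    Params₂ n k' ℓ k₀ ks₀ (Function.update w r a) := by
  rcases hr with ⟨b, rfl⟩ | rfl | rfl | rfl | rfl <;>
    exact h.update a (by simp [regs₂]) (by simp [regs₂]) (by simp [regs₂]) (by simp [regs₂])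
      (by simp [regs₂])

/-- The parameters before the algorithm is simulated. -/
def Params₁ (n k' ℓ k₀ : ℕ) (w : RedReg K S → ℕ) : Prop :=
  Params n k' ℓ k₀ w ∧ ∀ r, w (.inr (.inr r)) = 0

theorem Params₁.update_used {n k' ℓ k₀ : ℕ} (w : RedReg K S → ℕ) (r : RedReg K S) (a : ℕ)
    (hr : (regs₁ K S).Used r) (h : Params₁ n k' ℓ k₀ w) :
    Params₁ n k' ℓ k₀ (Function.update w r a) := by
  rcases hr with ⟨b, rfl⟩ | rfl | rfl | rfl | rfl <;>
    exact ⟨h.1.update a (by simp [regs₁]) (by simp [regs₁]) (by simp [regs₁]) (by simp [regs₁]),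
      fun r => by simp [regs₁, h.2 r]⟩

theorem reads_pair {x : List Bool} {ro : ℕ → Bool} {B n k' ℓ k₀ : ℕ} (hB : 2 ≤ B) :
    (regs₁ K S).Reads x ro B (Params₁ n k' ℓ k₀) readPair Set.univ
      (RAM.inputAt (encodePair (ℓ * k₀) k₀)) := by
  intro s hs hQ _
  have hval : (pairE (.mul (rd ell) (rd k)) (rd k) (rd adr₁) (.const 2) :
      Expr (RedReg K S)).eval x B s.1 = RAM.inputAt (encodePair (ℓ * k₀) k₀) (s.1 (.inl adr₁)) := by
    rw [← List.append_nil (encodePair (ℓ * k₀) k₀), inputAt_encodePair_append, eval_pairE]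
    simp only [Expr.eval, hQ.1.ell, hQ.1.k]
    rfl
  have hle := (RAM.inputAt_le (encodePair (ℓ * k₀) k₀) (s.1 (.inl adr₁))).trans hB
  simp only [readPair, Prog.eval, hval, min_eq_left hle]
  refine ⟨Params₁.update_used _ _ _ (.inr (.inr (.inr (.inl rfl)))) hQ, ?_, ?_, trivial, ?_⟩ <;>
    simp [regs₁]

/-- With `W = ℓ * k₀`, the address is split by division with remainder into a vertex of the middle
third and a vertex of the last third. Addresses below `W * W` keep both vertices in range. -/
theorem reads_multi {ℓ k₀ ks₀ : ℕ} (A : SimpleGraph (Fin (ℓ * (3 * k₀)))) {ro : ℕ → Bool} {B : ℕ}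
    (hB : 2 ≤ B) : (regs₂ K S).Reads (encodeInstance (3 * k₀) A) ro B
      (Params₂ (ℓ * (3 * k₀)) (3 * k₀) ℓ k₀ ks₀) readMulti {a | a < ℓ * k₀ * (ℓ * k₀)}
      (fun a => (simMulti (ℓ * k₀) A a).toNat) := by
  intro s hs hQ ha
  set a := s.1 (.inl adr₂) with ha'
  change a < ℓ * k₀ * (ℓ * k₀) at ha
  have h1 : a / (ℓ * k₀) < ℓ * k₀ := Nat.div_lt_of_lt_mul ha
  have h2 : a % (ℓ * k₀) < ℓ * k₀ := Nat.mod_lt _ ((Nat.zero_le _).trans_lt h1)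
  have h3 : ℓ * (3 * k₀) = 3 * (ℓ * k₀) := by ring
  have hval : (adjE (.add (.mul (rd ell) (rd k)) (.div (rd adr₂) (.mul (rd ell) (rd k))))
    (.add (.mul (.const 2) (.mul (rd ell) (rd k))) (modE (rd adr₂) (.mul (rd ell) (rd k)))) :
      Expr (RedReg K S)).eval (encodeInstance (3 * k₀) A) B s.1 =
      (simMulti (ℓ * k₀) A a).toNat := by
    rw [eval_adjE]
    simp only [Expr.eval, eval_modE, hQ.1.ell, hQ.1.k, hQ.1.vertices, hQ.1.parts, ← ha']
    rw [inputAt_encodeInstance_adj _ _ (by omega) (by omega)]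
    rfl
  have hle : (simMulti (ℓ * k₀) A a).toNat ≤ B := (Bool.toNat_le _).trans (by omega)
  simp only [readMulti, Prog.eval, hval, min_eq_left hle]
  refine ⟨Params₂.update_used _ _ _ (.inr (.inr (.inr (.inl rfl)))) hQ, ?_, ?_, trivial, ?_⟩ <;>
    simp [regs₂, ha']

/-- The complete program of the reduction; `p` reads the simulated instance. -/
noncomputable def redProg (p : Prog (RedReg K S)) : Prog (RedReg K S) :=
  .seq setupProg (.seq ((regs₁ K S).simProg readPair (asg res₁ (.const 0)))
    ((regs₂ K S).simProg p readMulti))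

/-- Needed twice: computing the clique size leaves the read-once string at its beginning for the
simulation of `S`, and the coin position can be ignored when configurations are counted. -/
theorem run_coin_of_noFlip {M : RAM} (h : M.NoFlip) (x : List Bool) (ro ma : ℕ → Bool) (t : ℕ) :
    (M.run x ro ma t).coin = 0 := by
  induction t with
  | zero => rfl
  | succ t ih =>
    rw [RAM.run, Function.iterate_succ_apply']
    change (M.step x ro ma (M.run x ro ma t)).coin = 0
    generalize M.run x ro ma t = c at ih
    unfold RAM.step
    cases hc : M.code c.state <;> simp only [ih]
    exact absurd hc (h _ _ _)

theorem eval_redProg {ℓ k₀ ks₀ : ℕ} (hk : 0 < k₀) (A : SimpleGraph (Fin (ℓ * (3 * k₀))))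
    (H : SimpleGraph (Fin (ℓ * ks₀))) {ro : ℕ → Bool} {B : ℕ} {p : Prog (RedReg K S)}
    (hB : (encodeInstance (3 * k₀) A).length ≤ B) (hK : K.NoMulti) (hK' : K.NoFlip)
    (hKB : Nat.card K.State ≤ B) (hSB : Nat.card S.State ≤ B)
    {ma' : ℕ → Bool} {t₁ : ℕ} (ht₁ : t₁ < B)
    (hhalt₁ : K.HaltsWith (encodePair (ℓ * k₀) k₀) ro ma' t₁ ks₀)
    (hle₁ : ∀ t r, (K.run (encodePair (ℓ * k₀) k₀) ro ma' t).regs r ≤ B)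
    (hp : (regs₂ K S).Reads (encodeInstance (3 * k₀) A) ro B
      (Params₂ (ℓ * (3 * k₀)) (3 * k₀) ℓ k₀ ks₀) p Set.univ (RAM.inputAt (encodeInstance ks₀ H)))
    (hA : S.UsesMultiAtMost (encodeInstance ks₀ H) (ℓ * k₀ * (ℓ * k₀)))
    {t₂ y : ℕ} (ht₂ : t₂ < B)
    (hhalt₂ : S.HaltsWith (encodeInstance ks₀ H) ro (simMulti (ℓ * k₀) A) t₂ y)
    (hle₂ : ∀ t r, (S.run (encodeInstance ks₀ H) ro (simMulti (ℓ * k₀) A) t).regs r ≤ B) :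
    ((redProg p).eval (encodeInstance (3 * k₀) A) ro B (fun _ => 0, 0)).1 (.inl out) = y := by
  obtain ⟨w, hw, hpar, hzero, hwB⟩ := eval_setupProg (K := K) (S := S) hk A ro hB
  have hB2 : 2 ≤ B := by rw [encodeInstance_length] at hB; omega
  set x := encodeInstance (3 * k₀) A
  -- The machine `K` never reads multiple access bits, so a dummy reading routine with the empty set
  -- of admissible addresses is enough.
  have h1 := (regs₁ K S).eval_simProg (x := x) (ro := ro) (ma := ma') (B := B)
    (Q := Params₁ (ℓ * (3 * k₀)) (3 * k₀) ℓ k₀) (RI := readPair) (RM := asg res₁ (.const 0))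
    (A := ∅) (s := (w, 0)) Params₁.update_used (reads_pair hB2) (fun s _ _ h => h.elim) hKB
    (by omega) hwB ⟨hpar, fun r => hzero _⟩ (fun r => hzero _) rfl hle₁
    (fun t d a q h => absurd h (hK _ _ _ _)) ht₁ hhalt₁
  set s₁ := ((regs₁ K S).simProg readPair (asg res₁ (.const 0))).eval x ro B (w, 0) with hs₁
  obtain ⟨hks, hQ, u, hu⟩ := h1
  rw [run_coin_of_noFlip hK'] at hu
  have hs₁B : ∀ r, s₁.1 r ≤ B := Prog.eval_le (by omega) _ _ hwB
  have h2 := (regs₂ K S).eval_simProg (x := x) (ro := ro) (ma := simMulti (ℓ * k₀) A) (B := B)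
    (Q := Params₂ (ℓ * (3 * k₀)) (3 * k₀) ℓ k₀ ks₀) (RI := p) (RM := readMulti) (s := s₁)
    Params₂.update_used hp (reads_multi A hB2) hSB (by omega) hs₁B ⟨hQ.1, hks⟩ hQ.2 hu hle₂
    (fun t d a q h => hA _ _ t d a q h) ht₂ hhalt₂
  simp only [redProg, Prog.eval, hw]
  exact h2.1

end Reduction

/-! ### On-demand reading of the two instances presented to `S` -/

namespace Reduction

open MainReg

variable {K S : RAM}

theorem eval_instE {x : List Bool} {B n k' ℓ k₀ ks₀ : ℕ} {w : RedReg K S → ℕ}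
    (hw : Params₂ n k' ℓ k₀ ks₀ w) (H : SimpleGraph (Fin (ℓ * ks₀))) {e : Expr (RedReg K S)}
    (he : ∀ p, p = w (.inl adr₂) - (ℓ * ks₀ + ks₀ + 2) → p < ℓ * ks₀ * (ℓ * ks₀) →
      e.eval x B w = (adjBit H (p / (ℓ * ks₀)) (p % (ℓ * ks₀))).toNat) :
    (instE e).eval x B w = RAM.inputAt (encodeInstance ks₀ H) (w (.inl adr₂)) := by
  rw [inputAt_encodeInstance]
  simp only [instE, eval_pairE, eval_sizeE, Expr.eval, eval_matE, hw.1.ell, hw.2]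
  split_ifs <;> first | rfl | exact he _ rfl (by omega)

/-- Read the induced subgraph on the first blocks. -/
def readSub : Prog (RedReg K S) :=
  asg res₂ (instE (adjE (.div matE sizeE) (modE matE sizeE)))

theorem reads_sub {ℓ k₀ ks₀ : ℕ} (hks : ks₀ ≤ k₀) (A : SimpleGraph (Fin (ℓ * (3 * k₀))))
    {ro : ℕ → Bool} {B : ℕ} (hB : 2 ≤ B) :
    (regs₂ K S).Reads (encodeInstance (3 * k₀) A) ro B
      (Params₂ (ℓ * (3 * k₀)) (3 * k₀) ℓ k₀ ks₀) readSub Set.univ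
      (RAM.inputAt (encodeInstance ks₀ (subGraph (ℓ * ks₀) A))) := by
  intro s hs hQ _
  have hval : (instE (adjE (.div matE sizeE) (modE matE sizeE)) :
      Expr (RedReg K S)).eval (encodeInstance (3 * k₀) A) B s.1 =
      RAM.inputAt (encodeInstance ks₀ (subGraph (ℓ * ks₀) A)) (s.1 (.inl adr₂)) := by
    refine eval_instE hQ _ fun p hp hlt => ?_
    have h1 : p / (ℓ * ks₀) < ℓ * ks₀ := Nat.div_lt_of_lt_mul hlt
    have h2 : p % (ℓ * ks₀) < ℓ * ks₀ := Nat.mod_lt _ ((Nat.zero_le _).trans_lt h1)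
    have h3 : ℓ * ks₀ ≤ ℓ * (3 * k₀) := Nat.mul_le_mul_left _ (by omega)
    simp only [eval_adjE, Expr.eval, eval_modE, eval_matE, eval_sizeE, hQ.1.ell, hQ.2,
      hQ.1.vertices, hQ.1.parts, ← hp]
    rw [inputAt_encodeInstance_adj _ _ (by omega) (by omega)]
    congr 1
    rw [Bool.eq_iff_iff]
    have := adjBit_fin (subGraph (ℓ * ks₀) A) ⟨_, h1⟩ ⟨_, h2⟩
    simp only at this
    rw [this]
    rfl
  have hle := (RAM.inputAt_le (encodeInstance ks₀ (subGraph (ℓ * ks₀) A))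
    (s.1 (.inl adr₂))).trans hB
  simp only [readSub, Prog.eval, hval, min_eq_left hle]
  refine ⟨Params₂.update_used _ _ _ (.inr (.inr (.inr (.inl rfl)))) hQ, ?_, ?_, trivial, ?_⟩ <;>
    simp [regs₂]

/-- The bound on `T` is the number of blocks times the number of pairs between the two halves of a
block; it keeps both endpoints inside the graph. -/
theorem eval_cleanE {ℓ k₀ ks₀ : ℕ} (A : SimpleGraph (Fin (ℓ * (3 * k₀)))) {B : ℕ}
    {w : RedReg K S → ℕ} (hw : Params₂ (ℓ * (3 * k₀)) (3 * k₀) ℓ k₀ ks₀ w)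
    (t : Expr (RedReg K S)) {T : ℕ} (ht : t.eval (encodeInstance (3 * k₀) A) B w = T)
    (hT : T < 3 * k₀ * (ℓ / 2 * (ℓ / 2))) :
    (cleanE t).eval (encodeInstance (3 * k₀) A) B w = (cleanBit ℓ A T).toNat := by
  simp only [cleanE, eval_adjE, Expr.eval, eval_modE, eval_halfE, ht, hw.1.ell, hw.1.vertices,
    hw.1.parts]
  set h := ℓ / 2 with hh
  have hpos : 0 < h := by
    by_contra h0
    have : h = 0 := by omega
    simp [this] at hT
  have h1 : T / (h * h) < 3 * k₀ := Nat.div_lt_of_lt_mul (by rwa [mul_comm])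
  have h2 : T % (h * h) / h < h := Nat.div_lt_of_lt_mul (Nat.mod_lt _ (by positivity))
  have h3 : T % (h * h) % h < h := Nat.mod_lt _ hpos
  have h4 : T / (h * h) * ℓ + ℓ ≤ ℓ * (3 * k₀) := by
    calc _ = (T / (h * h) + 1) * ℓ := by ring
      _ ≤ 3 * k₀ * ℓ := Nat.mul_le_mul_right _ h1
      _ = _ := mul_comm _ _
  rw [inputAt_encodeInstance_adj _ _ (by omega) (by omega)]
  rfl

/-- Compute the clique position in the block of the vertex in the register `b`. -/
def posProg (c b : MainReg) : Prog (RedReg K S) :=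
  .seq (asg c (.const 0)) (.seq (asg i (.const 0)) (.loop (rd ell)
    (.seq (asg c (modE (.add (.mul (.const 2) (rd c)) (cleanE (.add (.mul sizeE sizeE)
      (.add (.mul (.div (rd b) (rd ell)) (rd ell)) (rd i))))) (rd ell)))
      (asg i (.add (rd i) (.const 1))))))

theorem binaryMod_lt {ℓ : ℕ} (hℓ : 0 < ℓ) (b : ℕ → Bool) (s : ℕ) : binaryMod ℓ b s < ℓ := by
  cases s with
  | zero => exact hℓ
  | succ s => exact Nat.mod_lt _ hℓ

/-- The framing part is unconditional and only the value of `X` needs a valid vertex: the routine is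
also executed for addresses outside the adjacency matrix, where the vertex numbers can be
meaningless. -/
theorem eval_posProg {ℓ k₀ ks₀ : ℕ} (A : SimpleGraph (Fin (ℓ * (3 * k₀)))) {ro : ℕ → Bool}
    {B : ℕ} {c b : MainReg} (hcb : c ≠ b) (hci : c ≠ i) (hbi : b ≠ i)
    (hc1 : c ≠ vertices) (hc2 : c ≠ parts) (hc3 : c ≠ ell) (hc4 : c ≠ k) (hc5 : c ≠ ks)
    (hℓ : 0 < ℓ) (hB : ℓ ≤ B)
    (hcap : ℓ * ks₀ * (ℓ * ks₀) + ℓ * ks₀ ≤ 3 * k₀ * (ℓ / 2 * (ℓ / 2)))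
    {w₀ : RedReg K S → ℕ} {q : ℕ} (hQ : Params₂ (ℓ * (3 * k₀)) (3 * k₀) ℓ k₀ ks₀ w₀) :
    ∃ X Y, (posProg c b).eval (encodeInstance (3 * k₀) A) ro B (w₀, q) =
      (Function.update (Function.update w₀ (.inl c) X) (.inl i) Y, q) ∧
      (w₀ (.inl b) < ℓ * ks₀ → X = simPos ℓ ks₀ A (w₀ (.inl b) / ℓ)) := by
  set x := encodeInstance (3 * k₀) A with hx
  set body : Prog (RedReg K S) :=
    .seq (asg c (modE (.add (.mul (.const 2) (rd c)) (cleanE (.add (.mul sizeE sizeE)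
      (.add (.mul (.div (rd b) (rd ell)) (rd ell)) (rd i))))) (rd ell)))
      (asg i (.add (rd i) (.const 1))) with hbody
  set f : ℕ → Bool := fun t => cleanBit ℓ A (ℓ * ks₀ * (ℓ * ks₀) + (w₀ (.inl b) / ℓ * ℓ + t))
  have key : ∀ j ≤ ℓ, ∃ X, (body.eval x ro B)^[j]
      (Function.update (Function.update w₀ (.inl c) 0) (.inl i) 0, q) =
      (Function.update (Function.update w₀ (.inl c) X) (.inl i) j, q) ∧
      (w₀ (.inl b) < ℓ * ks₀ → X = binaryMod ℓ f j) := by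
    intro j
    induction j with
    | zero => exact fun _ => ⟨0, rfl, fun _ => rfl⟩
    | succ j ih =>
      intro hj
      obtain ⟨X, h1, h2⟩ := ih (by omega)
      set w := Function.update (Function.update w₀ (.inl c) X) (.inl i) j with hw
      have hQw : Params₂ (ℓ * (3 * k₀)) (3 * k₀) ℓ k₀ ks₀ w :=
        (hQ.update X (by simpa) (by simpa) (by simpa) (by simpa) (by simpa)).update j
          (by simp) (by simp) (by simp) (by simp) (by simp)
      have hwc : w (.inl c) = X := by simp [hw, hci]
      have hwb : w (.inl b) = w₀ (.inl b) := by simp [hw, hbi, hcb.symm]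
      have hwi : w (.inl i) = j := by simp [hw]
      refine ⟨min ((2 * X + (cleanE (.add (.mul sizeE sizeE)
        (.add (.mul (.div (rd b) (rd ell)) (rd ell)) (rd i)))).eval x B w) % ℓ) B, ?_, ?_⟩
      · rw [Function.iterate_succ_apply', h1]
        simp only [hbody, Prog.eval, eval_modE, Expr.eval, hwc, hQw.1.ell]
        simp only [ne_eq, Sum.inl.injEq, hci.symm, not_false_eq_true, Function.update_of_ne, hwi]
        rw [min_eq_left (show j + 1 ≤ B by omega), hw]
        congr 1
        funext r
        by_cases hri : r = .inl i
        · subst hri; simp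
        · by_cases hrc : r = .inl c
          · subst hrc; simp [hci]
          · simp [hri, hrc]
      · intro hb
        have hdiv : w₀ (.inl b) / ℓ < ks₀ := Nat.div_lt_of_lt_mul hb
        have hlt : w₀ (.inl b) / ℓ * ℓ + j < ℓ * ks₀ := by
          calc _ < w₀ (.inl b) / ℓ * ℓ + ℓ := by omega
            _ = (w₀ (.inl b) / ℓ + 1) * ℓ := by ring
            _ ≤ ks₀ * ℓ := Nat.mul_le_mul_right _ hdiv
            _ = _ := mul_comm _ _
        rw [eval_cleanE (T := ℓ * ks₀ * (ℓ * ks₀) + (w₀ (.inl b) / ℓ * ℓ + j)) A hQw _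
          (by simp [Expr.eval, hQw.1.ell, hQw.2, hwb, hwi]) (by omega), h2 hb, min_eq_left]
        · rfl
        · exact (Nat.mod_lt _ hℓ).le.trans hB
  obtain ⟨X, h1, h2⟩ := key ℓ le_rfl
  refine ⟨X, ℓ, ?_, h2⟩
  have hell : Function.update (Function.update w₀ (.inl c) 0) (.inl i) 0 (.inl ell) = ℓ := by
    simp [hc3.symm, hQ.1.ell]
  simp only [posProg, Prog.eval, Expr.eval, Nat.zero_min, hell]
  exact h1

/-- Read the simulated planted clique instance. -/
def readSim : Prog (RedReg K S) :=
  .seq (asg u (.div matE sizeE)) (.seq (asg v (modE matE sizeE)) (.seq (posProg cu u)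
    (.seq (posProg cv v) (asg res₂ (instE (eqE (rd u) (rd v) (.const 0)
      (.ite (eqE (modE (rd u) (rd ell)) (rd cu) (.const 0) (.const 1)) (.const 0)
        (eqE (modE (rd v) (rd ell)) (rd cv) (.const 1)
          (cleanE (.add (.mul (.ite (rd u) (rd v) (rd u) (rd v)) sizeE)
            (.ite (rd u) (rd v) (rd v) (rd u)))))
        (cleanE (.add (.mul (.ite (rd u) (rd v) (rd u) (rd v)) sizeE)
          (.ite (rd u) (rd v) (rd v) (rd u)))))))))))

theorem reads_sim {ℓ k₀ ks₀ : ℕ} (A : SimpleGraph (Fin (ℓ * (3 * k₀))))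
    {ro : ℕ → Bool} {B : ℕ} (hB : 2 ≤ B) (hℓ : 0 < ℓ) (hℓB : ℓ ≤ B)
    (hcap : ℓ * ks₀ * (ℓ * ks₀) + ℓ * ks₀ ≤ 3 * k₀ * (ℓ / 2 * (ℓ / 2))) :
    (regs₂ K S).Reads (encodeInstance (3 * k₀) A) ro B
      (Params₂ (ℓ * (3 * k₀)) (3 * k₀) ℓ k₀ ks₀) readSim Set.univ
      (RAM.inputAt (encodeInstance ks₀ (simGraph ℓ ks₀ A))) := by
  intro s hs hQ _
  set x := encodeInstance (3 * k₀) A with hx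
  set p := s.1 (.inl adr₂) - (ℓ * ks₀ + ks₀ + 2) with hp
  have hpB : p ≤ B := (Nat.sub_le _ _).trans (hs _)
  set w₁ := Function.update s.1 (.inl u) (p / (ℓ * ks₀)) with hw₁
  set w₂ := Function.update w₁ (.inl v) (p % (ℓ * ks₀)) with hw₂
  have hQ₁ : Params₂ (ℓ * (3 * k₀)) (3 * k₀) ℓ k₀ ks₀ w₁ :=
    hQ.update _ (by simp) (by simp) (by simp) (by simp) (by simp)
  have hQ₂ : Params₂ (ℓ * (3 * k₀)) (3 * k₀) ℓ k₀ ks₀ w₂ :=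
    hQ₁.update _ (by simp) (by simp) (by simp) (by simp) (by simp)
  obtain ⟨X, Y, he₁, hX⟩ := eval_posProg (K := K) (S := S) A (ro := ro) (B := B) (c := cu) (b := u)
    (w₀ := w₂) (q := s.2) (by simp) (by simp) (by simp) (by simp) (by simp) (by simp) (by simp) (by simp)
    hℓ hℓB hcap hQ₂
  set w₃ := Function.update (Function.update w₂ (.inl cu) X) (.inl i) Y with hw₃
  have hQ₃ : Params₂ (ℓ * (3 * k₀)) (3 * k₀) ℓ k₀ ks₀ w₃ :=
    (hQ₂.update _ (by simp) (by simp) (by simp) (by simp) (by simp)).update _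
      (by simp) (by simp) (by simp) (by simp) (by simp)
  obtain ⟨X', Y', he₂, hX'⟩ := eval_posProg (K := K) (S := S) A (ro := ro) (B := B) (c := cv)
    (b := v) (w₀ := w₃) (q := s.2) (by simp) (by simp) (by simp) (by simp) (by simp) (by simp) (by simp)
    (by simp) hℓ hℓB hcap hQ₃
  set w₄ := Function.update (Function.update w₃ (.inl cv) X') (.inl i) Y' with hw₄
  have hQ₄ : Params₂ (ℓ * (3 * k₀)) (3 * k₀) ℓ k₀ ks₀ w₄ :=
    (hQ₃.update _ (by simp) (by simp) (by simp) (by simp) (by simp)).update _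
      (by simp) (by simp) (by simp) (by simp) (by simp)
  have hadr : w₄ (.inl adr₂) = s.1 (.inl adr₂) := by simp [hw₄, hw₃, hw₂, hw₁]
  have hu : w₄ (.inl u) = p / (ℓ * ks₀) := by simp [hw₄, hw₃, hw₂, hw₁]
  have hv : w₄ (.inl v) = p % (ℓ * ks₀) := by simp [hw₄, hw₃, hw₂]
  have hcu : w₄ (.inl cu) = X := by simp [hw₄, hw₃]
  have hcv : w₄ (.inl cv) = X' := by simp [hw₄]
  have hu₂ : w₂ (.inl u) = p / (ℓ * ks₀) := by simp [hw₂, hw₁]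
  have hv₃ : w₃ (.inl v) = p % (ℓ * ks₀) := by simp [hw₃, hw₂]
  set e : Expr (RedReg K S) := eqE (rd u) (rd v) (.const 0)
      (.ite (eqE (modE (rd u) (rd ell)) (rd cu) (.const 0) (.const 1)) (.const 0)
        (eqE (modE (rd v) (rd ell)) (rd cv) (.const 1)
          (cleanE (.add (.mul (.ite (rd u) (rd v) (rd u) (rd v)) sizeE)
            (.ite (rd u) (rd v) (rd v) (rd u)))))
        (cleanE (.add (.mul (.ite (rd u) (rd v) (rd u) (rd v)) sizeE)
          (.ite (rd u) (rd v) (rd v) (rd u))))) with he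
  have hval : (instE e).eval x B w₄ =
      RAM.inputAt (encodeInstance ks₀ (simGraph ℓ ks₀ A)) (s.1 (.inl adr₂)) := by
    rw [← hadr]
    refine eval_instE hQ₄ _ fun p' hp' hlt => ?_
    rw [hadr] at hp'
    have hpp : p' = p := hp'
    subst hpp
    have h1 : p / (ℓ * ks₀) < ℓ * ks₀ := Nat.div_lt_of_lt_mul hlt
    have h2 : p % (ℓ * ks₀) < ℓ * ks₀ := Nat.mod_lt _ ((Nat.zero_le _).trans_lt h1)
    have hX₁ := hX (by omega)
    have hX₂ := hX' (by omega)
    rw [hu₂] at hX₁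
    rw [hv₃] at hX₂
    set a := p / (ℓ * ks₀)
    set b := p % (ℓ * ks₀)
    have hmin : (if a ≤ b then a else b) = min a b := rfl
    have hmax : (if a ≤ b then b else a) = max a b := rfl
    have hclean := eval_cleanE (B := B) A hQ₄
      (.add (.mul (.ite (rd u) (rd v) (rd u) (rd v)) sizeE) (.ite (rd u) (rd v) (rd v) (rd u)))
      (T := min a b * (ℓ * ks₀) + max a b)
      (by simp only [Expr.eval, eval_sizeE, hQ₄.1.ell, hQ₄.2, hu, hv, hmin, hmax])
      (by
        have h3 : (min a b + 1) * (ℓ * ks₀) ≤ ℓ * ks₀ * (ℓ * ks₀) :=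
          Nat.mul_le_mul_right _ (by omega)
        have h4 : max a b < ℓ * ks₀ := by omega
        rw [add_mul] at h3
        omega)
    simp only [he, eval_eqE, Expr.eval, eval_modE, hu, hv, hcu, hcv, hQ₄.1.ell]
    have hclean' : (cleanE (.add (.mul (.ite (rd u) (rd v) (rd u) (rd v)) sizeE)
        (.ite (rd u) (rd v) (rd v) (rd u))) : Expr (RedReg K S)).eval x B w₄ = _ := hclean
    rw [hclean', hX₁, hX₂]
    have hadj := adjBit_fin (simGraph ℓ ks₀ A) ⟨a, h1⟩ ⟨b, h2⟩
    simp only [simGraph, ne_eq, Fin.mk.injEq] at hadj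
    by_cases hab : a = b
    · rw [if_pos hab, hab, adjBit_self]; rfl
    rw [if_neg hab]
    by_cases hca : a % ℓ = simPos ℓ ks₀ A (a / ℓ)
    · by_cases hcb : b % ℓ = simPos ℓ ks₀ A (b / ℓ)
      · rw [if_pos hca, if_pos le_rfl, if_pos hcb]
        have : adjBit (simGraph ℓ ks₀ A) a b = true := hadj.2 ⟨hab, .inl ⟨hca, hcb⟩⟩
        rw [this]; rfl
      · rw [if_pos hca, if_pos le_rfl, if_neg hcb]
        congr 1
        rw [Bool.eq_iff_iff]
        refine Iff.trans ?_ hadj.symm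
        simp [hab, hcb]
    · rw [if_neg hca, if_neg (by omega)]
      congr 1
      rw [Bool.eq_iff_iff]
      refine Iff.trans ?_ hadj.symm
      simp [hab, hca]
  have hle := (RAM.inputAt_le (encodeInstance ks₀ (simGraph ℓ ks₀ A))
    (s.1 (.inl adr₂))).trans hB
  have hev : (readSim : Prog (RedReg K S)).eval x ro B s = (Function.update w₄ (.inl res₂)
      (RAM.inputAt (encodeInstance ks₀ (simGraph ℓ ks₀ A)) (s.1 (.inl adr₂))), s.2) := by
    -- The cut-off at `B` does not affect the two vertex numbers, because they are at most the
    -- offset `p` and hence at most the address register.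
    have e1 : min (p / (ℓ * ks₀)) B = p / (ℓ * ks₀) := min_eq_left ((Nat.div_le_self _ _).trans hpB)
    have e2 : min (p % (ℓ * ks₀)) B = p % (ℓ * ks₀) := min_eq_left ((Nat.mod_le _ _).trans hpB)
    have e3 : (Prog.seq (asg u (.div matE sizeE)) (asg v (modE matE sizeE)) :
        Prog (RedReg K S)).eval x ro B s = (w₂, s.2) := by
      simp [Prog.eval, Expr.eval, hQ.1.ell, hQ.2, ← hp, e1, e2, hw₂, hw₁]
    have e4 : (readSim : Prog (RedReg K S)).eval x ro B s =
        (asg res₂ (instE e)).eval x ro B ((posProg cv v).eval x ro B ((posProg cu u).eval x ro B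
          ((Prog.seq (asg u (.div matE sizeE)) (asg v (modE matE sizeE)) :
            Prog (RedReg K S)).eval x ro B s))) := rfl
    rw [e4, e3, he₁, he₂]
    simp only [Prog.eval, hval, min_eq_left hle]
  rw [hev]
  refine ⟨Params₂.update_used _ _ _ (.inr (.inr (.inr (.inl rfl)))) hQ₄, ?_, ?_, rfl, ?_⟩
  · simp [regs₂]
  · simp [regs₂, hw₄, hw₃, hw₂, hw₁]
  · simp [regs₂, hw₄, hw₃, hw₂, hw₁]

end Reduction

/-! ## Existence of the reductions -/

/-- A machine that does not flip coins and keeps its registers below `V` halts fast. -/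
theorem RAM.HaltsWith.exists_lt {M : RAM} (hM : M.NoFlip) {x : List Bool} {ro ma : ℕ → Bool}
    {t y V : ℕ} (h : M.HaltsWith x ro ma t y) (hV : ∀ t r, (M.run x ro ma t).regs r ≤ V) :
    ∃ t' < Nat.card M.State * (V + 1) ^ Fintype.card M.Reg, M.HaltsWith x ro ma t' y := by
  classical
  have hex : ∃ t, M.HaltsWith x ro ma t y := ⟨t, h⟩
  set t₀ := Nat.find hex
  have ht₀ : M.HaltsWith x ro ma t₀ y := Nat.find_spec hex
  refine ⟨t₀, ?_, ht₀⟩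
  let f : Fin (t₀ + 1) → M.State × (M.Reg → Fin (V + 1)) := fun j =>
    ((M.run x ro ma j).state, fun r => ⟨(M.run x ro ma j).regs r, Nat.lt_succ_of_le (hV _ r)⟩)
  -- A configuration repeated before the first halting time `t₀` could be cut out of the run, which
  -- would give an earlier halting time.
  have hlt : ∀ a b : ℕ, a < b → b ≤ t₀ → M.run x ro ma a = M.run x ro ma b → False := by
    intro a b hab hb heq
    have h1 : M.run x ro ma (t₀ - b + a) = M.run x ro ma t₀ := by
      have : M.run x ro ma (t₀ - b + b) = M.run x ro ma (t₀ - b + a) := by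
        simp only [RAM.run, Function.iterate_add_apply] at heq ⊢
        rw [heq]
      rw [← this, Nat.sub_add_cancel hb]
    refine Nat.find_min hex (m := t₀ - b + a) (by omega) ?_
    obtain ⟨c, hc, hy⟩ := ht₀
    exact ⟨c, by rw [h1, hc], by rw [h1, hy]⟩
  have hf : Function.Injective f := by
    have hrun : ∀ a b : Fin (t₀ + 1), f a = f b → M.run x ro ma a = M.run x ro ma b := by
      intro a b hab
      simp only [f, Prod.mk.injEq] at hab
      refine RAM.Cfg.ext hab.1 (funext fun r => ?_) ?_
      · simpa using congrFun hab.2 r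
      · rw [Reduction.run_coin_of_noFlip hM, Reduction.run_coin_of_noFlip hM]
    intro a b hab
    rcases lt_trichotomy (a : ℕ) b with h | h | h
    · exact (hlt a b h (by omega) (hrun a b hab)).elim
    · exact Fin.ext h
    · exact (hlt b a h (by omega) (hrun a b hab).symm).elim
  have := Nat.card_le_card_of_injective f hf
  rw [Nat.card_fin, Nat.card_prod, Nat.card_fun, Nat.card_fin,
    Nat.card_eq_fintype_card (α := M.Reg)] at this
  omega

/-- The converse translation, from logarithmic space to polynomially bounded registers, uses `2 ^
(log m + 1) ≤ 2 * m`. -/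
theorem RAM.regs_lt_of_space {M : RAM} {c : M.Cfg} {C m : ℕ} (hm : 0 < m)
    (h : c.space ≤ C * (Nat.log 2 m + 1)) (r : M.Reg) : c.regs r < (2 * m) ^ C := by
  have h1 : (c.regs r).size ≤ C * (Nat.log 2 m + 1) :=
    (Finset.single_le_sum (f := fun r => (c.regs r).size) (fun _ _ => Nat.zero_le _)
      (Finset.mem_univ r)).trans h
  refine (Nat.lt_size_self _).trans_le ((Nat.pow_le_pow_right (by omega) h1).trans ?_)
  rw [mul_comm C, pow_mul]
  refine Nat.pow_le_pow_left ?_ C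
  rw [pow_succ, mul_comm]
  exact Nat.mul_le_mul_left 2 (Nat.pow_log_le_self 2 hm.ne')

namespace Reduction

/-- The reduction that simulates `S` on the instance read by the program `p`. -/
theorem exists_reduction {ℓ k ks : ℕ → ℕ} {K S : RAM} (hℓ : ∀ i, 0 < ℓ i) (hk : ∀ i, 0 < k i)
    (hks : ∀ i, ks i ≤ k i) (hK : K.NoMulti) (hK' : K.NoFlip) {C₁ : ℕ}
    (hKs : ∀ (i : ℕ) (ro ma : ℕ → Bool),
      (∃ t, K.HaltsWith (encodePair (ℓ i * k i) (k i)) ro ma t (ks i)) ∧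
      ∀ t, (K.run (encodePair (ℓ i * k i) (k i)) ro ma t).space ≤ C₁ * (Nat.log 2 (ℓ i) + 1))
    (hS : S.IsMultiAccessRandomizedLogspace)
    (hSu : ∀ (i : ℕ) (G : SimpleGraph (Fin (ℓ i * ks i))),
        S.UsesMultiAtMost (encodeInstance (ks i) G) ((ℓ i * k i).choose 2))
    (good : ℕ → Prop) (p : Prog (RedReg K S))
    (H : ∀ i, SimpleGraph (Fin (ℓ i * (3 * k i))) → SimpleGraph (Fin (ℓ i * ks i)))
    (hp : ∀ i, good i → ∀ A ro B, 2 ≤ B → ℓ i ≤ B →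
      (regs₂ K S).Reads (encodeInstance (3 * k i) A) ro B
        (Params₂ (ℓ i * (3 * k i)) (3 * k i) (ℓ i) (k i) (ks i)) p Set.univ
        (RAM.inputAt (encodeInstance (ks i) (H i A)))) :
    ∃ M : RAM, M.IsRandomizedLogspace ∧ ∀ i, good i → ∀ A ro ma b,
      M.Answers (encodeInstance (3 * k i) A) ro ma b ↔
        S.Answers (encodeInstance (ks i) (H i A)) ro (simMulti (ℓ i * k i) A) b := by
  obtain ⟨C₂, hS⟩ := hS
  set e₁ := Nat.card K.State + (2 * C₁ + 1) * Fintype.card K.Reg with he₁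
  -- The exponent collects everything that the bound must dominate: `e₁` for the running time and
  -- the states of `K`, then the states of `S`, the registers of `K`, and the registers and running
  -- time of `S`, the last needing an exponent above `2 * C₂ + 1`.
  set C := e₁ + Nat.card S.State + 2 * C₁ + 3 * C₂ + 2 with hC
  obtain ⟨M, hM, hMa⟩ := (redProg p).exists_RAM (.inl MainReg.out) (C := C) (by omega)
  refine ⟨M, hM, fun i hi A ro ma b => ?_⟩
  set x := encodeInstance (3 * k i) A with hx
  set x' := encodeInstance (ks i) (H i A) with hx'
  set n := x.length + 2 with hn
  have hxl : x.length = ℓ i * (3 * k i) + 3 * k i + 2 + ℓ i * (3 * k i) * (ℓ i * (3 * k i)) :=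
    encodeInstance_length _ _
  have hxl' : x'.length = ℓ i * ks i + ks i + 2 + ℓ i * ks i * (ℓ i * ks i) :=
    encodeInstance_length _ _
  have hpow : ∀ {j}, j ≤ C → n ^ j ≤ n ^ C := fun hj => Nat.pow_le_pow_right (by omega) hj
  have hself : ∀ m, m < n ^ m := fun m => Nat.lt_pow_self (by omega)
  have hBdef : progBound C x = n ^ C := rfl
  have hℓks : ℓ i * ks i ≤ ℓ i * (3 * k i) := Nat.mul_le_mul_left _ ((hks i).trans (by omega))
  have hlen : x'.length ≤ x.length := by
    rw [hxl, hxl']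
    have h2 := Nat.mul_le_mul hℓks hℓks
    have h3 := hks i
    omega
  have hℓn : ℓ i ≤ n := by
    have h1 : ℓ i ≤ ℓ i * (3 * k i) := Nat.le_mul_of_pos_right _ (by have := hk i; omega)
    omega
  have hn1 : n ≤ n ^ C := by simpa using hpow (j := 1) (by omega)
  have h2n : 2 * n ≤ n ^ 2 := by rw [pow_two]; exact Nat.mul_le_mul_right _ (by omega)
  have hKreg : ∀ t r, (K.run (encodePair (ℓ i * k i) (k i)) ro ma t).regs r ≤ n ^ (2 * C₁) := by
    intro t r
    refine (RAM.regs_lt_of_space (hℓ i) ((hKs i ro ma).2 t) r).le.trans ?_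
    rw [pow_mul]
    exact Nat.pow_le_pow_left ((Nat.mul_le_mul_left 2 hℓn).trans h2n) _
  obtain ⟨⟨t, ht⟩, -⟩ := hKs i ro ma
  -- Only the space of `K` is bounded by assumption; a polynomial time bound follows by counting
  -- configurations.
  obtain ⟨t₁, ht₁, hhalt₁⟩ := ht.exists_lt hK' hKreg
  have ht₁' : t₁ < n ^ C := by
    refine ht₁.trans_le (le_trans ?_ (hpow (j := e₁) (by omega)))
    rw [he₁, pow_add, pow_mul n (2 * C₁ + 1)]
    refine Nat.mul_le_mul (hself _).le (Nat.pow_le_pow_left ?_ _)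
    have := Nat.pow_add_pow_le_pow (show 2 ≤ n by omega) (2 * C₁) 0
    simpa using this
  obtain ⟨⟨t₂, ht₂, y, hy⟩, hsp⟩ := hS x' ro (simMulti (ℓ i * k i) A)
  have hx'n : x'.length ≤ n := by omega
  have ht₂' : t₂ < n ^ C := by
    refine (ht₂.trans ?_).trans_lt (Nat.pow_lt_pow_right (by omega) (show C₂ + (C₂ + 1) < C by omega))
    rw [pow_add]
    refine Nat.mul_le_mul (hself C₂).le ?_
    refine (Nat.add_le_add_right (Nat.pow_le_pow_left hx'n C₂) 1).trans ?_
    have := Nat.pow_add_pow_le_pow (show 2 ≤ n by omega) C₂ 0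
    simpa using this
  have hSreg : ∀ t r, (S.run x' ro (simMulti (ℓ i * k i) A) t).regs r ≤ n ^ C := by
    intro t r
    refine (RAM.regs_lt_of_space (by omega) (hsp t) r).le.trans ?_
    refine le_trans ?_ (hpow (j := 2 * C₂) (by omega))
    rw [pow_mul]
    exact Nat.pow_le_pow_left ((Nat.mul_le_mul_left 2 hx'n).trans h2n) _
  have hu : S.UsesMultiAtMost x' (ℓ i * k i * (ℓ i * k i)) := by
    intro ro' ma' t d a q h
    refine (hSu i (H i A) ro' ma' t d a q h).trans_le ?_
    rw [Nat.choose_two_right]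
    exact (Nat.div_le_self _ _).trans (Nat.mul_le_mul_left _ (Nat.sub_le _ _))
  have hfin := eval_redProg (hk i) A (H i A) (B := n ^ C) (p := p)
    ((Nat.le_add_right _ 2).trans hn1) hK hK'
    ((hself _).le.trans (hpow (by omega))) ((hself _).le.trans (hpow (by omega))) ht₁' hhalt₁
    (fun t r => (hKreg t r).trans (hpow (by omega))) (hp i hi A ro _ (by omega) (by omega)) hu ht₂'
    hy hSreg
  rw [hMa, RAM.answers_iff hy, hBdef, hfin]

end Reduction

/-! ## Dependence of runs on the random strings -/

namespace RAM

theorem run_succ (M : RAM) (x : List Bool) (ro ma : ℕ → Bool) (t : ℕ) :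
    M.run x ro ma (t + 1) = M.step x ro ma (M.run x ro ma t) := Function.iterate_succ_apply' _ _ _

theorem coin_le (M : RAM) (x : List Bool) (ro ma : ℕ → Bool) (t : ℕ) :
    (M.run x ro ma t).coin ≤ t := by
  induction t with
  | zero => exact le_rfl
  | succ t ih =>
    rw [run_succ]
    unfold step
    cases M.code (M.run x ro ma t).state <;> simp only <;> omega

/-- At most one read-once bit is consumed per step, so `T` steps see only the first `T` bits. The
multiple access strings have to agree only at the addresses actually queried. -/
theorem run_congr {M : RAM} {x : List Bool} {ro ro' ma ma' : ℕ → Bool} {T : ℕ}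
    (hro : ∀ j < T, ro j = ro' j)
    (hma : ∀ t d a q, M.code (M.run x ro ma t).state = .readMulti d a q →
      ma ((M.run x ro ma t).regs a) = ma' ((M.run x ro ma t).regs a)) :
    ∀ t ≤ T, M.run x ro' ma' t = M.run x ro ma t := by
  intro t
  induction t with
  | zero => exact fun _ => rfl
  | succ t ih =>
    intro ht
    rw [run_succ, run_succ, ih (by omega)]
    have h1 := M.coin_le x ro ma t
    have h2 := hma t
    generalize M.run x ro ma t = c at h1 h2
    unfold step
    cases hc : M.code c.state with
    | readMulti d a q => simp only [h2 d a q hc]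
    | flip d q => simp only [hro c.coin (by omega)]
    | _ => rfl

theorem answers_congr_multi {M : RAM} {x : List Bool} {ro ma ma' : ℕ → Bool} {R : ℕ}
    (hu : M.UsesMultiAtMost x R) (hma : ∀ a < R, ma a = ma' a) (b : Bool) :
    M.Answers x ro ma b ↔ M.Answers x ro ma' b := by
  have h : ∀ t, M.run x ro ma' t = M.run x ro ma t := fun t =>
    run_congr (T := t) (fun _ _ => rfl) (fun t d a q h => hma _ (hu ro ma t d a q h)) t le_rfl
  unfold Answers HaltsWith
  simp only [h]

/-- By the time bound the answer depends on finitely many read-once bits, so the event is the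
preimage of a subset of a finite space. -/
theorem measurableSet_answers {M : RAM} (hM : M.IsMultiAccessRandomizedLogspace) (x : List Bool)
    (ma : ℕ → Bool) (b : Bool) : MeasurableSet {ro | M.Answers x ro ma b} := by
  obtain ⟨C, hC⟩ := hM
  set T := C * (x.length ^ C + 1)
  let f : (ℕ → Bool) → Fin T → Bool := fun ro j => ro j
  have hf : Measurable f := measurable_pi_lambda _ fun j => measurable_pi_apply _
  have key : ∀ ro ro', f ro = f ro' → M.Answers x ro ma b → M.Answers x ro' ma b := by
    intro ro ro' hff h
    obtain ⟨⟨t, ht, y, hy⟩, -⟩ := hC x ro ma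
    rw [answers_iff hy] at h
    refine ⟨t, y, ?_, h⟩
    unfold HaltsWith at hy ⊢
    rwa [run_congr (ro := ro) (ro' := ro') (T := T) (fun j hj => congrFun hff ⟨j, hj⟩)
      (fun _ _ _ _ _ => rfl) t ht]
  have : {ro | M.Answers x ro ma b} = f ⁻¹' (f '' {ro | M.Answers x ro ma b}) := by
    refine (Set.subset_preimage_image _ _).antisymm ?_
    rintro ro ⟨ro', h, hff⟩
    exact key ro' ro hff h
  rw [this]
  exact hf (Set.toFinite _).measurableSet

theorem answers_false_iff {M : RAM} (hM : M.IsMultiAccessRandomizedLogspace) (x : List Bool)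
    (ro ma : ℕ → Bool) : M.Answers x ro ma false ↔ ¬ M.Answers x ro ma true := by
  obtain ⟨C, hC⟩ := hM
  obtain ⟨⟨t, ht, y, hy⟩, -⟩ := hC x ro ma
  rw [answers_iff hy, answers_iff hy]
  simp

end RAM

/-! ## Random bits -/

instance : IsProbabilityMeasure fairBits := by
  unfold fairBits
  infer_instance

theorem fairBits_cylinder {m : ℕ} (r : Fin m → Bool) :
    fairBits.real ((fun ma (j : Fin m) => ma j) ⁻¹' {r}) = (1 / 2) ^ m := by
  have h1 : (fun (ma : ℕ → Bool) (j : Fin m) => ma j) ⁻¹' {r} =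
      Set.pi (Finset.range m) fun j => if h : j < m then {r ⟨j, h⟩} else Set.univ := by
    ext ma
    simp only [Set.mem_preimage, Set.mem_singleton_iff, Set.mem_pi, Finset.coe_range, Set.mem_Iio]
    constructor
    · rintro rfl j hj
      simp [hj]
    · intro h
      funext j
      simpa using h j j.2
  rw [h1, Measure.real, fairBits, Measure.infinitePi_pi _ (fun _ _ => (Set.toFinite _).measurableSet),
    Finset.prod_congr rfl (g := fun _ => (2⁻¹ : ENNReal))]
  · simp
  · intro j hj
    rw [dif_pos (Finset.mem_range.1 hj), uniformOn_univ]
    simp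

/-- The set `s` need not be measurable, since only the fibres of `f` are used to split. Answer
events on product spaces can thus be decomposed without a measurability proof. -/
theorem measureReal_eq_sum_fibers {α κ : Type*} [MeasurableSpace α] [Fintype κ]
    [MeasurableSpace κ] [MeasurableSingletonClass κ] (ν : Measure α) [IsFiniteMeasure ν] {f : α → κ}
    (hf : Measurable f) (s : Set α) : ν.real s = ∑ y, ν.real (s ∩ f ⁻¹' {y}) := by
  have h1 := sum_measureReal_preimage_singleton (μ := ν.restrict s) Finset.univ (f := f)
    fun y _ => hf (measurableSet_singleton y)
  simp only [Finset.coe_univ, Set.preimage_univ] at h1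
  rw [measureReal_restrict_apply MeasurableSet.univ, Set.univ_inter] at h1
  rw [← h1]
  refine Finset.sum_congr rfl fun y _ => ?_
  rw [measureReal_restrict_apply (hf (measurableSet_singleton y)), Set.inter_comm]

/-- Extend a finite bit string by zeros. -/
def extendBits {m : ℕ} (r : Fin m → Bool) (a : ℕ) : Bool := if h : a < m then r ⟨a, h⟩ else false

/-- The probability over the read-once bits that `M` answers `b`, given the first `m` multiple
access random bits. -/
noncomputable def coinProb (M : RAM) (x : List Bool) {m : ℕ} (r : Fin m → Bool) (b : Bool) : ℝ :=
  fairBits.real {ro | M.Answers x ro (extendBits r) b}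

theorem coinProb_nonneg (M : RAM) (x : List Bool) {m : ℕ} (r : Fin m → Bool) (b : Bool) :
    0 ≤ coinProb M x r b := measureReal_nonneg

theorem coinProb_false {M : RAM} (hM : M.IsMultiAccessRandomizedLogspace) (x : List Bool) {m : ℕ}
    (r : Fin m → Bool) : coinProb M x r false = 1 - coinProb M x r true := by
  unfold coinProb
  rw [← probReal_compl_eq_one_sub (RAM.measurableSet_answers hM x _ true)]
  exact congrArg fairBits.real (Set.ext fun ro => RAM.answers_false_iff hM x ro _)

/-- Once the first `m` multiple access bits are fixed, the answer depends on the read-once string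
alone. Each fibre is therefore a product set. -/
theorem prob_answers_eq_expect {M : RAM} {x : List Bool} {m : ℕ} (hu : M.UsesMultiAtMost x m)
    (b : Bool) : (fairBits.prod fairBits).real {ω | M.Answers x ω.1 ω.2 b} =
      𝔼 r : Fin m → Bool, coinProb M x r b := by
  let f : (ℕ → Bool) × (ℕ → Bool) → Fin m → Bool := fun ω j => ω.2 j
  have hf : Measurable f :=
    measurable_pi_lambda _ fun j => (measurable_pi_apply _).comp measurable_snd
  rw [measureReal_eq_sum_fibers _ hf, Fintype.expect_eq_sum_div_card, Finset.sum_div]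
  refine Finset.sum_congr rfl fun r _ => ?_
  have h1 : {ω : (ℕ → Bool) × (ℕ → Bool) | M.Answers x ω.1 ω.2 b} ∩ f ⁻¹' {r} =
      {ro | M.Answers x ro (extendBits r) b} ×ˢ ((fun ma (j : Fin m) => ma j) ⁻¹' {r}) := by
    ext ⟨ro, ma⟩
    simp only [Set.mem_inter_iff, Set.mem_preimage, Set.mem_singleton_iff, Set.mem_prod]
    refine and_congr_left fun h => ?_
    refine RAM.answers_congr_multi hu (fun a ha => ?_) b
    rw [extendBits, dif_pos ha, ← h]
  rw [h1, measureReal_prod_prod, fairBits_cylinder]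
  simp [coinProb, div_eq_mul_inv]

theorem prob_fst_fairBits (P : (ℕ → Bool) → Prop) :
    (fairBits.prod fairBits).real {ω | P ω.1} = fairBits.real {ro | P ro} := by
  have : {ω : (ℕ → Bool) × (ℕ → Bool) | P ω.1} = {ro | P ro} ×ˢ Set.univ := by
    ext; simp
  rw [this, measureReal_prod_prod]
  simp

/-! ## Random graphs -/

instance {V : Type*} [Countable V] [Finite V] : MeasurableSingletonClass (SimpleGraph V) := by
  refine ⟨fun G => ?_⟩
  have : ({G} : Set (SimpleGraph V)) = SimpleGraph.edgeSet ⁻¹' {G.edgeSet} := by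
    ext H
    simp
  rw [this]
  exact SimpleGraph.measurable_edgeSet (measurableSet_singleton _)

theorem answerProb_eq_integral (M : RAM) {n : ℕ} (k : ℕ) (μ : Measure (SimpleGraph (Fin n)))
    [IsProbabilityMeasure μ] (b : Bool) : answerProb M k μ b =
      ∫ G, (fairBits.prod fairBits).real {ω | M.Answers (encodeInstance k G) ω.1 ω.2 b} ∂μ := by
  have := Fintype.ofFinite (SimpleGraph (Fin n))
  rw [integral_fintype (.of_finite), answerProb, measureReal_eq_sum_fibers _ measurable_fst]
  refine Finset.sum_congr rfl fun G _ => ?_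
  have h1 : {ω : SimpleGraph (Fin n) × (ℕ → Bool) × (ℕ → Bool) |
      M.Answers (encodeInstance k ω.1) ω.2.1 ω.2.2 b} ∩ Prod.fst ⁻¹' {G} =
      {G} ×ˢ {ω | M.Answers (encodeInstance k G) ω.1 ω.2 b} := by
    ext ⟨G', ω⟩
    simp only [Set.mem_inter_iff, Set.mem_preimage, Set.mem_singleton_iff, Set.mem_prod]
    constructor
    · rintro ⟨h, rfl⟩; exact ⟨rfl, h⟩
    · rintro ⟨rfl, h⟩; exact ⟨h, rfl⟩
  rw [h1, measureReal_prod_prod, smul_eq_mul]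

/-- The pairs of vertices. -/
abbrev Pairs (n : ℕ) : Type := {p : Fin n × Fin n // p.1 < p.2}

/-- The graph with the given adjacencies. -/
def ofBits {n : ℕ} (e : Pairs n → Bool) : SimpleGraph (Fin n) where
  Adj u v := (∃ h : u < v, e ⟨(u, v), h⟩ = true) ∨ ∃ h : v < u, e ⟨(v, u), h⟩ = true
  symm := ⟨fun _ _ h => h.symm⟩
  loopless := ⟨fun u h => by simp at h⟩

theorem ofBits_adj {n : ℕ} (e : Pairs n → Bool) (p : Pairs n) :
    (ofBits e).Adj p.1.1 p.1.2 ↔ e p = true := by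
  have h1 : p.1.1 < p.1.2 := p.2
  constructor
  · rintro (⟨h, h'⟩ | ⟨h, h'⟩)
    · exact h'
    · exact absurd h1 h.not_gt
  · intro h
    exact .inl ⟨h1, h⟩

theorem ofBits_bijective (n : ℕ) : Function.Bijective (ofBits : (Pairs n → Bool) → _) := by
  classical
  constructor
  · intro e e' h
    funext p
    rw [Bool.eq_iff_iff, ← ofBits_adj, ← ofBits_adj, h]
  · intro G
    refine ⟨fun p => decide (G.Adj p.1.1 p.1.2), ?_⟩
    ext u v
    rcases lt_trichotomy u v with h | rfl | h
    · simp [ofBits, h, h.not_gt]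
    · simp
    · simp [ofBits, h, h.not_gt, G.adj_comm]

/-- At edge probability `1 / 2` every graph has the same weight, so the law is uniform. The number
of graphs is never computed: it is the inverse of the weight because the total mass is `1`. -/
theorem integral_erdosRenyi {n : ℕ} (f : SimpleGraph (Fin n) → ℝ) :
    ∫ G, f G ∂erdosRenyi n = 𝔼 e : Pairs n → Bool, f (ofBits e) := by
  classical
  have := Fintype.ofFinite (SimpleGraph (Fin n))
  have : IsProbabilityMeasure (erdosRenyi n) := by unfold erdosRenyi; infer_instance
  have hs : ∀ G : SimpleGraph (Fin n), (erdosRenyi n).real {G} = (1 / 2 : ℝ) ^ n.choose 2 := by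
    intro G
    have hle : G.edgeSet.ncard ≤ n.choose 2 := by
      rw [← SimpleGraph.coe_edgeFinset, Set.ncard_coe_finset]
      simpa using G.card_edgeFinset_le_card_choose_two
    rw [erdosRenyi, Measure.real, SimpleGraph.binomialRandom_singleton, Nat.card_fin,
      ENNReal.toReal_mul, ENNReal.toReal_pow, ENNReal.toReal_pow]
    simp only [ENNReal.coe_toReal, unitInterval.coe_toNNReal, unitInterval.coe_symm_eq]
    rw [show (1 - 1 / 2 : ℝ) = 1 / 2 by norm_num, ← pow_add, Nat.add_sub_cancel' hle]
  have h1 : ∑ G : SimpleGraph (Fin n), (erdosRenyi n).real {G} = 1 := by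
    rw [sum_measureReal_singleton]
    simp
  simp only [hs, Finset.sum_const, Finset.card_univ, nsmul_eq_mul] at h1
  have hcard : Fintype.card (Pairs n → Bool) = Fintype.card (SimpleGraph (Fin n)) :=
    Fintype.card_of_bijective (ofBits_bijective n)
  rw [integral_fintype .of_finite, Fintype.expect_eq_sum_div_card, hcard,
    (ofBits_bijective n).sum_comp (fun G => f G), Finset.sum_div]
  refine Finset.sum_congr rfl fun G _ => ?_
  rw [hs, smul_eq_mul, eq_one_div_of_mul_eq_one_right h1]
  ring

/-! ### Transversal vertex sets and the planted distribution as a uniform average -/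

/-- The set of vertices with the given positions in the blocks. -/
def cliqueSet {ℓ k : ℕ} (c : Fin k → Fin ℓ) : Finset (Fin (ℓ * k)) :=
  Finset.univ.filter fun v => (v : ℕ) % ℓ = c ⟨v / ℓ, Nat.div_lt_of_lt_mul v.2⟩

theorem mem_cliqueSet {ℓ k : ℕ} (c : Fin k → Fin ℓ) (v : Fin (ℓ * k)) : v ∈ cliqueSet c ↔
    (v : ℕ) % ℓ = c ⟨v / ℓ, Nat.div_lt_of_lt_mul v.2⟩ := by
  simp [cliqueSet]

/-- The vertex with a given position in a block. -/
def blockVertex {ℓ k : ℕ} (j : Fin k) (p : Fin ℓ) : Fin (ℓ * k) :=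
  ⟨j * ℓ + p, by
    calc (j : ℕ) * ℓ + p < j * ℓ + ℓ := Nat.add_lt_add_left p.2 _
      _ = (j + 1) * ℓ := by ring
      _ ≤ k * ℓ := Nat.mul_le_mul_right _ j.2
      _ = ℓ * k := mul_comm _ _⟩

theorem blockVertex_div {ℓ k : ℕ} (j : Fin k) (p : Fin ℓ) : (blockVertex j p : ℕ) / ℓ = j := by
  have : 0 < ℓ := (Nat.zero_le _).trans_lt p.2
  simp only [blockVertex]
  rw [mul_comm, Nat.mul_add_div this, Nat.div_eq_of_lt p.2, add_zero]

theorem blockVertex_mod {ℓ k : ℕ} (j : Fin k) (p : Fin ℓ) : (blockVertex j p : ℕ) % ℓ = p := by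
  simp only [blockVertex]
  rw [mul_comm, Nat.mul_add_mod, Nat.mod_eq_of_lt p.2]

theorem blockVertex_mem_cliqueSet {ℓ k : ℕ} (c : Fin k → Fin ℓ) (j : Fin k) (p : Fin ℓ) :
    blockVertex j p ∈ cliqueSet c ↔ p = c j := by
  rw [mem_cliqueSet, blockVertex_mod, Fin.ext_iff]
  simp only [blockVertex_div]

theorem cliqueSet_eq_image {ℓ k : ℕ} (c : Fin k → Fin ℓ) :
    cliqueSet c = Finset.univ.image fun j => blockVertex j (c j) := by
  ext v
  rw [mem_cliqueSet, Finset.mem_image]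
  constructor
  · intro h
    refine ⟨⟨v / ℓ, Nat.div_lt_of_lt_mul v.2⟩, Finset.mem_univ _, Fin.ext ?_⟩
    simp only [blockVertex, ← h]
    rw [mul_comm]
    exact Nat.div_add_mod _ _
  · rintro ⟨j, -, rfl⟩
    rw [← mem_cliqueSet, blockVertex_mem_cliqueSet]

theorem cliqueSet_injective {ℓ k : ℕ} :
    Function.Injective (cliqueSet : (Fin k → Fin ℓ) → Finset (Fin (ℓ * k))) := by
  intro c c' h
  funext j
  rw [← blockVertex_mem_cliqueSet c' j, ← h, blockVertex_mem_cliqueSet]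

theorem card_cliqueSet {ℓ k : ℕ} (c : Fin k → Fin ℓ) : (cliqueSet c).card = k := by
  rw [cliqueSet_eq_image, Finset.card_image_of_injective, Finset.card_univ, Fintype.card_fin]
  intro i j h
  have := congrArg (fun v : Fin (ℓ * k) => (v : ℕ) / ℓ) h
  simpa [blockVertex_div, Fin.ext_iff] using this

theorem block_iff_div {ℓ v j : ℕ} (hℓ : 0 < ℓ) : j * ℓ ≤ v ∧ v < (j + 1) * ℓ ↔ v / ℓ = j := by
  rw [Nat.div_eq_iff hℓ]
  have : (j + 1) * ℓ = j * ℓ + ℓ := by ring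
  omega

theorem onePerBlock_iff {ℓ k : ℕ} (hℓ : 0 < ℓ) (K : Finset (Fin (ℓ * k))) :
    OnePerBlock ℓ k K ↔ ∃ c : Fin k → Fin ℓ, cliqueSet c = K := by
  simp only [OnePerBlock, block_iff_div hℓ]
  constructor
  · intro h
    have h' : ∀ j : Fin k, ∃ v : Fin (ℓ * k),
        K.filter (fun v : Fin (ℓ * k) => (v : ℕ) / ℓ = j) = {v} :=
      fun j => Finset.card_eq_one.1 (h j j.2)
    choose v hv using h'
    have hv' : ∀ (j : Fin k) w, w ∈ K ∧ (w : ℕ) / ℓ = j ↔ w = v j := by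
      intro j w
      have := Finset.ext_iff.1 (hv j) w
      rwa [Finset.mem_filter, Finset.mem_singleton] at this
    refine ⟨fun j => ⟨v j % ℓ, Nat.mod_lt _ hℓ⟩, ?_⟩
    ext w
    rw [mem_cliqueSet]
    set j : Fin k := ⟨w / ℓ, Nat.div_lt_of_lt_mul w.2⟩ with hj
    obtain ⟨hK, hd⟩ := (hv' j (v j)).2 rfl
    constructor
    · intro hw
      have : w = v j := by
        apply Fin.ext
        rw [← Nat.div_add_mod (w : ℕ) ℓ, ← Nat.div_add_mod (v j : ℕ) ℓ, hd, hw]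
      rwa [this]
    · intro hw
      rw [← (hv' j w).1 ⟨hw, rfl⟩]
  · rintro ⟨c, rfl⟩ j hj
    rw [Finset.card_eq_one]
    refine ⟨blockVertex ⟨j, hj⟩ (c ⟨j, hj⟩), ?_⟩
    ext w
    rw [Finset.mem_filter, Finset.mem_singleton, cliqueSet_eq_image, Finset.mem_image]
    constructor
    · rintro ⟨⟨i, -, rfl⟩, h⟩
      rw [blockVertex_div] at h
      subst h
      rfl
    · rintro rfl
      exact ⟨⟨_, Finset.mem_univ _, rfl⟩, blockVertex_div _ _⟩

instance (n : ℕ) : IsProbabilityMeasure (erdosRenyi n) := by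
  unfold erdosRenyi
  infer_instance

/-- The condition concerns only the first factor. A set with one vertex per block automatically has
`k` elements, so conditioning the uniform law on `k`-sets gives the uniform law on such sets. -/
theorem cond_plantedPair {ℓ k : ℕ} (hℓ : 0 < ℓ) :
    cond (plantedPair (ℓ * k) k) {p | OnePerBlock ℓ k p.1} =
      (uniformOn {K | OnePerBlock ℓ k K}).prod (erdosRenyi (ℓ * k)) := by
  have h1 : {p : Finset (Fin (ℓ * k)) × SimpleGraph (Fin (ℓ * k)) | OnePerBlock ℓ k p.1} =
      {K | OnePerBlock ℓ k K} ×ˢ Set.univ := by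
    ext; simp
  have hsub : {K | OnePerBlock ℓ k K} ⊆ {K : Finset (Fin (ℓ * k)) | K.card = k} := by
    intro K hK
    obtain ⟨c, rfl⟩ := (onePerBlock_iff hℓ K).1 hK
    exact card_cliqueSet c
  have h2 : cond (uniformOn {K : Finset (Fin (ℓ * k)) | K.card = k}) {K | OnePerBlock ℓ k K} =
      uniformOn {K | OnePerBlock ℓ k K} := by
    rw [uniformOn, cond_cond_eq_cond_inter (Set.toFinite _).measurableSet
      (Set.toFinite _).measurableSet, Set.inter_eq_self_of_subset_right hsub]
    rfl
  rw [← h2, h1, ProbabilityTheory.cond, ProbabilityTheory.cond, plantedPair, Measure.prod_prod, measure_univ,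
    mul_one,
    Measure.prod_smul_left, ← Measure.prod_restrict, Measure.restrict_univ]

theorem integral_uniformOn_onePerBlock {ℓ k : ℕ} (hℓ : 0 < ℓ) (g : Finset (Fin (ℓ * k)) → ℝ) :
    ∫ K, g K ∂uniformOn {K : Finset (Fin (ℓ * k)) | OnePerBlock ℓ k K} =
      𝔼 c : Fin k → Fin ℓ, g (cliqueSet c) := by
  classical
  have : NeZero ℓ := ⟨hℓ.ne'⟩
  have h1 : {K : Finset (Fin (ℓ * k)) | OnePerBlock ℓ k K} =
      ((Finset.univ.image cliqueSet : Finset (Finset (Fin (ℓ * k)))) : Set (Finset _)) := by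
    ext K
    simp [onePerBlock_iff hℓ]
  have hcard : (Finset.univ.image (cliqueSet : (Fin k → Fin ℓ) → _)).card =
      Fintype.card (Fin k → Fin ℓ) := by
    rw [Finset.card_image_of_injective _ cliqueSet_injective, Finset.card_univ]
  have h2 : ∀ K : Finset (Fin (ℓ * k)),
      (uniformOn {K : Finset (Fin (ℓ * k)) | OnePerBlock ℓ k K}).real {K} =
      if K ∈ Finset.univ.image (cliqueSet : (Fin k → Fin ℓ) → _) then
        (Fintype.card (Fin k → Fin ℓ) : ℝ)⁻¹ else 0 := by
    intro K
    rw [h1, Measure.real, ← Finset.coe_singleton, uniformOn_apply_finset, hcard]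
    split_ifs with hK
    · rw [Finset.inter_singleton_of_mem hK]
      simp
    · rw [Finset.inter_singleton_of_notMem hK]
      simp
  have : IsProbabilityMeasure (uniformOn {K : Finset (Fin (ℓ * k)) | OnePerBlock ℓ k K}) := by
    refine isProbabilityMeasure_uniformOn (Set.toFinite _) ?_
    rw [h1]
    simpa using Set.range_nonempty _
  rw [integral_fintype .of_finite, Fintype.expect_eq_sum_div_card, Finset.sum_div]
  simp only [h2, smul_eq_mul, ite_mul, zero_mul]
  rw [← Finset.sum_filter, Finset.filter_mem_eq_inter, Finset.univ_inter,
    Finset.sum_image cliqueSet_injective.injOn]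
  exact Finset.sum_congr rfl fun c _ => by ring

theorem isProbabilityMeasure_uniformOn_onePerBlock {ℓ k : ℕ} (hℓ : 0 < ℓ) :
    IsProbabilityMeasure (uniformOn {K : Finset (Fin (ℓ * k)) | OnePerBlock ℓ k K}) :=
  isProbabilityMeasure_uniformOn (Set.toFinite _)
    ⟨cliqueSet fun _ => ⟨0, hℓ⟩, (onePerBlock_iff hℓ _).2 ⟨_, rfl⟩⟩

theorem isProbabilityMeasure_kPartitePlanted {ℓ k : ℕ} (hℓ : 0 < ℓ) :
    IsProbabilityMeasure (kPartitePlanted ℓ k) := by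
  have := isProbabilityMeasure_uniformOn_onePerBlock (k := k) hℓ
  rw [kPartitePlanted, cond_plantedPair hℓ]
  exact Measure.isProbabilityMeasure_map (measurable_of_finite _).aemeasurable

theorem integral_kPartitePlanted {ℓ k : ℕ} (hℓ : 0 < ℓ) (f : SimpleGraph (Fin (ℓ * k)) → ℝ) :
    ∫ G, f G ∂kPartitePlanted ℓ k =
      𝔼 c : Fin k → Fin ℓ, 𝔼 e : Pairs (ℓ * k) → Bool, f (plantClique (cliqueSet c) (ofBits e)) := by
  have := isProbabilityMeasure_uniformOn_onePerBlock (k := k) hℓ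
  rw [kPartitePlanted, cond_plantedPair hℓ, integral_map (measurable_of_finite _).aemeasurable
    (measurable_of_finite _).aestronglyMeasurable, integral_prod _ .of_finite]
  simp only [integral_erdosRenyi]
  exact integral_uniformOn_onePerBlock hℓ _

/-- The probability of an answer on a random graph without a planted clique. -/
theorem answerProb_erdosRenyi (M : RAM) (n k : ℕ) (b : Bool) : answerProb M k (erdosRenyi n) b =
    𝔼 e : Pairs n → Bool, (fairBits.prod fairBits).real
      {ω | M.Answers (encodeInstance k (ofBits e)) ω.1 ω.2 b} := by
  rw [answerProb_eq_integral, integral_erdosRenyi]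

/-- The probability of an answer on a random graph with a planted clique. -/
theorem answerProb_kPartitePlanted (M : RAM) {ℓ k : ℕ} (hℓ : 0 < ℓ) (k' : ℕ) (b : Bool) :
    answerProb M k' (kPartitePlanted ℓ k) b =
    𝔼 c : Fin k → Fin ℓ, 𝔼 e : Pairs (ℓ * k) → Bool, (fairBits.prod fairBits).real
      {ω | M.Answers (encodeInstance k' (plantClique (cliqueSet c) (ofBits e))) ω.1 ω.2 b} := by
  have := isProbabilityMeasure_kPartitePlanted (k := k) hℓ
  rw [answerProb_eq_integral, integral_kPartitePlanted hℓ]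

/-! ## Uniform averages -/

section

variable {J L E X : Type*} [Fintype J] [Fintype L] [Fintype E] [Fintype X]
  [DecidableEq J] [DecidableEq L] [DecidableEq E]

/-- Independent uniform symbols read at distinct places are again independent and uniform: the
coordinates outside the range of `ι` average out. -/
theorem expect_comp_injective [Nonempty X] {ι : J → E} (hι : Function.Injective ι)
    (g : (J → X) → ℝ) :
    𝔼 a : E → X, g (a ∘ ι) = 𝔼 b : J → X, g b := by
  classical
  let e : J ⊕ {y // y ∉ Set.range ι} ≃ E :=
    ((Equiv.ofInjective ι hι).sumCongr (Equiv.refl _)).trans (Equiv.Set.sumCompl (Set.range ι))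
  let e' : (E → X) ≃ (J → X) × ({y // y ∉ Set.range ι} → X) :=
    (e.arrowCongr (Equiv.refl X)).symm.trans (Equiv.sumArrowEquivProdArrow _ _ _)
  have he' : ∀ a, (e' a).1 = a ∘ ι := by
    intro a
    funext j
    exact congrArg a (Equiv.Set.sumCompl_apply_inl _ _)
  rw [Fintype.expect_equiv e' (fun a => g (a ∘ ι)) (fun b => g b.1) fun a => by rw [he'],
    ← Finset.univ_product_univ, Finset.expect_product]
  refine Finset.expect_congr rfl fun b _ => ?_
  exact Finset.expect_const (Finset.univ_nonempty (α := {y // y ∉ Set.range ι} → X)) (g b)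

theorem expect_sumElim (g : (J → X) → (L → X) → ℝ) :
    𝔼 a : J ⊕ L → X, g (a ∘ Sum.inl) (a ∘ Sum.inr) = 𝔼 b : J → X, 𝔼 c : L → X, g b c := by
  rw [Fintype.expect_equiv (Equiv.sumArrowEquivProdArrow J L X)
    (fun a => g (a ∘ Sum.inl) (a ∘ Sum.inr)) (fun b => g b.1 b.2) fun a => rfl,
    ← Finset.univ_product_univ, Finset.expect_product]

/-- Injectivity of `Sum.elim ι κ` means that the two index families are injective with disjoint
ranges. Independence in the reduction is reduced to such injectivity statements. -/
theorem expect_comp_pair [Nonempty X] {ι : J → E} {κ : L → E}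
    (h : Function.Injective (Sum.elim ι κ)) (g : (J → X) → (L → X) → ℝ) :
    𝔼 a : E → X, g (a ∘ ι) (a ∘ κ) = 𝔼 b : J → X, 𝔼 c : L → X, g b c := by
  rw [← expect_sumElim, ← expect_comp_injective h fun a => g (a ∘ Sum.inl) (a ∘ Sum.inr)]
  rfl

end

/-! ## Adjacencies in the random graphs -/

theorem adjBit_ofBits {n : ℕ} (e : Pairs n → Bool) {u v : ℕ} (huv : u < v) (hv : v < n) :
    adjBit (ofBits e) u v = e ⟨(⟨u, huv.trans hv⟩, ⟨v, hv⟩), huv⟩ := by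
  rw [Bool.eq_iff_iff, ← ofBits_adj]
  exact adjBit_fin (ofBits e) ⟨u, huv.trans hv⟩ ⟨v, hv⟩

theorem plantClique_adj {n : ℕ} (K : Finset (Fin n)) (G : SimpleGraph (Fin n)) (u v : Fin n) :
    (plantClique K G).Adj u v ↔ G.Adj u v ∨ u ≠ v ∧ u ∈ K ∧ v ∈ K := by
  simp only [plantClique, SimpleGraph.sup_adj, SimpleGraph.fromRel_adj]
  tauto

theorem adjBit_plantClique {n : ℕ} (K : Finset (Fin n)) (G : SimpleGraph (Fin n)) {u v : ℕ}
    (hu : u < n) (hv : v < n) (huv : u ≠ v) : adjBit (plantClique K G) u v =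
      (adjBit G u v || decide ((⟨u, hu⟩ : Fin n) ∈ K ∧ (⟨v, hv⟩ : Fin n) ∈ K)) := by
  rw [Bool.eq_iff_iff, Bool.or_eq_true, decide_eq_true_eq]
  have h1 := adjBit_fin (plantClique K G) ⟨u, hu⟩ ⟨v, hv⟩
  have h2 := adjBit_fin G ⟨u, hu⟩ ⟨v, hv⟩
  simp only at h1 h2
  rw [h1, h2, plantClique_adj]
  simp [huv]

theorem subGraph_adj {n m : ℕ} (A : SimpleGraph (Fin n)) (hm : m ≤ n) (u v : Fin m) :
    (subGraph m A).Adj u v ↔ A.Adj (Fin.castLE hm u) (Fin.castLE hm v) :=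
  adjBit_fin A (Fin.castLE hm u) (Fin.castLE hm v)

/-- Pairs among the first vertices. -/
def castPairs {m n : ℕ} (h : m ≤ n) (p : Pairs m) : Pairs n :=
  ⟨(Fin.castLE h p.1.1, Fin.castLE h p.1.2), p.2⟩

theorem subGraph_ofBits {m n : ℕ} (h : m ≤ n) (a : Pairs n → Bool) :
    subGraph m (ofBits a) = ofBits (a ∘ castPairs h) := by
  ext u v
  rw [subGraph_adj _ h]
  rfl

theorem subGraph_plantClique {ℓ ks k' : ℕ} (h : ks ≤ k') (c : Fin k' → Fin ℓ)
    (G : SimpleGraph (Fin (ℓ * k'))) : subGraph (ℓ * ks) (plantClique (cliqueSet c) G) =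
      plantClique (cliqueSet (c ∘ Fin.castLE h)) (subGraph (ℓ * ks) G) := by
  have hm : ℓ * ks ≤ ℓ * k' := Nat.mul_le_mul_left _ h
  ext u v
  rw [subGraph_adj _ hm, plantClique_adj, plantClique_adj, subGraph_adj _ hm]
  have hmem : ∀ w : Fin (ℓ * ks), Fin.castLE hm w ∈ cliqueSet c ↔
      w ∈ cliqueSet (c ∘ Fin.castLE h) := by
    intro w
    rw [mem_cliqueSet, mem_cliqueSet]
    rfl
  rw [hmem, hmem, Ne, Ne, Fin.castLE_inj]

/-! ### Edges used as multiple access bits, and the subgraph reduction -/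

section multi

variable {ℓ k : ℕ}

theorem multi_lt (j : Fin (ℓ * k * (ℓ * k))) :
    (j : ℕ) / (ℓ * k) < ℓ * k ∧ (j : ℕ) % (ℓ * k) < ℓ * k := by
  have h1 : (j : ℕ) / (ℓ * k) < ℓ * k := Nat.div_lt_of_lt_mul j.2
  exact ⟨h1, Nat.mod_lt _ ((Nat.zero_le _).trans_lt h1)⟩

theorem three_mul_size : ℓ * (3 * k) = 3 * (ℓ * k) := by ring

/-- The edges that serve as multiple access random bits. -/
def multiPair (j : Fin (ℓ * k * (ℓ * k))) : Pairs (ℓ * (3 * k)) :=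
  ⟨(⟨ℓ * k + j / (ℓ * k), by have := multi_lt j; rw [three_mul_size]; omega⟩,
    ⟨2 * (ℓ * k) + j % (ℓ * k), by have := multi_lt j; rw [three_mul_size]; omega⟩), by
    have := multi_lt j
    simp only [Fin.mk_lt_mk]
    omega⟩

/-- The edges of the clique with the given positions in the last `2 * k` blocks among the edges
that serve as multiple access random bits. -/
def cliqueBits (c : Fin (2 * k) → Fin ℓ) (j : Fin (ℓ * k * (ℓ * k))) : Bool :=
  decide ((j : ℕ) / (ℓ * k) % ℓ =
      c ⟨j / (ℓ * k) / ℓ, by have := Nat.div_lt_of_lt_mul (multi_lt j).1; omega⟩ ∧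
    (j : ℕ) % (ℓ * k) % ℓ =
      c ⟨k + j % (ℓ * k) / ℓ, by have := Nat.div_lt_of_lt_mul (multi_lt j).2; omega⟩)

theorem simMulti_ofBits (a : Pairs (ℓ * (3 * k)) → Bool) :
    (fun j : Fin (ℓ * k * (ℓ * k)) => simMulti (ℓ * k) (ofBits a) j) = a ∘ multiPair := by
  funext j
  exact adjBit_ofBits a (multiPair j).2 (multiPair j).1.2.2

/-- The last `2 * k` blocks. -/
def lastBlocks (j : Fin (2 * k)) : Fin (3 * k) := ⟨k + j, by omega⟩

/-- Planting a clique only adds edges, so it or-s a mask into the string. The endpoints of these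
edges lie in the last `2 * k` blocks, so the mask ignores the clique positions in the first `k`
blocks. -/
theorem simMulti_plantClique (c : Fin (3 * k) → Fin ℓ) (G : SimpleGraph (Fin (ℓ * (3 * k)))) :
    (fun j : Fin (ℓ * k * (ℓ * k)) => simMulti (ℓ * k) (plantClique (cliqueSet c) G) j) =
      fun j : Fin (ℓ * k * (ℓ * k)) => simMulti (ℓ * k) G j || cliqueBits (c ∘ lastBlocks) j := by
  funext j
  have hj := multi_lt j
  have hℓ : 0 < ℓ := by
    by_contra h
    have : ℓ = 0 := by omega
    subst this
    have := hj.1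
    simp at this
  refine (adjBit_plantClique _ _ (multiPair j).1.1.2 (multiPair j).1.2.2
    (Fin.val_injective.ne (multiPair j).2.ne)).trans (congrArg (simMulti (ℓ * k) G j || ·) ?_)
  rw [cliqueBits, decide_eq_decide, mem_cliqueSet, mem_cliqueSet]
  have e1 : (ℓ * k + j / (ℓ * k)) % ℓ = j / (ℓ * k) % ℓ := Nat.mul_add_mod _ _ _
  have e2 : (2 * (ℓ * k) + j % (ℓ * k)) % ℓ = j % (ℓ * k) % ℓ := by
    rw [show 2 * (ℓ * k) = ℓ * (2 * k) by ring, Nat.mul_add_mod]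
  have e3 : (ℓ * k + j / (ℓ * k)) / ℓ = k + j / (ℓ * k) / ℓ := Nat.mul_add_div hℓ _ _
  have e4 : (2 * (ℓ * k) + j % (ℓ * k)) / ℓ = k + (k + j % (ℓ * k) / ℓ) := by
    rw [show 2 * (ℓ * k) = ℓ * (2 * k) by ring, Nat.mul_add_div hℓ]
    ring
  simp only [multiPair, e1, e2, e3, e4, Function.comp, lastBlocks]

theorem lastBlocks_injective {ks : ℕ} (h : ks ≤ k) : Function.Injective
    (Sum.elim (Fin.castLE (by omega) : Fin ks → Fin (3 * k)) lastBlocks) := by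
  rintro (i | i) (j | j) hij <;> simp [lastBlocks, Fin.ext_iff] at hij ⊢ <;> omega

theorem multiPair_injective : Function.Injective (multiPair : Fin (ℓ * k * (ℓ * k)) → _) := by
  intro i j h
  simp only [multiPair, Subtype.mk.injEq, Prod.mk.injEq, Fin.mk.injEq, Nat.add_left_cancel_iff] at h
  apply Fin.ext
  rw [← Nat.div_add_mod (i : ℕ) (ℓ * k), ← Nat.div_add_mod (j : ℕ) (ℓ * k), h.1, h.2]

/-- Edges of the subgraph have both endpoints below `ℓ * k`, whereas edges serving as random bits
have both endpoints at or above it. -/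
theorem castPairs_multiPair_injective {ks : ℕ} (h : ks ≤ k) : Function.Injective
    (Sum.elim (castPairs (Nat.mul_le_mul_left ℓ (by omega : ks ≤ 3 * k))) multiPair) := by
  have hle : ℓ * ks ≤ ℓ * k := Nat.mul_le_mul_left _ h
  refine Function.Injective.sumElim ?_ multiPair_injective ?_
  · intro p q hpq
    simp only [castPairs, Subtype.mk.injEq, Prod.mk.injEq, Fin.castLE_inj] at hpq
    exact Subtype.ext (Prod.ext hpq.1 hpq.2)
  · intro p j hpj
    simp only [castPairs, multiPair, Subtype.mk.injEq, Prod.mk.injEq, Fin.ext_iff,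
      Fin.val_castLE] at hpj
    have := p.1.1.2
    omega

theorem expect_sub_null {ks : ℕ} (h : ks ≤ k)
    (F : SimpleGraph (Fin (ℓ * ks)) → (Fin (ℓ * k * (ℓ * k)) → Bool) → ℝ) :
    𝔼 a : Pairs (ℓ * (3 * k)) → Bool, F (subGraph (ℓ * ks) (ofBits a))
      (fun j => simMulti (ℓ * k) (ofBits a) j) =
    𝔼 e : Pairs (ℓ * ks) → Bool, 𝔼 r : Fin (ℓ * k * (ℓ * k)) → Bool, F (ofBits e) r := by
  have hm : ℓ * ks ≤ ℓ * (3 * k) := Nat.mul_le_mul_left _ (by omega)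
  simp only [simMulti_ofBits, subGraph_ofBits hm]
  exact expect_comp_pair (castPairs_multiPair_injective h) fun e r => F (ofBits e) r

/-- The instance and the masked string are independent: they use clique positions in disjoint sets
of blocks and disjoint sets of edges. -/
theorem expect_sub_planted {ks : ℕ} (hℓ : 0 < ℓ) (h : ks ≤ k)
    (F : SimpleGraph (Fin (ℓ * ks)) → (Fin (ℓ * k * (ℓ * k)) → Bool) → ℝ) :
    𝔼 c : Fin (3 * k) → Fin ℓ, 𝔼 a : Pairs (ℓ * (3 * k)) → Bool,
      F (subGraph (ℓ * ks) (plantClique (cliqueSet c) (ofBits a)))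
        (fun j => simMulti (ℓ * k) (plantClique (cliqueSet c) (ofBits a)) j) =
    𝔼 c₁ : Fin ks → Fin ℓ, 𝔼 c₂ : Fin (2 * k) → Fin ℓ, 𝔼 e : Pairs (ℓ * ks) → Bool,
      𝔼 r : Fin (ℓ * k * (ℓ * k)) → Bool,
      F (plantClique (cliqueSet c₁) (ofBits e)) fun j => r j || cliqueBits c₂ j := by
  have : NeZero ℓ := ⟨hℓ.ne'⟩
  have hm : ℓ * ks ≤ ℓ * (3 * k) := Nat.mul_le_mul_left _ (by omega)
  have h3 : ks ≤ 3 * k := by omega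
  rw [← expect_comp_pair (lastBlocks_injective h)]
  refine Finset.expect_congr rfl fun c _ => ?_
  simp only [simMulti_plantClique, subGraph_plantClique h3, subGraph_ofBits hm]
  rw [← expect_comp_pair (castPairs_multiPair_injective h)]
  refine Finset.expect_congr rfl fun a _ => ?_
  rw [← simMulti_ofBits]

end multi

theorem expect_comp_triple {J L R E X : Type*} [Fintype J] [Fintype L] [Fintype R] [Fintype E]
    [Fintype X] [DecidableEq J] [DecidableEq L] [DecidableEq R] [DecidableEq E] [Nonempty X]
    {ι : J → E} {κ : L → E} {ρ : R → E} (h : Function.Injective (Sum.elim (Sum.elim ι κ) ρ))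
    (g : (J → X) → (L → X) → (R → X) → ℝ) :
    𝔼 a : E → X, g (a ∘ ι) (a ∘ κ) (a ∘ ρ) =
      𝔼 b : J → X, 𝔼 c : L → X, 𝔼 d : R → X, g b c d := by
  rw [← expect_sumElim fun b c => 𝔼 d : R → X, g b c d,
    ← expect_comp_pair h fun b d => g (b ∘ Sum.inl) (b ∘ Sum.inr) d]
  rfl

/-! ### Edges inside blocks, and the law of the simulated planted instance -/

section simulation

variable {ℓ k ks : ℕ}

theorem cleanPair_bounds {t : ℕ} (ht : t < 3 * k * (ℓ / 2 * (ℓ / 2))) :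
    t / (ℓ / 2 * (ℓ / 2)) < 3 * k ∧ t % (ℓ / 2 * (ℓ / 2)) / (ℓ / 2) < ℓ / 2 ∧
      t % (ℓ / 2 * (ℓ / 2)) % (ℓ / 2) < ℓ / 2 := by
  have h0 : 0 < ℓ / 2 * (ℓ / 2) := by
    by_contra h
    have : ℓ / 2 * (ℓ / 2) = 0 := by omega
    rw [this] at ht
    omega
  refine ⟨Nat.div_lt_of_lt_mul (by rwa [mul_comm] at ht), Nat.div_lt_of_lt_mul (Nat.mod_lt _ h0),
    Nat.mod_lt _ (Nat.pos_of_mul_pos_left h0)⟩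

theorem add_lt_block {j p : ℕ} (hj : j < k) (hp : p < ℓ) : j * ℓ + p < ℓ * k :=
  (blockVertex (⟨j, hj⟩ : Fin k) ⟨p, hp⟩).2

/-- The edges inside the blocks that replace read-once random bits. -/
def cleanPair (t : Fin (3 * k * (ℓ / 2 * (ℓ / 2)))) : Pairs (ℓ * (3 * k)) :=
  ⟨(blockVertex ⟨_, (cleanPair_bounds t.2).1⟩
      ⟨t % (ℓ / 2 * (ℓ / 2)) / (ℓ / 2), by have := cleanPair_bounds t.2; omega⟩,
    blockVertex ⟨_, (cleanPair_bounds t.2).1⟩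
      ⟨ℓ / 2 + t % (ℓ / 2 * (ℓ / 2)) % (ℓ / 2), by have := cleanPair_bounds t.2; omega⟩), by
    have := cleanPair_bounds t.2
    simp only [blockVertex, Fin.mk_lt_mk]
    omega⟩

theorem cleanBit_eq_adjBit {n : ℕ} (A : SimpleGraph (Fin n)) (t : Fin (3 * k * (ℓ / 2 * (ℓ / 2)))) :
    cleanBit ℓ A t = adjBit A (cleanPair t).1.1 (cleanPair t).1.2 := by
  simp only [cleanBit, cleanPair, blockVertex, add_assoc]

theorem cleanBit_ofBits (a : Pairs (ℓ * (3 * k)) → Bool) (t : Fin (3 * k * (ℓ / 2 * (ℓ / 2)))) :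
    cleanBit ℓ (ofBits a) t = a (cleanPair t) := by
  rw [cleanBit_eq_adjBit]
  exact adjBit_ofBits a (cleanPair t).2 (cleanPair t).1.2.2

/-- The two endpoints lie in one block at different positions, one in each half, whereas the clique
has a single vertex in that block. Planting cannot touch such an edge. -/
theorem cleanBit_plantClique (c : Fin (3 * k) → Fin ℓ) (G : SimpleGraph (Fin (ℓ * (3 * k))))
    (t : Fin (3 * k * (ℓ / 2 * (ℓ / 2)))) :
    cleanBit ℓ (plantClique (cliqueSet c) G) t = cleanBit ℓ G t := by
  rw [cleanBit_eq_adjBit, cleanBit_eq_adjBit, adjBit_plantClique _ _ (cleanPair t).1.1.2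
    (cleanPair t).1.2.2 (Fin.val_injective.ne (cleanPair t).2.ne), decide_eq_false, Bool.or_false]
  rintro ⟨h1, h2⟩
  simp only [cleanPair, Fin.eta, blockVertex_mem_cliqueSet] at h1 h2
  have := h1.trans h2.symm
  have hb := cleanPair_bounds t.2
  simp only [Fin.mk.injEq] at this
  omega

theorem cleanPair_injective :
    Function.Injective (cleanPair : Fin (3 * k * (ℓ / 2 * (ℓ / 2))) → Pairs (ℓ * (3 * k))) := by
  intro s t h
  simp only [cleanPair, Subtype.mk.injEq, Prod.mk.injEq] at h
  have h1 := congrArg (fun v : Fin (ℓ * (3 * k)) => (v : ℕ) / ℓ) h.1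
  have h2 := congrArg (fun v : Fin (ℓ * (3 * k)) => (v : ℕ) % ℓ) h.1
  have h3 := congrArg (fun v : Fin (ℓ * (3 * k)) => (v : ℕ) % ℓ) h.2
  simp only [blockVertex_div, blockVertex_mod] at h1 h2 h3
  have h4 := Nat.add_left_cancel h3
  have h5 : (s : ℕ) % (ℓ / 2 * (ℓ / 2)) = t % (ℓ / 2 * (ℓ / 2)) := by
    rw [← Nat.div_add_mod ((s : ℕ) % (ℓ / 2 * (ℓ / 2))) (ℓ / 2), h2, h4, Nat.div_add_mod]
  apply Fin.ext
  rw [← Nat.div_add_mod (s : ℕ) (ℓ / 2 * (ℓ / 2)), h1, h5, Nat.div_add_mod]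

/-- One edge stays within a block, the other joins a block of the middle third to one of the last
third. -/
theorem cleanPair_ne_multiPair (t : Fin (3 * k * (ℓ / 2 * (ℓ / 2)))) (j : Fin (ℓ * k * (ℓ * k))) :
    cleanPair t ≠ multiPair j := by
  intro h
  have hj := multi_lt j
  have hℓ : 0 < ℓ := by
    by_contra h
    have : ℓ = 0 := by omega
    subst this
    have := hj.1
    simp at this
  have h1 := congrArg (fun p : Pairs (ℓ * (3 * k)) => (p.1.1 : ℕ) / ℓ) h
  have h2 := congrArg (fun p : Pairs (ℓ * (3 * k)) => (p.1.2 : ℕ) / ℓ) h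
  simp only [cleanPair, blockVertex_div, multiPair] at h1 h2
  rw [Nat.mul_add_div hℓ] at h1
  rw [show 2 * (ℓ * k) = ℓ * (2 * k) by ring, Nat.mul_add_div hℓ] at h2
  have := Nat.div_lt_of_lt_mul hj.1
  linarith [Nat.zero_le ((j : ℕ) % (ℓ * k) / ℓ)]

section

variable (hcap : ℓ * ks * (ℓ * ks) + ℓ * ks ≤ 3 * k * (ℓ / 2 * (ℓ / 2)))

/-- The index of the random bit for an edge of the simulated instance. -/
def edgeIndex (p : Pairs (ℓ * ks)) : Fin (3 * k * (ℓ / 2 * (ℓ / 2))) :=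
  ⟨p.1.1 * (ℓ * ks) + p.1.2, by
    have h1 := p.1.1.2
    have h2 := p.1.2.2
    nlinarith⟩

/-- The index of a random bit for the position of a clique vertex of the simulated instance. -/
def posIndex (q : Fin ks × Fin ℓ) : Fin (3 * k * (ℓ / 2 * (ℓ / 2))) :=
  ⟨ℓ * ks * (ℓ * ks) + (q.1 * ℓ + q.2), by
    have := add_lt_block q.1.2 q.2.2
    omega⟩

/-- Edge bits occupy indices below `(ℓ * ks) ^ 2` and position bits start there, so the two ranges
do not meet; `hcap` says that both fit among the available pairs. -/
theorem simIndex_injective : Function.Injective (Sum.elim (Sum.elim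
    (cleanPair ∘ posIndex hcap) (cleanPair ∘ edgeIndex hcap)) multiPair) := by
  have key : ∀ x, ∃ t, Sum.elim (cleanPair ∘ posIndex hcap) (cleanPair ∘ edgeIndex hcap) x =
      cleanPair t := by
    rintro (x | x)
    exacts [⟨_, rfl⟩, ⟨_, rfl⟩]
  refine Function.Injective.sumElim ?_ multiPair_injective fun x j => ?_
  · refine Function.Injective.sumElim (cleanPair_injective.comp ?_) (cleanPair_injective.comp ?_) ?_
    · intro x y h
      have h' := congrArg Fin.val h
      simp only [posIndex, Nat.add_left_cancel_iff] at h'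
      have h'' : blockVertex x.1 x.2 = blockVertex y.1 y.2 := Fin.ext h'
      have h1 := congrArg (fun v : Fin (ℓ * ks) => (v : ℕ) / ℓ) h''
      have h2 := congrArg (fun v : Fin (ℓ * ks) => (v : ℕ) % ℓ) h''
      simp only [blockVertex_div, blockVertex_mod] at h1 h2
      exact Prod.ext (Fin.ext h1) (Fin.ext h2)
    · intro x y h
      have h' := congrArg Fin.val h
      simp only [edgeIndex] at h'
      have h'' : blockVertex x.1.1 x.1.2 = blockVertex y.1.1 y.1.2 := Fin.ext h'
      have h1 := congrArg (fun v : Fin (ℓ * ks * (ℓ * ks)) => (v : ℕ) / (ℓ * ks)) h''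
      have h2 := congrArg (fun v : Fin (ℓ * ks * (ℓ * ks)) => (v : ℕ) % (ℓ * ks)) h''
      simp only [blockVertex_div, blockVertex_mod] at h1 h2
      exact Subtype.ext (Prod.ext (Fin.ext h1) (Fin.ext h2))
    · intro x y h
      have h' := congrArg Fin.val (cleanPair_injective h)
      simp only [edgeIndex, posIndex] at h'
      have := add_lt_block y.1.1.2 y.1.2.2
      omega
  · obtain ⟨t, ht⟩ := key x
    rw [ht]
    exact cleanPair_ne_multiPair t j

/-- The position in a block that is given by random bits. -/
def bitsPos (hℓ : 0 < ℓ) (b : Fin ℓ → Bool) : Fin ℓ :=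
  ⟨binaryMod ℓ (extendBits b) ℓ, Reduction.binaryMod_lt hℓ _ _⟩

theorem binaryMod_congr {b b' : ℕ → Bool} {n : ℕ} (h : ∀ s < n, b s = b' s) :
    binaryMod ℓ b n = binaryMod ℓ b' n := by
  induction n with
  | zero => rfl
  | succ n ih => rw [binaryMod, binaryMod, ih fun s hs => h s (by omega), h n (by omega)]

/-- Only the clean bits of `A` are assumed to be those of `a`. Hence the same statement serves for
`ofBits a` itself and for any graph obtained from it by planting a clique. -/
theorem simGraph_eq (hℓ : 0 < ℓ) {n : ℕ} (A : SimpleGraph (Fin n))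
    (a : Pairs (ℓ * (3 * k)) → Bool)
    (ha : ∀ t : Fin (3 * k * (ℓ / 2 * (ℓ / 2))), cleanBit ℓ A t = a (cleanPair t)) :
    simGraph ℓ ks A = plantClique
      (cliqueSet fun j : Fin ks => bitsPos hℓ fun s => (a ∘ cleanPair ∘ posIndex hcap) (j, s))
      (ofBits (a ∘ cleanPair ∘ edgeIndex hcap)) := by
  have hpos : ∀ j : Fin ks, simPos ℓ ks A j =
      bitsPos hℓ fun s => (a ∘ cleanPair ∘ posIndex hcap) (j, s) := by
    intro j
    refine binaryMod_congr fun s hs => ?_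
    rw [extendBits, dif_pos hs]
    exact ha (posIndex hcap (j, ⟨s, hs⟩))
  have hedge : ∀ u v : Fin (ℓ * ks), u < v →
      (cleanBit ℓ A ((u : ℕ) * (ℓ * ks) + v) = true ↔
        (ofBits (a ∘ cleanPair ∘ edgeIndex hcap)).Adj u v) := by
    intro u v huv
    rw [← adjBit_fin, adjBit_ofBits _ huv v.2]
    exact iff_of_eq (congrArg (· = true) (ha (edgeIndex hcap ⟨(u, v), huv⟩)))
  ext u v
  rw [plantClique_adj, mem_cliqueSet, mem_cliqueSet]
  change (u ≠ v ∧ ((_ ∧ _) ∨ _)) ↔ _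
  rw [← hpos, ← hpos]
  have hmin : u ≠ v → (cleanBit ℓ A (min (u : ℕ) v * (ℓ * ks) + max (u : ℕ) v) = true ↔
      (ofBits (a ∘ cleanPair ∘ edgeIndex hcap)).Adj u v) := by
    intro huv
    rcases lt_or_gt_of_ne huv with h | h
    · have h' : (u : ℕ) ≤ v := h.le
      rw [min_eq_left h', max_eq_right h', hedge u v h]
    · have h' : (v : ℕ) ≤ u := h.le
      rw [min_eq_right h', max_eq_left h', hedge v u h, SimpleGraph.adj_comm]
  constructor
  · rintro ⟨h, h' | h'⟩
    · exact Or.inr ⟨h, h'⟩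
    · exact Or.inl ((hmin h).1 h')
  · rintro (h | ⟨h, h'⟩)
    · exact ⟨h.ne, Or.inr ((hmin h.ne).2 h)⟩
    · exact ⟨h, Or.inl h'⟩

theorem expect_sim_null (hℓ : 0 < ℓ)
    (hcap : ℓ * ks * (ℓ * ks) + ℓ * ks ≤ 3 * k * (ℓ / 2 * (ℓ / 2)))
    (F : SimpleGraph (Fin (ℓ * ks)) → (Fin (ℓ * k * (ℓ * k)) → Bool) → ℝ) :
    𝔼 a : Pairs (ℓ * (3 * k)) → Bool, F (simGraph ℓ ks (ofBits a))
      (fun j => simMulti (ℓ * k) (ofBits a) j) =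
    𝔼 z : Fin ks × Fin ℓ → Bool, 𝔼 e : Pairs (ℓ * ks) → Bool,
      𝔼 r : Fin (ℓ * k * (ℓ * k)) → Bool,
      F (plantClique (cliqueSet fun j => bitsPos hℓ fun s => z (j, s)) (ofBits e)) r := by
  rw [← expect_comp_triple (simIndex_injective hcap)]
  refine Finset.expect_congr rfl fun a _ => ?_
  rw [simMulti_ofBits, simGraph_eq hcap hℓ _ a (cleanBit_ofBits a)]

/-- The clique of the input leaves no trace in the simulated instance; it enters only through the
mask on the multiple access string, and the positions in the first `k` blocks average out. -/
theorem expect_sim_planted (hℓ : 0 < ℓ)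
    (hcap : ℓ * ks * (ℓ * ks) + ℓ * ks ≤ 3 * k * (ℓ / 2 * (ℓ / 2)))
    (F : SimpleGraph (Fin (ℓ * ks)) → (Fin (ℓ * k * (ℓ * k)) → Bool) → ℝ) :
    𝔼 c : Fin (3 * k) → Fin ℓ, 𝔼 a : Pairs (ℓ * (3 * k)) → Bool,
      F (simGraph ℓ ks (plantClique (cliqueSet c) (ofBits a)))
        (fun j => simMulti (ℓ * k) (plantClique (cliqueSet c) (ofBits a)) j) =
    𝔼 z : Fin ks × Fin ℓ → Bool, 𝔼 c₂ : Fin (2 * k) → Fin ℓ, 𝔼 e : Pairs (ℓ * ks) → Bool,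
      𝔼 r : Fin (ℓ * k * (ℓ * k)) → Bool,
      F (plantClique (cliqueSet fun j => bitsPos hℓ fun s => z (j, s)) (ofBits e))
        fun j => r j || cliqueBits c₂ j := by
  have : NeZero ℓ := ⟨hℓ.ne'⟩
  have hlast : Function.Injective (lastBlocks (k := k)) := by
    intro i j hij
    simpa [lastBlocks, Fin.ext_iff] using hij
  have hrow : ∀ c : Fin (3 * k) → Fin ℓ, 𝔼 a : Pairs (ℓ * (3 * k)) → Bool,
      F (simGraph ℓ ks (plantClique (cliqueSet c) (ofBits a)))
        (fun j => simMulti (ℓ * k) (plantClique (cliqueSet c) (ofBits a)) j) =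
      𝔼 z : Fin ks × Fin ℓ → Bool, 𝔼 e : Pairs (ℓ * ks) → Bool,
        𝔼 r : Fin (ℓ * k * (ℓ * k)) → Bool,
        F (plantClique (cliqueSet fun j => bitsPos hℓ fun s => z (j, s)) (ofBits e))
          fun j => r j || cliqueBits (c ∘ lastBlocks) j := by
    intro c
    rw [← expect_comp_triple (simIndex_injective hcap)]
    refine Finset.expect_congr rfl fun a _ => ?_
    rw [simMulti_plantClique, simGraph_eq hcap hℓ _ a fun t =>
      (cleanBit_plantClique c _ t).trans (cleanBit_ofBits a t), ← simMulti_ofBits]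
  rw [Finset.expect_congr rfl fun c _ => hrow c, Finset.expect_comm]
  refine Finset.expect_congr rfl fun z _ => ?_
  exact expect_comp_injective hlast fun c => 𝔼 e : Pairs (ℓ * ks) → Bool,
    𝔼 r : Fin (ℓ * k * (ℓ * k)) → Bool,
      F (plantClique (cliqueSet fun j => bitsPos hℓ fun s => z (j, s)) (ofBits e))
        fun j => r j || cliqueBits c j

end

end simulation

/-! ## Nearly uniform positions -/

theorem card_comp_eq_prod {B P : Type*} [Fintype B] [DecidableEq B] [DecidableEq P] (π : B → P)
    {n : ℕ} (c : Fin n → P) : (Finset.univ.filter fun z : Fin n → B => π ∘ z = c).card =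
      ∏ j, (Finset.univ.filter fun b => π b = c j).card := by
  rw [← Fintype.card_piFinset]
  congr 1
  ext z
  simp [Fintype.mem_piFinset, funext_iff]

/-- If each fibre of `π` has at least `1 - δ` times its fair share, then each fibre of the `n`-fold
product has at least `(1 - δ) ^ n` times its fair share. -/
theorem expect_comp_ge {B P : Type*} [Fintype B] [DecidableEq B] [Nonempty B] [Fintype P]
    [DecidableEq P] [Nonempty P] (π : B → P) {δ : ℝ} (hδ : δ ≤ 1)
    (hπ : ∀ p, (1 - δ) * (Fintype.card B / Fintype.card P : ℝ) ≤
      (Finset.univ.filter fun b => π b = p).card) {n : ℕ} {g : (Fin n → P) → ℝ}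
    (hg : ∀ c, 0 ≤ g c) :
    (1 - δ) ^ n * 𝔼 c, g c ≤ 𝔼 z : Fin n → B, g (π ∘ z) := by
  have h0 : 0 < (Fintype.card B : ℝ) := by exact_mod_cast Fintype.card_pos
  have h1 : 0 < (Fintype.card P : ℝ) := by exact_mod_cast Fintype.card_pos
  have key : ∀ c : Fin n → P, ((1 - δ) * (Fintype.card B / Fintype.card P : ℝ)) ^ n ≤
      (Finset.univ.filter fun z : Fin n → B => π ∘ z = c).card := by
    intro c
    rw [card_comp_eq_prod, Nat.cast_prod]
    calc _ = ∏ _j : Fin n, ((1 - δ) * (Fintype.card B / Fintype.card P : ℝ)) := by simp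
      _ ≤ _ := Finset.prod_le_prod
        (fun _ _ => mul_nonneg (by linarith) (by positivity)) fun j _ => hπ (c j)
  have hsum : ∑ z : Fin n → B, g (π ∘ z) =
      ∑ c, ((Finset.univ.filter fun z : Fin n → B => π ∘ z = c).card : ℝ) * g c := by
    rw [← Finset.sum_fiberwise_of_maps_to (t := Finset.univ) (g := fun z : Fin n → B => π ∘ z)
      fun _ _ => Finset.mem_univ _]
    refine Finset.sum_congr rfl fun c _ => ?_
    rw [← nsmul_eq_mul, ← Finset.sum_const]
    refine Finset.sum_congr rfl fun z hz => ?_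
    rw [(Finset.mem_filter.1 hz).2]
  rw [Fintype.expect_eq_sum_div_card, Fintype.expect_eq_sum_div_card, hsum,
    le_div_iff₀ (by exact_mod_cast Fintype.card_pos)]
  calc _ = ∑ c, ((1 - δ) * (Fintype.card B / Fintype.card P : ℝ)) ^ n * g c := by
        rw [← Finset.mul_sum]
        simp only [Fintype.card_fun, Fintype.card_fin, Nat.cast_pow]
        rw [mul_pow, div_pow]
        field_simp
    _ ≤ _ := Finset.sum_le_sum fun c _ => mul_le_mul_of_nonneg_right (key c) (hg c)

/-- A lower bound on fibres suffices for both directions: it is applied to `g` and to `1 - g`, and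
Bernoulli's inequality turns `(1 - δ) ^ n` into `1 - n * δ`. -/
theorem abs_expect_comp_sub_le {B P : Type*} [Fintype B] [DecidableEq B] [Nonempty B] [Fintype P]
    [DecidableEq P] [Nonempty P] (π : B → P) {δ : ℝ} (hδ0 : 0 ≤ δ) (hδ : δ ≤ 1)
    (hπ : ∀ p, (1 - δ) * (Fintype.card B / Fintype.card P : ℝ) ≤
      (Finset.univ.filter fun b => π b = p).card) {n : ℕ} {g : (Fin n → P) → ℝ} (hg : ∀ c, 0 ≤ g c)
    (hg1 : ∀ c, g c ≤ 1) :
    |𝔼 z : Fin n → B, g (π ∘ z) - 𝔼 c, g c| ≤ n * δ := by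
  have hpow : 1 - n * δ ≤ (1 - δ) ^ n := by
    have := one_add_mul_le_pow (show (-2 : ℝ) ≤ -δ by linarith) n
    calc (1 : ℝ) - n * δ = 1 + n * -δ := by ring
      _ ≤ _ := this
  have key : ∀ f : (Fin n → P) → ℝ, (∀ c, 0 ≤ f c) → (∀ c, f c ≤ 1) →
      𝔼 c, f c - n * δ ≤ 𝔼 z : Fin n → B, f (π ∘ z) := by
    intro f hf hf1
    have h1 := expect_comp_ge π hδ hπ hf
    have h2 : 0 ≤ 𝔼 c, f c := Finset.expect_nonneg fun c _ => hf c
    have h3 : 𝔼 c, f c ≤ 1 :=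
      (Finset.expect_le_expect fun c _ => hf1 c).trans_eq (Fintype.expect_const 1)
    have h4 : (0 : ℝ) ≤ n * δ := by positivity
    nlinarith
  have h1 := key g hg hg1
  have h2 := key (fun c => 1 - g c) (fun c => sub_nonneg.2 (hg1 c)) fun c => by linarith [hg c]
  rw [Finset.expect_sub_distrib, Finset.expect_sub_distrib, Fintype.expect_const,
    Fintype.expect_const] at h2
  rw [abs_le]
  constructor <;> linarith

/-- Horner's scheme, most significant bit first: after `s` digits the value is the leading part of
`v`, reduced modulo `ℓ`. -/
theorem binaryMod_testBit (ℓ v n : ℕ) {s : ℕ} (hs : s ≤ n) (hv : v < 2 ^ n) :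
    binaryMod ℓ (fun i => v.testBit (n - 1 - i)) s = v / 2 ^ (n - s) % ℓ := by
  induction s with
  | zero => rw [binaryMod, Nat.sub_zero, Nat.div_eq_of_lt hv, Nat.zero_mod]
  | succ s ih =>
    rw [binaryMod, ih (by omega), Nat.testBit_eq_decide_div_mod_eq,
      show n - 1 - s = n - (s + 1) by omega, show n - s = n - (s + 1) + 1 by omega, pow_succ,
      ← Nat.div_div_eq_div_mul]
    generalize v / 2 ^ (n - (s + 1)) = w
    rw [Nat.add_mod, Nat.mul_mod_mod, ← Nat.add_mod]
    congr 1
    rcases Nat.mod_two_eq_zero_or_one w with h | h <;> simp [h] <;> omega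

/-- The numbers `q * ℓ + p` with `q < 2 ^ ℓ / ℓ` lie below `2 ^ ℓ`, are congruent to `p`, and have
distinct bit strings. -/
theorem card_bitsPos_ge {ℓ : ℕ} (hℓ : 0 < ℓ) (p : Fin ℓ) :
    2 ^ ℓ / ℓ ≤ (Finset.univ.filter fun b => bitsPos hℓ b = p).card := by
  have hlt : ∀ q < 2 ^ ℓ / ℓ, q * ℓ + p < 2 ^ ℓ := by
    intro q hq
    have h1 : (q + 1) * ℓ ≤ 2 ^ ℓ := (Nat.mul_le_mul_right _ hq).trans (Nat.div_mul_le_self _ _)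
    have h2 := p.2
    linarith
  let f : ℕ → Fin ℓ → Bool := fun q i => (q * ℓ + p).testBit (ℓ - 1 - i)
  rw [← Finset.card_range (2 ^ ℓ / ℓ)]
  refine Finset.card_le_card_of_injOn f (fun q hq => ?_) fun q hq q' hq' h => ?_
  · have hq := hlt q (Finset.mem_range.1 hq)
    simp only [Finset.coe_filter, Finset.mem_univ, true_and, Set.mem_ofPred_eq, bitsPos, Fin.ext_iff]
    rw [binaryMod_congr (b' := fun i => (q * ℓ + p).testBit (ℓ - 1 - i)) fun s hs => by
      rw [extendBits, dif_pos hs], binaryMod_testBit ℓ _ ℓ le_rfl hq, Nat.sub_self, pow_zero,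
      Nat.div_one, mul_comm, Nat.mul_add_mod, Nat.mod_eq_of_lt p.2]
  · have hq := hlt q (Finset.mem_range.1 hq)
    have hq' := hlt q' (Finset.mem_range.1 hq')
    have : q * ℓ + p = q' * ℓ + p := by
      refine Nat.eq_of_testBit_eq fun i => ?_
      by_cases hi : i < ℓ
      · have := congrFun h ⟨ℓ - 1 - i, by omega⟩
        simpa [f, show ℓ - 1 - (ℓ - 1 - i) = i by omega] using this
      · have h2 : 2 ^ ℓ ≤ 2 ^ i := Nat.pow_le_pow_right (by norm_num) (by omega)
        rw [Nat.testBit_lt_two_pow (hq.trans_le h2), Nat.testBit_lt_two_pow (hq'.trans_le h2)]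
    exact Nat.eq_of_mul_eq_mul_right hℓ (Nat.add_right_cancel this)

theorem abs_expect_bitsPos_sub_le {ℓ n : ℕ} (hℓ : 0 < ℓ) {g : (Fin n → Fin ℓ) → ℝ}
    (hg : ∀ c, 0 ≤ g c) (hg1 : ∀ c, g c ≤ 1) :
    |𝔼 z : Fin n × Fin ℓ → Bool, g (fun j => bitsPos hℓ fun s => z (j, s)) - 𝔼 c, g c| ≤
      n * (ℓ / 2 ^ ℓ) := by
  have : NeZero ℓ := ⟨hℓ.ne'⟩
  have hpow : (ℓ : ℝ) ≤ 2 ^ ℓ := by exact_mod_cast (Nat.lt_two_pow_self (n := ℓ)).le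
  have hℓ' : (0 : ℝ) < ℓ := by exact_mod_cast hℓ
  rw [Fintype.expect_equiv (Equiv.curry (Fin n) (Fin ℓ) Bool)
    (fun z => g (fun j => bitsPos hℓ fun s => z (j, s))) (fun z => g (bitsPos hℓ ∘ z)) fun z => rfl]
  refine abs_expect_comp_sub_le (bitsPos hℓ) (by positivity)
    ((div_le_one (by positivity)).2 hpow) (fun p => ?_) hg hg1
  have h1 : ((2 ^ ℓ / ℓ : ℕ) : ℝ) ≤ (Finset.univ.filter fun b => bitsPos hℓ b = p).card := by
    exact_mod_cast card_bitsPos_ge hℓ p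
  refine le_trans ?_ h1
  have h2 : (2 ^ ℓ : ℝ) ≤ ((2 ^ ℓ / ℓ : ℕ) : ℝ) * ℓ + ℓ := by
    have := Nat.div_add_mod (2 ^ ℓ) ℓ
    have h3 := Nat.mod_lt (2 ^ ℓ) hℓ
    have h4 : 2 ^ ℓ ≤ 2 ^ ℓ / ℓ * ℓ + ℓ := by rw [mul_comm (2 ^ ℓ / ℓ)]; omega
    exact_mod_cast h4
  have h3 : (1 - (ℓ : ℝ) / 2 ^ ℓ) * (2 ^ ℓ / ℓ) = (2 ^ ℓ - ℓ) / ℓ := by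
    field_simp
  simp only [Fintype.card_fun, Fintype.card_bool, Fintype.card_fin, Nat.cast_pow, Nat.cast_ofNat]
  rw [h3, div_le_iff₀ hℓ']
  linarith

/-! ## The reduction -/

section reduction

variable {ℓ k ks : ℕ} {S : RAM}

theorem coinProb_le_one (M : RAM) (x : List Bool) {m : ℕ} (r : Fin m → Bool) (b : Bool) :
    coinProb M x r b ≤ 1 := measureReal_le_one

theorem kPCSuccess_of_usesMulti {m : ℕ} (hℓ : 0 < ℓ) (hS : S.IsMultiAccessRandomizedLogspace)
    (hu : ∀ G : SimpleGraph (Fin (ℓ * ks)), S.UsesMultiAtMost (encodeInstance ks G) m) :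
    kPCSuccess S ℓ ks =
      1 - 𝔼 e : Pairs (ℓ * ks) → Bool, 𝔼 r : Fin m → Bool,
        coinProb S (encodeInstance ks (ofBits e)) r true +
      𝔼 c : Fin ks → Fin ℓ, 𝔼 e : Pairs (ℓ * ks) → Bool, 𝔼 r : Fin m → Bool,
        coinProb S (encodeInstance ks (plantClique (cliqueSet c) (ofBits e))) r true := by
  rw [kPCSuccess, answerProb_erdosRenyi, answerProb_kPartitePlanted _ hℓ]
  simp only [prob_answers_eq_expect (hu _), coinProb_false hS, Finset.expect_sub_distrib,
    Fintype.expect_const]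

theorem kPCSuccess_of_reduction {M : RAM} (hℓ : 0 < ℓ) (hS : S.IsMultiAccessRandomizedLogspace)
    (hu : ∀ G : SimpleGraph (Fin (ℓ * ks)),
      S.UsesMultiAtMost (encodeInstance ks G) (ℓ * k * (ℓ * k)))
    {H : SimpleGraph (Fin (ℓ * (3 * k))) → SimpleGraph (Fin (ℓ * ks))}
    (hM : ∀ A ro ma b, M.Answers (encodeInstance (3 * k) A) ro ma b ↔
      S.Answers (encodeInstance ks (H A)) ro (simMulti (ℓ * k) A) b) :
    kPCSuccess M ℓ (3 * k) =
      1 - 𝔼 a : Pairs (ℓ * (3 * k)) → Bool, coinProb S (encodeInstance ks (H (ofBits a)))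
        (fun j : Fin (ℓ * k * (ℓ * k)) => simMulti (ℓ * k) (ofBits a) j) true +
      𝔼 c : Fin (3 * k) → Fin ℓ, 𝔼 a : Pairs (ℓ * (3 * k)) → Bool,
        coinProb S (encodeInstance ks (H (plantClique (cliqueSet c) (ofBits a))))
        (fun j : Fin (ℓ * k * (ℓ * k)) =>
          simMulti (ℓ * k) (plantClique (cliqueSet c) (ofBits a)) j) true := by
  have key : ∀ A b, (fairBits.prod fairBits).real
      {ω | M.Answers (encodeInstance (3 * k) A) ω.1 ω.2 b} =
      coinProb S (encodeInstance ks (H A))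
        (fun j : Fin (ℓ * k * (ℓ * k)) => simMulti (ℓ * k) A j) b := by
    intro A b
    simp only [hM]
    rw [prob_fst_fairBits fun ro => S.Answers (encodeInstance ks (H A)) ro (simMulti (ℓ * k) A) b,
      coinProb]
    refine congrArg fairBits.real (Set.ext fun ro => RAM.answers_congr_multi (hu _) ?_ b)
    intro a ha
    rw [extendBits, dif_pos ha]
  rw [kPCSuccess, answerProb_erdosRenyi, answerProb_kPartitePlanted _ hℓ]
  simp only [key, coinProb_false hS, Finset.expect_sub_distrib, Fintype.expect_const]

/-- The central cancellation. With exactly uniform clique positions the two terms with masked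
strings would agree and the difference would be zero; the nonuniformity costs `ks * ℓ / 2 ^ ℓ` once
for the fair and once for the masked string. -/
theorem abs_kPCSuccess_sub_le {M M' : RAM} (hℓ : 0 < ℓ) (h : ks ≤ k)
    (hcap : ℓ * ks * (ℓ * ks) + ℓ * ks ≤ 3 * k * (ℓ / 2 * (ℓ / 2)))
    (hS : S.IsMultiAccessRandomizedLogspace)
    (hu : ∀ G : SimpleGraph (Fin (ℓ * ks)),
      S.UsesMultiAtMost (encodeInstance ks G) (ℓ * k * (ℓ * k)))
    (hM : ∀ (A : SimpleGraph (Fin (ℓ * (3 * k)))) ro ma b,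
      M.Answers (encodeInstance (3 * k) A) ro ma b ↔
      S.Answers (encodeInstance ks (subGraph (ℓ * ks) A)) ro (simMulti (ℓ * k) A) b)
    (hM' : ∀ (A : SimpleGraph (Fin (ℓ * (3 * k)))) ro ma b,
      M'.Answers (encodeInstance (3 * k) A) ro ma b ↔
      S.Answers (encodeInstance ks (simGraph ℓ ks A)) ro (simMulti (ℓ * k) A) b) :
    |kPCSuccess S ℓ ks - (kPCSuccess M ℓ (3 * k) - kPCSuccess M' ℓ (3 * k) + 1)| ≤
      2 * (ks * (ℓ / 2 ^ ℓ)) := by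
  have : NeZero ℓ := ⟨hℓ.ne'⟩
  rw [kPCSuccess_of_usesMulti hℓ hS hu, kPCSuccess_of_reduction hℓ hS hu hM,
    kPCSuccess_of_reduction hℓ hS hu hM',
    expect_sub_null h fun G r => coinProb S (encodeInstance ks G) r true,
    expect_sub_planted hℓ h fun G r => coinProb S (encodeInstance ks G) r true,
    expect_sim_null hℓ hcap fun G r => coinProb S (encodeInstance ks G) r true,
    expect_sim_planted hℓ hcap fun G r => coinProb S (encodeInstance ks G) r true]
  have h1 := abs_expect_bitsPos_sub_le (n := ks) hℓ (g := fun c =>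
    𝔼 e : Pairs (ℓ * ks) → Bool, 𝔼 r : Fin (ℓ * k * (ℓ * k)) → Bool,
      coinProb S (encodeInstance ks (plantClique (cliqueSet c) (ofBits e))) r true)
    (fun c => Finset.expect_nonneg fun e _ => Finset.expect_nonneg fun r _ =>
      coinProb_nonneg _ _ _ _)
    (fun c => Finset.expect_le Finset.univ_nonempty fun e _ =>
      Finset.expect_le Finset.univ_nonempty fun r _ => coinProb_le_one _ _ _ _)
  have h2 := abs_expect_bitsPos_sub_le (n := ks) hℓ (g := fun c =>
    𝔼 c₂ : Fin (2 * k) → Fin ℓ, 𝔼 e : Pairs (ℓ * ks) → Bool,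
      𝔼 r : Fin (ℓ * k * (ℓ * k)) → Bool,
      coinProb S (encodeInstance ks (plantClique (cliqueSet c) (ofBits e)))
        (fun j => r j || cliqueBits c₂ j) true)
    (fun c => Finset.expect_nonneg fun c₂ _ => Finset.expect_nonneg fun e _ =>
      Finset.expect_nonneg fun r _ => coinProb_nonneg _ _ _ _)
    (fun c => Finset.expect_le Finset.univ_nonempty fun c₂ _ =>
      Finset.expect_le Finset.univ_nonempty fun e _ =>
      Finset.expect_le Finset.univ_nonempty fun r _ => coinProb_le_one _ _ _ _)
  rw [abs_le] at h1 h2 ⊢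
  constructor <;> linarith

end reduction

/-! ## Asymptotics of the parameters -/

theorem PolyBelow.isLittleO {ℓ k : ℕ → ℕ} (h : PolyBelow k ℓ) (hℓ : Tendsto ℓ atTop atTop) :
    (fun i => (k i : ℝ)) =o[atTop] fun i => (ℓ i : ℝ) := by
  obtain ⟨δ, hδ, hO⟩ := h
  have h1 : (fun x : ℝ => x ^ (1 - δ)) =o[atTop] fun x : ℝ => x := by
    refine Asymptotics.isLittleO_of_tendsto' ?_ ((tendsto_rpow_neg_atTop hδ).congr' ?_)
    · filter_upwards [eventually_ne_atTop 0] with x hx h using absurd h hx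
    · filter_upwards [eventually_gt_atTop 0] with x hx
      rw [sub_eq_add_neg, add_comm, Real.rpow_add_one hx.ne', mul_div_cancel_right₀ _ hx.ne']
  exact hO.trans_isLittleO (h1.comp_tendsto (tendsto_natCast_atTop_atTop.comp hℓ))

theorem PolyBelow.const_mul {ℓ k : ℕ → ℕ} (h : PolyBelow k ℓ) (c : ℕ) :
    PolyBelow (fun i => c * k i) ℓ := by
  obtain ⟨δ, hδ, hO⟩ := h
  refine ⟨δ, hδ, ?_⟩
  simpa using hO.const_mul_left (c : ℝ)

theorem PolyBelow.eventually_mul_le {ℓ k : ℕ → ℕ} (h : PolyBelow k ℓ)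
    (hℓ : Tendsto ℓ atTop atTop) : ∀ᶠ i in atTop, 6 * k i ≤ ℓ i := by
  filter_upwards [(h.isLittleO hℓ).bound (show (0 : ℝ) < 1 / 6 by norm_num)] with i hi
  simp only [Real.norm_natCast] at hi
  have : (6 : ℝ) * k i ≤ ℓ i := by linarith
  exact_mod_cast this

theorem sq_mul_le_of_le_div_sqrt {ℓ k ks : ℕ} (hℓ : 0 < ℓ)
    (h : (ks : ℝ) ≤ (k : ℝ) / Real.sqrt (ℓ : ℝ)) : ks * ks * ℓ ≤ k * k := by
  have h0 : 0 < Real.sqrt (ℓ : ℝ) := Real.sqrt_pos.2 (by exact_mod_cast hℓ)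
  rw [le_div_iff₀ h0] at h
  have h1 := mul_self_le_mul_self (by positivity) h
  rw [mul_mul_mul_comm, Real.mul_self_sqrt (Nat.cast_nonneg _)] at h1
  exact_mod_cast h1

/-- Both summands on the left are at most `ℓ * k ^ 2`. By `6 * k ≤ ℓ` their sum is at most `k * ℓ ^
2 / 3`, and `ℓ ≤ 3 * (ℓ / 2)` bounds this by the right side. -/
theorem capacity {ℓ k ks : ℕ} (h : ks * ks * ℓ ≤ k * k) (hk : 0 < k) (hks : ks ≤ k)
    (h6 : 6 * k ≤ ℓ) : ℓ * ks * (ℓ * ks) + ℓ * ks ≤ 3 * k * (ℓ / 2 * (ℓ / 2)) := by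
  have h3 : ℓ ≤ 3 * (ℓ / 2) := by omega
  have h1 : ℓ * ks * (ℓ * ks) ≤ ℓ * (k * k) := by
    calc _ = ℓ * (ks * ks * ℓ) := by ring
      _ ≤ _ := Nat.mul_le_mul_left _ h
  have h2 : ℓ * ks ≤ ℓ * (k * k) := Nat.mul_le_mul_left _ (hks.trans (Nat.le_mul_self k))
  have h4 : ℓ * ℓ ≤ 9 * (ℓ / 2 * (ℓ / 2)) := by
    calc _ ≤ 3 * (ℓ / 2) * (3 * (ℓ / 2)) := Nat.mul_le_mul h3 h3
      _ = _ := by ring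
  have h5 : ℓ * (k * k) * 6 ≤ k * (ℓ * ℓ) := by
    calc _ = k * (ℓ * (6 * k)) := by ring
      _ ≤ _ := Nat.mul_le_mul_left _ (Nat.mul_le_mul_left _ h6)
  have h7 : k * (ℓ * ℓ) ≤ k * (9 * (ℓ / 2 * (ℓ / 2))) := Nat.mul_le_mul_left _ h4
  have h8 : k * (9 * (ℓ / 2 * (ℓ / 2))) = 3 * (3 * k * (ℓ / 2 * (ℓ / 2))) := by ring
  omega

/-- Eventually `ks ≤ k ≤ ℓ`, so the error is at most `2 * ℓ ^ 2 / 2 ^ ℓ`. -/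
theorem tendsto_error {ℓ k ks : ℕ → ℕ} (hkℓ : PolyBelow k ℓ) (hℓ : Tendsto ℓ atTop atTop)
    (hks : ∀ i, ks i ≤ k i) :
    Tendsto (fun i => 2 * ((ks i : ℝ) * (ℓ i / 2 ^ ℓ i))) atTop (𝓝 0) := by
  have h1 : Tendsto (fun n : ℕ => 2 * ((n : ℝ) ^ 2 / 2 ^ n)) atTop (𝓝 0) := by
    simpa using (tendsto_pow_const_div_const_pow_of_one_lt 2 (one_lt_two (α := ℝ))).const_mul 2
  refine squeeze_zero' (.of_forall fun i => by positivity) ?_ (h1.comp hℓ)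
  filter_upwards [hkℓ.eventually_mul_le hℓ] with i hi
  have h2 : (ks i : ℝ) ≤ ℓ i := by exact_mod_cast (hks i).trans (by omega)
  simp only [Function.comp]
  rw [sq, mul_div_assoc]
  gcongr

/-- Assume the logspace `k`-partite planted clique conjecture, and let `ks ≤ k / √ℓ` be computable
from `ℓ * k` and `k` in logarithmic space.  Then no multiple access randomized logspace algorithm
that uses at most `(ℓ * k).choose 2` multiple access random bits on the instances of
`kPC_D(ℓ * ks, ks)` solves `kPC_D(ℓ * ks, ks)`. -/
theorem mainTheorem9 (ℓ k ks : ℕ → ℕ)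
    (hℓ : IsParamSeq ℓ) (hk : IsParamSeq k) (hks : IsParamSeq ks)
    (hℓ_top : Tendsto ℓ atTop atTop) (hkℓ : PolyBelow k ℓ)
    (hks_le : ∀ i, (ks i : ℝ) ≤ (k i : ℝ) / Real.sqrt (ℓ i : ℝ))
    (hks_comp : ComputableInLogSpace ℓ k ks)
    (hconj : KPCConjSpace) :
    ¬ ∃ S : RAM, S.IsMultiAccessRandomizedLogspace ∧
      (∀ (i : ℕ) (G : SimpleGraph (Fin (ℓ i * ks i))),
        S.UsesMultiAtMost (encodeInstance (ks i) G) ((ℓ i * k i).choose 2)) ∧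
      SolvesKPC S ℓ ks := by
  rintro ⟨S, hS, hSu, c, hc, hsol⟩
  obtain ⟨K, C₁, hK, hK', hKs⟩ := hks_comp
  have hsq : ∀ i, ks i * ks i * ℓ i ≤ k i * k i :=
    fun i => sq_mul_le_of_le_div_sqrt (hℓ.2 i) (hks_le i)
  have hksk : ∀ i, ks i ≤ k i := fun i => Nat.mul_self_le_mul_self_iff.1
    ((Nat.le_mul_of_pos_right _ (hℓ.2 i)).trans (hsq i))
  obtain ⟨M, hM, hMa⟩ := Reduction.exists_reduction hℓ.2 hk.2 hksk hK hK' hKs hS hSu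
    (fun _ => True) Reduction.readSub (fun i => subGraph (ℓ i * ks i))
    fun i _ A _ _ hB _ => Reduction.reads_sub (hksk i) A hB
  obtain ⟨M', hM', hMa'⟩ := Reduction.exists_reduction hℓ.2 hk.2 hksk hK hK' hKs hS hSu
    -- The simulated instance is correct only where enough clean bits are available, which holds for
    -- all large `i`; the subgraph reduction above needs no such restriction.
    (fun i => ℓ i * ks i * (ℓ i * ks i) + ℓ i * ks i ≤ 3 * k i * (ℓ i / 2 * (ℓ i / 2)))
    Reduction.readSim (fun i => simGraph (ℓ i) (ks i))
    fun i hcap A _ _ hB hℓB => Reduction.reads_sim A hB (hℓ.2 i) hℓB hcap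
  have h3k : IsParamSeq fun i => 3 * k i :=
    ⟨fun i j hij => Nat.mul_le_mul_left 3 (hk.1 hij), fun i => Nat.mul_pos (by norm_num) (hk.2 i)⟩
  have hlim := hconj M hM ℓ _ hℓ h3k hℓ_top (hkℓ.const_mul 3)
  have hlim' := hconj M' hM' ℓ _ hℓ h3k hℓ_top (hkℓ.const_mul 3)
  have hbound : ∀ᶠ i in atTop, kPCSuccess S (ℓ i) (ks i) ≤
      kPCSuccess M (ℓ i) (3 * k i) - kPCSuccess M' (ℓ i) (3 * k i) + 1 +
        2 * (ks i * (ℓ i / 2 ^ ℓ i)) := by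
    filter_upwards [hkℓ.eventually_mul_le hℓ_top] with i hi
    have hcap := capacity (hsq i) (hk.2 i) (hksk i) hi
    have hu : ∀ G : SimpleGraph (Fin (ℓ i * ks i)),
        S.UsesMultiAtMost (encodeInstance (ks i) G) (ℓ i * k i * (ℓ i * k i)) := by
      intro G ro ma t d a q h
      refine (hSu i G ro ma t d a q h).trans_le ?_
      rw [Nat.choose_two_right]
      exact (Nat.div_le_self _ _).trans (Nat.mul_le_mul_left _ (Nat.sub_le _ _))
    have := (abs_le.1 (abs_kPCSuccess_sub_le (hℓ.2 i) (hksk i) hcap hS hu (hMa i trivial)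
      (hMa' i hcap))).2
    linarith
  -- The upper bound for the success of `S` tends to `1 - 1 + 1 + 0 = 1`, although it is eventually
  -- at least `1 + c`.
  have hfinal := ((hlim.sub hlim').add_const 1).add (tendsto_error hkℓ hℓ_top hksk)
  have := ge_of_tendsto hfinal (hsol.and hbound |>.mono fun i hi => hi.1.trans hi.2)
  linarith
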